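/- For $k \ge 3$ let $d_k(1)$ be the poset with $2k-2$ elements consisting of two incomparable elements (the side elements), a chain of $k-2$ elements above both of them (the neck elements), and a chain of $k-2$ elements below both of them (the tail elements). Let $P$ be a finite poset. An interval $[p,q]$ of $P$ is a $d_k$-interval if it is isomorphic to $d_k(1)$, and a $d$-interval if it is a $d_k$-interval for some $k \ge 3$; its side and neck elements are those corresponding to the side and neck elements of $d_k(1)$. A subset of $P$ is $d_k^-$-convex if it is convex and isomorphic to $d_k(1)$ with its maximum removed, and $d^-$-convex if it is $d_k^-$-convex for some $k\ge 3$. The poset $P$ is $d$-complete if 1. for each $k\ge 3$ and each $d_k^-$-convex subset $I$ of $P$ there is an element $z \in P$ such that $I \cup \{z\}$ is a $d_k$-interval; 2. for each $d$-interval $[w,z]$, the element $z$ does not cover any element outside $[w,z]$; 3. there are no two distinct $d^-$-convex sets which differ only in their minimal elements. Let $P$ be $d$-complete. The diagonals of $P$ are the classes of the equivalence relation on $P$ generated by $p \sim q$ whenever $[p,q]$ is a $d$-interval; let $\mathcal D(P)$ be the set of diagonals. The hook vector $\mathbf h_P(p) = (h_P^{(D)}(p))_{D \in \mathcal D(P)}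 \in \mathbb Z^{\mathcal D(P)}$ of $p \in P$ is defined recursively: if $p$ is not a neck element of any $d$-interval, then $h_P^{(D)}(p)$ is the number of elements $q \in D$ with $q \le p$; if $p$ is the maximal element of a $d$-interval $[p',p]$ with side elements $w$ and $z$, then $\mathbf h_P(p) = \mathbf h_P(w) + \mathbf h_P(z) - \mathbf h_P(p')$. (Every neck element of a $d$-interval is the maximal element of a $d$-interval, and in a $d$-complete poset this $d$-interval is unique.) **Theorem.** For every $d$-complete poset $P$, the number of linear extensions of $P$ is $$\frac{|P|!}{\prod_{p \in P} \sum_{D \in \mathcal D(P)} h_P^{(D)}(p)}.$$ -/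

import Mathlib

namespace DComplete

/-- The underlying set of `d_k(1)`: a chain of `k - 2` tail elements, two side elements, and a chain
of `k - 2` neck elements. It is only used for `3 ≤ k`. -/
inductive DPoset (k : ℕ) : Type
  | tail (i : Fin (k - 2)) : DPoset k
  | side (b : Bool) : DPoset k
  | neck (i : Fin (k - 2)) : DPoset k

/-- The height of an element of `d_k(1)`; the two side elements share one height, and all other
elements have heights of their own. -/
def DPoset.level {k : ℕ} : DPoset k → ℕ
  | .tail i => i
  | .side _ => k - 2
  | .neck i => k - 1 + i

/-- The order of `d_k(1)`: the tail is a chain below the two incomparable side elements, and the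
neck is a chain above them. -/
instance DPoset.instPartialOrder (k : ℕ) : PartialOrder (DPoset k) where
  le x y := x = y ∨ x.level < y.level
  le_refl x := Or.inl rfl
  le_trans x y z hxy hyz := by
    rcases hxy with rfl | hxy
    · exact hyz
    · rcases hyz with rfl | hyz
      · exact Or.inr hxy
      · exact Or.inr (hxy.trans hyz)
  le_antisymm x y hxy hyx := by
    rcases hxy with h | h
    · exact h
    · rcases hyx with h' | h'
      · exact h'.symm
      · exact absurd h' h.asymm

theorem DPoset.le_iff {k : ℕ} {x y : DPoset k} : x ≤ y ↔ x = y ∨ x.level < y.level := Iff.rfl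

/-- A set `I` is a `d_k`-interval if it is an interval `[p, q]` isomorphic to `d_k(1)`. -/
def IsDkInterval {P : Type*} [PartialOrder P] (k : ℕ) (I : Set P) : Prop :=
  3 ≤ k ∧ ∃ p q : P, I = Set.Icc p q ∧ Nonempty (I ≃o DPoset k)

/-- A set `I` is `d_k^-`-convex if it is convex and isomorphic to `d_k(1)` without its maximum. -/
def IsDkMinusConvex {P : Type*} [PartialOrder P] (k : ℕ) (I : Set P) : Prop :=
  3 ≤ k ∧ I.OrdConnected ∧ Nonempty (I ≃o {x : DPoset k // ¬ IsTop x})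

/-- `[p, q]` is a `d`-interval, that is, a `d_k`-interval for some `k`. -/
def IsDInterval {P : Type*} [PartialOrder P] (p q : P) : Prop :=
  ∃ k, IsDkInterval k (Set.Icc p q)

/-- `[p, q]` is a `d`-interval with side elements `w` and `z`. -/
def IsDIntervalWithSides {P : Type*} [PartialOrder P] (p q w z : P) : Prop :=
  ∃ k, 3 ≤ k ∧ ∃ e : Set.Icc p q ≃o DPoset k,
    (e.symm (.side false) : P) = w ∧ (e.symm (.side true) : P) = z

/-- `p` is a neck element of some `d`-interval `[a, b]`. -/
def IsNeckElement {P : Type*} [PartialOrder P] (p : P) : Prop :=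
  ∃ k, 3 ≤ k ∧ ∃ (a b : P) (e : Set.Icc a b ≃o DPoset k) (i : Fin (k - 2)),
    (e.symm (.neck i) : P) = p

/-- `d`-complete posets (finiteness is a separate type class hypothesis). -/
structure IsDComplete (P : Type*) [PartialOrder P] : Prop where
  /-- Each `d_k^-`-convex set can be completed to a `d_k`-interval by adding one element. -/
  exists_completion : ∀ (k : ℕ) (I : Set P), IsDkMinusConvex k I →
    ∃ z : P, IsDkInterval k (insert z I)
  /-- The maximum of a `d`-interval covers no element outside of the interval. -/
  mem_of_covBy : ∀ w z : P, IsDInterval w z → ∀ x : P, x ⋖ z → x ∈ Set.Icc w z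
  /-- No two `d^-`-convex sets differ only in their minimal elements. -/
  eq_of_diff_min : ∀ (k l : ℕ) (I J : Set P), IsDkMinusConvex k I → IsDkMinusConvex l J →
    ∀ a b : P, IsLeast I a → IsLeast J b → I \ {a} = J \ {b} → I = J

/-- The equivalence relation generated by `p ∼ q` whenever `[p, q]` is a `d`-interval. -/
def diagonalSetoid (P : Type*) [PartialOrder P] : Setoid P :=
  Relation.EqvGen.setoid (IsDInterval (P := P))

/-- The set of diagonals of `P`. -/
def Diagonal (P : Type*) [PartialOrder P] : Type _ := Quotient (diagonalSetoid P)

/-- The diagonal `D(p)` containing `p`. -/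
def diagonalOf {P : Type*} [PartialOrder P] (p : P) : Diagonal P :=
  Quotient.mk (diagonalSetoid P) p

noncomputable instance Diagonal.instFintype (P : Type*) [PartialOrder P] [Fintype P] :
    Fintype (Diagonal P) :=
  @Fintype.ofFinite _ (Finite.of_surjective (diagonalOf (P := P)) Quotient.mk_surjective)

theorem IsDIntervalWithSides.lt {P : Type*} [PartialOrder P] {p q w z : P}
    (h : IsDIntervalWithSides p q w z) : w < q ∧ z < q ∧ p < q := by
  obtain ⟨k, hk, e, rfl, rfl⟩ := h
  have key : ∀ b, (e.symm (.side b) : P) < q := by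
    intro b
    have h1 : e.symm (.side b) < e.symm (.neck ⟨0, by omega⟩) := by
      rw [e.symm.lt_iff_lt]
      refine lt_of_le_of_ne (Or.inr ?_) (by simp)
      simp only [DPoset.level]
      omega
    exact lt_of_lt_of_le h1 (e.symm (.neck ⟨0, by omega⟩)).2.2
  exact ⟨key _, key _, lt_of_le_of_lt (e.symm (.side false)).2.1 (key false)⟩

theorem isDInterval_iff {P : Type*} [PartialOrder P] {p q : P} :
    IsDInterval p q ↔ ∃ w z, IsDIntervalWithSides p q w z := by
  constructor
  · rintro ⟨k, hk, _, _, _, ⟨e⟩⟩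
    exact ⟨_, _, k, hk, e, rfl, rfl⟩
  · rintro ⟨_, _, k, hk, e, _, _⟩
    exact ⟨k, hk, p, q, rfl, ⟨e⟩⟩

/-- The neck elements of `d`-intervals are exactly the maxima of `d`-intervals, so that the two cases
in the definition of hook vectors are exhaustive and mutually exclusive. -/
theorem isNeckElement_iff {P : Type*} [PartialOrder P] {p : P} :
    IsNeckElement p ↔ ∃ p' w z, IsDIntervalWithSides p' p w z := by
  constructor
  · rintro ⟨k, hk, a, b, e, i, rfl⟩
    have hi := i.2
    let f : DPoset (i + 3) → DPoset k := fun x => match x with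
      | .tail j => .tail ⟨j + (k - 3 - i), by omega⟩
      | .side c => .side c
      | .neck j => .neck ⟨j, by omega⟩
    have hf : ∀ x y, f x ≤ f y ↔ x ≤ y := by
      rintro (x | x | x) (y | y | y) <;>
        simp only [DPoset.le_iff, DPoset.level, f, DPoset.tail.injEq, DPoset.side.injEq,
          DPoset.neck.injEq, Fin.ext_iff, reduceCtorEq, false_or, lt_irrefl, or_false] <;> omega
    let f' : DPoset (i + 3) ↪o DPoset k := OrderEmbedding.ofMapLEIff f hf
    let g : DPoset (i + 3) ↪o P :=
      (f'.trans e.symm.toOrderEmbedding).trans (OrderEmbedding.subtype (· ∈ Set.Icc a b))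
    have hr : Set.range g = Set.Icc (g (.tail ⟨0, by omega⟩)) (e.symm (.neck i)) := by
      ext y
      constructor
      · rintro ⟨x, rfl⟩
        refine ⟨g.le_iff_le.2 ?_, ?_⟩
        · rcases x with x | x | x <;>
            simp only [DPoset.le_iff, DPoset.level, DPoset.tail.injEq, Fin.ext_iff,
              reduceCtorEq, false_or] <;> omega
        · change e.symm (f x) ≤ e.symm (.neck i)
          rw [e.symm.le_iff_le]
          rcases x with x | x | x <;>
            simp only [DPoset.le_iff, DPoset.level, f, DPoset.neck.injEq, Fin.ext_iff,
              reduceCtorEq, false_or] <;> omega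
      · rintro ⟨h1, h2⟩
        have hy : y ∈ Set.Icc a b :=
          ⟨le_trans (e.symm _).2.1 h1, le_trans h2 (e.symm _).2.2⟩
        obtain ⟨v, hv⟩ := e.symm.surjective ⟨y, hy⟩
        obtain rfl : (e.symm v : P) = y := by rw [hv]
        replace h1 : e.symm (f (.tail ⟨0, by omega⟩)) ≤ e.symm v := h1
        replace h2 : e.symm v ≤ e.symm (.neck i) := h2
        rw [e.symm.le_iff_le] at h1 h2
        rcases v with v | v | v
        · simp only [DPoset.le_iff, DPoset.level, f, DPoset.tail.injEq, Fin.ext_iff] at h1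
          refine ⟨.tail ⟨v - (k - 3 - i), by omega⟩, ?_⟩
          change (e.symm (.tail _) : P) = _
          congr 3
          simp only [Fin.ext_iff]
          omega
        · exact ⟨.side v, rfl⟩
        · simp only [DPoset.le_iff, DPoset.level, DPoset.neck.injEq, Fin.ext_iff] at h2
          exact ⟨.neck ⟨v, by omega⟩, rfl⟩
    exact ⟨_, _, _, i + 3, by omega, ((OrderIso.setCongr _ _ hr).symm.trans g.orderIso.symm),
      rfl, rfl⟩
  · rintro ⟨p', w, z, k, hk, e, -, -⟩
    refine ⟨k, hk, p', p, e, ⟨k - 3, by omega⟩, le_antisymm (e.symm _).2.2 ?_⟩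
    have hp : p' ≤ p := (e.symm (.side true)).2.1.trans (e.symm (.side true)).2.2
    have h : e ⟨p, hp, le_rfl⟩ ≤ .neck ⟨k - 3, by omega⟩ := by
      generalize e ⟨p, hp, le_rfl⟩ = x
      rcases x with x | x | x <;>
        simp only [DPoset.le_iff, DPoset.level, DPoset.neck.injEq, Fin.ext_iff,
          reduceCtorEq, false_or] <;> omega
    exact e.le_symm_apply.2 h

open Classical in
/-- The hook vector of `p`, as a function on diagonals, by recursion along `<`. If `p` is the maximum
of a `d`-interval `[p', p]` with side elements `w` and `z`, it is `h(w) + h(z) - h(p')`; otherwise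
(that is, if `p` is not a neck element) its entry at `D` is the number of elements of `D` that are at
most `p`. In a `d`-complete poset `p'` and the set `{w, z}` are determined by `p`. -/
noncomputable def hookVector {P : Type*} [PartialOrder P] [Fintype P] : P → Diagonal P → ℤ :=
  (wellFounded_lt (α := P)).fix fun p rec =>
    if h : ∃ t : P × P × P, IsDIntervalWithSides t.1 p t.2.1 t.2.2 then
      rec h.choose.2.1 h.choose_spec.lt.1 + rec h.choose.2.2 h.choose_spec.lt.2.1 -
        rec h.choose.1 h.choose_spec.lt.2.2
    else fun D => ({q : P | q ≤ p ∧ diagonalOf q = D}.ncard : ℤ)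

theorem hookVector_of_not_isNeckElement {P : Type*} [PartialOrder P] [Fintype P] {p : P}
    (hp : ¬ IsNeckElement p) (D : Diagonal P) :
    hookVector p D = ({q : P | q ≤ p ∧ diagonalOf q = D}.ncard : ℤ) := by
  rw [hookVector, WellFounded.fix_eq, dif_neg]
  rintro ⟨t, ht⟩
  exact hp (isNeckElement_iff.2 ⟨_, _, _, ht⟩)

theorem exists_hookVector_of_isNeckElement {P : Type*} [PartialOrder P] [Fintype P] {p : P}
    (hp : IsNeckElement p) : ∃ p' w z, IsDIntervalWithSides p' p w z ∧
      hookVector p = hookVector w + hookVector z - hookVector p' := by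
  have h : ∃ t : P × P × P, IsDIntervalWithSides t.1 p t.2.1 t.2.2 := by
    obtain ⟨p', w, z, h⟩ := isNeckElement_iff.1 hp
    exact ⟨(p', w, z), h⟩
  refine ⟨_, _, _, h.choose_spec, ?_⟩
  conv_lhs => rw [hookVector, WellFounded.fix_eq, dif_pos h]
  rfl

/-- The hook length of `p`: the sum of the entries of its hook vector. -/
noncomputable def hookLength {P : Type*} [PartialOrder P] [Fintype P] (p : P) : ℤ :=
  ∑ D : Diagonal P, hookVector p D

/-- Linear extensions of `P`: order-preserving bijections onto the chain `0 < 1 < ⋯ < |P| - 1`. -/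
def LinExt (P : Type*) [PartialOrder P] [Fintype P] : Type _ :=
  {f : P ≃ Fin (Fintype.card P) // Monotone f}

end DComplete

/-! The poset is turned into a heap. There is a colouring of `P` and a forest on the colours (a
simply laced Dynkin diagram) such that elements of equal or adjacent colour are comparable and the
`d`-intervals are exactly the intervals between consecutive elements of one colour
(`IsDComplete.exists_heapColoring`). It is built by adding minimal elements one at a time. If a new
element is the minimum of a `d`-interval, it takes the colour of the maximum of that interval;
otherwise it gets a new colour, attached to at most one old colour. The three conditions of
`d`-completeness are what make this consistent.

In Weyl group terms, a linear extension read from the top down is then a word of a minuscule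
element. Each `p` carries a root: the simple root of its colour, transformed by the reflections of
the elements below it. The sum of the hook vector of `p` is the value of this root where all simple
roots equal `1` (`hookLength_eq_root`). If `p` is the lowest element of its colour, its root is the
sum of the colours of the elements at most `p` (`root_eq_sum`). For neck elements, roots obey the
recursion that defines hook vectors (`root_neck`). The delicate input is `sum_cartan_Icc_eq_one`:
the colour of the minimum of certain intervals pairs to `1` with the interval. A smallest
counterexample would pair nonpositively with every colour, and comparing its norm with a dominant
weight forbids this (`not_antidominant`).

The product formula is a shadow of equivariant Schubert calculus. For each upper set `F` there is a
function `ψ` of upper sets `Q`, the localization at `F` of the class of `Q`, with `ψ ∅ = 1`, with `ψ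
F` equal to the product of the roots of `F`, and with the Chevalley formula (sum of the colours of
`F` minus sum of the colours of `Q`) · `ψ Q` = sum of `ψ (insert x Q)` over addable `x`. It is
constructed by recursion on `F` (`isLocalization_insert`), so no Weyl group is needed. The recursion
preserves the Chevalley formula because the weight of `Q` pairs with a colour as the number of
addable minus the number of removable elements of that colour (`card_addable_sub_card_removable`).

For `F = P` and all simple roots equal to `1`, the Chevalley formula reads `(|P| - |Q|) ψ Q = ∑ ψ
(insert x Q)`. Iterating it from `∅` up to `P` along all ways of adding elements gives `|P|! = e(P)
· ψ P`, where `e(P)` is the number of linear extensions. -/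

namespace DComplete

open Set

/-! ### Peeling minimum and maximum off `d_{k+1}(1)` to get `d_k(1)`. -/

section Charts

/-- The embedding of `d_k(1)` into `d_{k+1}(1)` as the complement of the minimum and the maximum. -/
def DPoset.shift {k : ℕ} : DPoset k → DPoset (k + 1)
  | .tail i => .tail ⟨i + 1, by omega⟩
  | .side b => .side b
  | .neck i => .neck ⟨i, by omega⟩

/-- The minimum of `d_k(1)`. -/
def DPoset.bot {k : ℕ} (hk : 3 ≤ k) : DPoset k := .tail ⟨0, by omega⟩

/-- The maximum of `d_k(1)`. -/
def DPoset.top {k : ℕ} (hk : 3 ≤ k) : DPoset k := .neck ⟨k - 3, by omega⟩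

theorem DPoset.shift_le_iff {k : ℕ} (hk : 3 ≤ k) {x y : DPoset k} :
    x.shift ≤ y.shift ↔ x ≤ y := by
  rcases x with x | x | x <;> rcases y with y | y | y <;>
    simp only [DPoset.le_iff, DPoset.level, DPoset.shift, DPoset.tail.injEq, DPoset.side.injEq,
      DPoset.neck.injEq, Fin.ext_iff, reduceCtorEq, false_or, lt_irrefl, or_false] <;> omega

theorem DPoset.bot_le {k : ℕ} (hk : 3 ≤ k) (x : DPoset k) : DPoset.bot hk ≤ x := by
  rcases x with x | x | x <;>
    simp only [DPoset.le_iff, DPoset.level, DPoset.bot, DPoset.tail.injEq, Fin.ext_iff,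
      reduceCtorEq, false_or] <;> omega

theorem DPoset.le_top {k : ℕ} (hk : 3 ≤ k) (x : DPoset k) : x ≤ DPoset.top hk := by
  rcases x with x | x | x <;>
    simp only [DPoset.le_iff, DPoset.level, DPoset.top, DPoset.neck.injEq, Fin.ext_iff,
      reduceCtorEq, false_or] <;> omega

theorem DPoset.isTop_iff {k : ℕ} (hk : 3 ≤ k) {x : DPoset k} : IsTop x ↔ x = DPoset.top hk :=
  ⟨fun h => le_antisymm (DPoset.le_top hk x) (h _), fun h y => h ▸ DPoset.le_top hk y⟩

theorem DPoset.eq_bot_or_top_or_shift {k : ℕ} (hk : 3 ≤ k) (x : DPoset (k + 1)) :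
    x = DPoset.bot (by omega) ∨ x = DPoset.top (by omega) ∨ ∃ y : DPoset k, x = y.shift := by
  rcases x with ⟨i, hi⟩ | b | ⟨i, hi⟩
  · rcases i with _ | i
    · exact Or.inl rfl
    · exact Or.inr (Or.inr ⟨.tail ⟨i, by omega⟩, rfl⟩)
  · exact Or.inr (Or.inr ⟨.side b, rfl⟩)
  · by_cases h : i = k - 2
    · refine Or.inr (Or.inl ?_)
      simp only [DPoset.top, DPoset.neck.injEq, Fin.ext_iff]
      omega
    · exact Or.inr (Or.inr ⟨.neck ⟨i, by omega⟩, rfl⟩)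

theorem DPoset.bot_ne_shift {k : ℕ} (hk : 3 ≤ k + 1) (x : DPoset k) :
    DPoset.bot hk ≠ x.shift := by
  rcases x with x | x | x <;> simp [DPoset.bot, DPoset.shift]

theorem DPoset.top_ne_shift {k : ℕ} (hk : 3 ≤ k) (x : DPoset k) :
    DPoset.top (k := k + 1) (by omega) ≠ x.shift := by
  rcases x with x | x | x <;> simp [DPoset.top, DPoset.shift]
  omega

theorem DPoset.bot_ne_top {k : ℕ} (hk : 3 ≤ k) : DPoset.bot hk ≠ DPoset.top hk := by
  simp [DPoset.bot, DPoset.top]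

variable {P : Type*}

open Classical in
/-- Extend a map on `d_k(1)` to `d_{k+1}(1)` by prescribing the images of minimum and maximum. -/
noncomputable def DPoset.extend {k : ℕ} (f : DPoset k → P) (m t : P) (x : DPoset (k + 1)) : P :=
  if h : ∃ y : DPoset k, x = y.shift then f h.choose else
    if ∃ h, x = DPoset.bot h then m else t

theorem DPoset.shift_injective {k : ℕ} (hk : 3 ≤ k) {x y : DPoset k} (h : x.shift = y.shift) :
    x = y :=
  le_antisymm ((DPoset.shift_le_iff hk).1 h.le) ((DPoset.shift_le_iff hk).1 h.ge)

theorem DPoset.extend_shift {k : ℕ} (hk : 3 ≤ k) (f : DPoset k → P) (m t : P) (x : DPoset k) :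
    DPoset.extend f m t x.shift = f x := by
  have h : ∃ y : DPoset k, x.shift = y.shift := ⟨x, rfl⟩
  rw [DPoset.extend, dif_pos h]
  exact congrArg f (DPoset.shift_injective hk h.choose_spec).symm

theorem DPoset.extend_bot {k : ℕ} (hk : 3 ≤ k + 1) (f : DPoset k → P) (m t : P) :
    DPoset.extend f m t (DPoset.bot hk) = m := by
  rw [DPoset.extend, dif_neg, if_pos ⟨hk, rfl⟩]
  rintro ⟨y, hy⟩
  exact DPoset.bot_ne_shift _ _ hy

theorem DPoset.extend_top {k : ℕ} (hk : 3 ≤ k) (f : DPoset k → P) (m t : P) :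
    DPoset.extend f m t (DPoset.top (by omega)) = t := by
  rw [DPoset.extend, dif_neg, if_neg]
  · rintro ⟨h, hy⟩
    exact DPoset.bot_ne_top _ hy.symm
  · rintro ⟨y, hy⟩
    exact DPoset.top_ne_shift hk _ hy

end Charts

/-! ### Inductive description of `d`-intervals. -/

variable {P : Type*} [PartialOrder P]

/-- `DInt k p q w z`: the interval `[p, q]` is a `d_k`-interval with sides `w` and `z`, described by
its covering relations. -/
inductive DInt : ℕ → P → P → P → P → Prop
  | base {p q w z : P} (hpw : p ⋖ w) (hpz : p ⋖ z) (hwq : w ⋖ q) (hzq : z ⋖ q) (hwz : w ≠ z)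
      (hI : Icc p q = {p, w, z, q}) : DInt 3 p q w z
  | step {k : ℕ} {p q w z p' q' : P} (h : DInt k p q w z) (hp : p' ⋖ p) (hq : q ⋖ q')
      (hI : Icc p' q' = insert p' (insert q' (Icc p q))) : DInt (k + 1) p' q' w z

theorem DInt.three_le {k : ℕ} {p q w z : P} (h : DInt k p q w z) : 3 ≤ k := by
  induction h with
  | base => exact le_rfl
  | step _ _ _ _ ih => omega

theorem DInt.lt_sides {k : ℕ} {p q w z : P} (h : DInt k p q w z) :
    p < w ∧ p < z ∧ w < q ∧ z < q ∧ ¬ w ≤ z ∧ ¬ z ≤ w := by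
  induction h with
  | base hpw hpz hwq hzq hwz hI =>
    refine ⟨hpw.lt, hpz.lt, hwq.lt, hzq.lt, fun h => ?_, fun h => ?_⟩
    · exact hpz.2 hpw.lt (lt_of_le_of_ne h hwz)
    · exact hpw.2 hpz.lt (lt_of_le_of_ne h hwz.symm)
  | step _ hp hq _ ih =>
    exact ⟨hp.lt.trans ih.1, hp.lt.trans ih.2.1, ih.2.2.1.trans hq.lt, ih.2.2.2.1.trans hq.lt,
      ih.2.2.2.2⟩

theorem DInt.lt {k : ℕ} {p q w z : P} (h : DInt k p q w z) : p < q :=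
  h.lt_sides.1.trans h.lt_sides.2.2.1

theorem DInt.exists_chart {k : ℕ} {p q w z : P} (h : DInt k p q w z) :
    ∃ f : DPoset k → P, (∀ x y, f x ≤ f y ↔ x ≤ y) ∧ range f = Icc p q ∧
      f (.side false) = w ∧ f (.side true) = z := by
  induction h with
  | @base p q w z hpw hpz hwq hzq hwz hI =>
    have hd := (DInt.base hpw hpz hwq hzq hwz hI).lt_sides
    have hd' := (DInt.base hpw hpz hwq hzq hwz hI).lt
    refine ⟨fun x => match x with
      | .tail _ => p
      | .side b => if b then z else w
      | .neck _ => q, ?_, ?_, rfl, rfl⟩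
    · rintro (⟨x, hx⟩ | x | ⟨x, hx⟩) (⟨y, hy⟩ | y | ⟨y, hy⟩)
      · simp [show x = y by omega]
      · cases y <;> simp [DPoset.le_iff, DPoset.level, hd.1.le, hd.2.1.le, show x = 0 by omega]
      · simp [DPoset.le_iff, DPoset.level, hd'.le]; omega
      · cases x <;> simp [DPoset.le_iff, DPoset.level, hd.1.not_ge, hd.2.1.not_ge] <;> omega
      · cases x <;> cases y <;> simp [DPoset.le_iff, DPoset.level, hd.2.2.2.2.1, hd.2.2.2.2.2]
      · cases x <;>
          simp [DPoset.le_iff, DPoset.level, hd.2.2.1.le, hd.2.2.2.1.le] <;> omega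
      · simp [DPoset.le_iff, DPoset.level, hd'.not_ge]; omega
      · cases y <;> simp [DPoset.le_iff, DPoset.level, hd.2.2.1.not_ge, hd.2.2.2.1.not_ge]
      · simp [show x = y by omega]
    · rw [hI]
      ext v
      constructor
      · rintro ⟨x | (_ | _) | x, rfl⟩ <;> simp
      · rintro (rfl | rfl | rfl | rfl)
        · exact ⟨.tail ⟨0, by omega⟩, rfl⟩
        · exact ⟨.side false, rfl⟩
        · exact ⟨.side true, rfl⟩
        · exact ⟨.neck ⟨0, by omega⟩, rfl⟩
  | @step k p q w z p' q' h hp hq hI ih =>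
    obtain ⟨f, hf, hr, h1, h2⟩ := ih
    have hk := h.three_le
    have hmem : ∀ x, p ≤ f x ∧ f x ≤ q := fun x => mem_Icc.1 (hr ▸ mem_range_self x)
    have hpq : p' < q' := hp.lt.trans (h.lt.trans hq.lt)
    refine ⟨DPoset.extend f p' q', ?_, ?_, ?_, ?_⟩
    · intro x y
      rcases DPoset.eq_bot_or_top_or_shift hk x with rfl | rfl | ⟨x, rfl⟩ <;>
        rcases DPoset.eq_bot_or_top_or_shift hk y with rfl | rfl | ⟨y, rfl⟩ <;>
        simp only [DPoset.extend_bot, DPoset.extend_top hk, DPoset.extend_shift hk, le_refl,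
          DPoset.bot_le, DPoset.le_top, hpq.le, iff_true]
      · exact hp.le.trans (hmem y).1
      · exact iff_of_false hpq.not_ge
          fun h' => DPoset.bot_ne_top _ (le_antisymm (DPoset.bot_le _ _) h')
      · exact iff_of_false (((hmem y).2.trans_lt hq.lt).not_ge)
          fun h' => DPoset.top_ne_shift hk _ (le_antisymm h' (DPoset.le_top _ _))
      · exact iff_of_false ((hp.lt.trans_le (hmem x).1).not_ge)
          fun h' => DPoset.bot_ne_shift _ _ (le_antisymm (DPoset.bot_le _ _) h')
      · exact (hmem x).2.trans hq.le
      · rw [hf, DPoset.shift_le_iff hk]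
    · rw [hI, ← hr]
      ext v
      constructor
      · rintro ⟨x, rfl⟩
        rcases DPoset.eq_bot_or_top_or_shift hk x with rfl | rfl | ⟨x, rfl⟩
        · simp [DPoset.extend_bot]
        · simp [DPoset.extend_top hk]
        · simp [DPoset.extend_shift hk]
      · rintro (rfl | rfl | ⟨x, rfl⟩)
        · exact ⟨_, DPoset.extend_bot (by omega) _ _ _⟩
        · exact ⟨_, DPoset.extend_top hk _ _ _⟩
        · exact ⟨_, DPoset.extend_shift hk _ _ _ _⟩
    · rw [← h1]
      exact DPoset.extend_shift hk f p' q' (.side false)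
    · rw [← h2]
      exact DPoset.extend_shift hk f p' q' (.side true)

theorem dInt_of_chart {k : ℕ} (hk : 3 ≤ k) : ∀ {p q : P} (f : DPoset k → P),
    (∀ x y, f x ≤ f y ↔ x ≤ y) → range f = Icc p q →
      DInt k p q (f (.side false)) (f (.side true)) := by
  have inj {k : ℕ} (f : DPoset k → P) (hf : ∀ x y, f x ≤ f y ↔ x ≤ y) : Function.Injective f :=
    fun x y h => le_antisymm ((hf _ _).1 h.le) ((hf _ _).1 h.ge)
  have ends {k : ℕ} (hk : 3 ≤ k) (p q : P) (f : DPoset k → P) (hf : ∀ x y, f x ≤ f y ↔ x ≤ y)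
      (hr : range f = Icc p q) : p = f (.bot hk) ∧ q = f (.top hk) := by
    have h0 : p ≤ q := (hr ▸ mem_range_self (DPoset.bot hk) : _ ∈ Icc p q).1.trans
      (hr ▸ mem_range_self (DPoset.bot hk) : _ ∈ Icc p q).2
    constructor
    · obtain ⟨x, hx⟩ : p ∈ range f := hr ▸ left_mem_Icc.2 h0
      refine le_antisymm (hr ▸ mem_range_self (DPoset.bot hk) : _ ∈ Icc p q).1 ?_
      rw [← hx, hf]
      exact DPoset.bot_le _ _
    · obtain ⟨x, hx⟩ : q ∈ range f := hr ▸ right_mem_Icc.2 h0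
      refine le_antisymm ?_ (hr ▸ mem_range_self (DPoset.top hk) : _ ∈ Icc p q).2
      rw [← hx, hf]
      exact DPoset.le_top _ _
  have cov {k : ℕ} (hk : 3 ≤ k) (p q : P) (f : DPoset k → P) (hf : ∀ x y, f x ≤ f y ↔ x ≤ y)
      (hr : range f = Icc p q) (x y : DPoset k) (h1 : x < y) (h2 : ∀ z, x < z → ¬ z < y) :
      f x ⋖ f y := by
    have hlt : ∀ x y, f x < f y ↔ x < y := fun x y => by simp [lt_iff_le_not_ge, hf]
    refine ⟨(hlt _ _).2 h1, fun v hv hv' => ?_⟩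
    obtain ⟨z, rfl⟩ : v ∈ range f := by
      rw [hr]
      exact ⟨(hr ▸ mem_range_self x : _ ∈ Icc p q).1.trans hv.le,
        hv'.le.trans (hr ▸ mem_range_self y : _ ∈ Icc p q).2⟩
    exact h2 z ((hlt _ _).1 hv) ((hlt _ _).1 hv')
  induction k, hk using Nat.le_induction with
  | base =>
    intro p q f hf hr
    obtain ⟨rfl, rfl⟩ := ends le_rfl p q f hf hr
    have hc := cov le_rfl _ _ f hf hr
    have low : ∀ b, f (DPoset.bot le_rfl) ⋖ f (.side b) := fun b => by
      refine hc _ _ ?_ ?_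
      · exact lt_of_le_of_ne (DPoset.bot_le _ _) (by simp [DPoset.bot])
      · rintro (⟨z, hz⟩ | z | z) h1 h2 <;>
          simp [lt_iff_le_and_ne, DPoset.le_iff, DPoset.level, DPoset.bot] at h1 h2
        omega
    have high : ∀ b, f (.side b) ⋖ f (DPoset.top le_rfl) := fun b => by
      refine hc _ _ ?_ ?_
      · exact lt_of_le_of_ne (DPoset.le_top _ _) (by simp [DPoset.top])
      · rintro (⟨z, hz⟩ | z | ⟨z, hz⟩) h1 h2 <;>
          simp [lt_iff_le_and_ne, DPoset.le_iff, DPoset.level, DPoset.top] at h1 h2 <;> omega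
    refine .base (low _) (low _) (high _) (high _) (fun h => by simpa using inj f hf h) ?_
    rw [← hr]
    ext v
    constructor
    · rintro ⟨⟨x, hx⟩ | (_ | _) | ⟨x, hx⟩, rfl⟩
      · obtain rfl : x = 0 := by omega
        exact Or.inl rfl
      · exact Or.inr (Or.inl rfl)
      · exact Or.inr (Or.inr (Or.inl rfl))
      · obtain rfl : x = 0 := by omega
        exact Or.inr (Or.inr (Or.inr rfl))
    · rintro (rfl | rfl | rfl | rfl) <;> exact mem_range_self _
  | succ k hk ih =>
    intro p q f hf hr
    obtain ⟨rfl, rfl⟩ := ends (by omega) p q f hf hr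
    have hc := cov (by omega) _ _ f hf hr
    have hf' : ∀ x y : DPoset k, f x.shift ≤ f y.shift ↔ x ≤ y := fun x y => by
      rw [hf, DPoset.shift_le_iff hk]
    have hI : range (fun x : DPoset k => f x.shift) =
        Icc (f (DPoset.bot hk).shift) (f (DPoset.top hk).shift) := by
      ext v
      constructor
      · rintro ⟨x, rfl⟩
        exact ⟨(hf' _ _).2 (DPoset.bot_le _ _), (hf' _ _).2 (DPoset.le_top _ _)⟩
      · rintro ⟨h1, h2⟩
        obtain ⟨x, rfl⟩ : v ∈ range f := by
          rw [hr]
          exact ⟨((hf _ _).2 (DPoset.bot_le _ _)).trans h1,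
            h2.trans ((hf _ _).2 (DPoset.le_top _ _))⟩
        rw [hf] at h1 h2
        rcases DPoset.eq_bot_or_top_or_shift hk x with rfl | rfl | ⟨x, rfl⟩
        · exact (DPoset.bot_ne_shift _ _ (le_antisymm (DPoset.bot_le _ _) h1)).elim
        · exact (DPoset.top_ne_shift hk _ (le_antisymm h2 (DPoset.le_top _ _))).elim
        · exact ⟨x, rfl⟩
    refine .step (ih (fun x => f x.shift) hf' hI) (hc _ _ ?_ ?_) (hc _ _ ?_ ?_) ?_
    · exact lt_of_le_of_ne (DPoset.bot_le _ _) (DPoset.bot_ne_shift _ _)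
    · rintro (z | z | z) h1 h2 <;>
        simp [lt_iff_le_and_ne, DPoset.le_iff, DPoset.level, DPoset.bot, DPoset.shift] at h1 h2 <;>
        omega
    · exact lt_of_le_of_ne (DPoset.le_top _ _) (DPoset.top_ne_shift hk _).symm
    · rintro (⟨z, hz⟩ | z | ⟨z, hz⟩) h1 h2 <;>
        simp [lt_iff_le_and_ne, DPoset.le_iff, DPoset.level, DPoset.top, DPoset.shift] at h1 h2 <;>
        omega
    · rw [← hI, ← hr]
      ext v
      constructor
      · rintro ⟨x, rfl⟩
        rcases DPoset.eq_bot_or_top_or_shift hk x with rfl | rfl | ⟨x, rfl⟩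
        · exact Or.inl rfl
        · exact Or.inr (Or.inl rfl)
        · exact Or.inr (Or.inr ⟨x, rfl⟩)
      · rintro (rfl | rfl | ⟨x, rfl⟩) <;> exact mem_range_self _

theorem dInt_of_orderIso {k : ℕ} (hk : 3 ≤ k) {p q : P} (e : Icc p q ≃o DPoset k) :
    DInt k p q (e.symm (.side false)) (e.symm (.side true)) := by
  refine dInt_of_chart hk (fun x => (e.symm x : P)) (fun x y => ?_) ?_
  · exact e.symm.le_iff_le
  · ext v
    constructor
    · rintro ⟨x, rfl⟩
      exact (e.symm x).2
    · intro hv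
      exact ⟨e ⟨v, hv⟩, by simp⟩

/-- The translation that permits induction on `k`: a `d`-interval is a diamond, or a smaller
`d`-interval with a new minimum and a new maximum. -/
theorem isDIntervalWithSides_iff {p q w z : P} :
    IsDIntervalWithSides p q w z ↔ ∃ k, DInt k p q w z := by
  constructor
  · rintro ⟨k, hk, e, rfl, rfl⟩
    exact ⟨k, dInt_of_orderIso hk e⟩
  · rintro ⟨k, h⟩
    obtain ⟨f, hf, hr, rfl, rfl⟩ := h.exists_chart
    let g : DPoset k ↪o P := OrderEmbedding.ofMapLEIff f hf
    exact ⟨k, h.three_le, (OrderIso.setCongr _ _ hr).symm.trans g.orderIso.symm, rfl, rfl⟩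

theorem DInt.isDInterval {k : ℕ} {p q w z : P} (h : DInt k p q w z) : IsDInterval p q :=
  isDInterval_iff.2 ⟨w, z, isDIntervalWithSides_iff.2 ⟨k, h⟩⟩

/-- Below its maximum, a `d_{k+1}`-interval is a `d_k`-interval with a new minimum. -/
theorem DInt.isDkMinusConvex {k : ℕ} {u n w z m : P} (h : DInt k u n w z) (hm : m ⋖ u)
    (hI : ∀ v, m ≤ v → v ≤ n → v = m ∨ u ≤ v) : IsDkMinusConvex (k + 1) (insert m (Icc u n)) := by
  obtain ⟨f, hf, hr, -, -⟩ := h.exists_chart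
  have hk := h.three_le
  have hmem : ∀ x, u ≤ f x ∧ f x ≤ n := fun x => mem_Icc.1 (hr ▸ mem_range_self x)
  refine ⟨by omega, ⟨?_⟩, ?_⟩
  · intro x hx y hy v hv
    have h1 : m ≤ v := le_trans (by rcases hx with rfl | hx; exacts [le_rfl, hm.le.trans hx.1]) hv.1
    have h2 : v ≤ n :=
      hv.2.trans (by rcases hy with rfl | hy; exacts [hm.le.trans h.lt.le, hy.2])
    exact (hI v h1 h2).imp_right fun h3 => ⟨h3, h2⟩
  · let F : {x : DPoset (k + 1) // ¬ IsTop x} → P := fun x => DPoset.extend f m m x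
    have hF : ∀ x y, F x ≤ F y ↔ x ≤ y := by
      rintro ⟨x, hx⟩ ⟨y, hy⟩
      simp only [F, Subtype.mk_le_mk]
      rcases DPoset.eq_bot_or_top_or_shift hk x with rfl | rfl | ⟨x, rfl⟩
      · rcases DPoset.eq_bot_or_top_or_shift hk y with rfl | rfl | ⟨y, rfl⟩
        · simp
        · exact (hy ((DPoset.isTop_iff _).2 rfl)).elim
        · simp only [DPoset.extend_bot, DPoset.extend_shift hk, DPoset.bot_le, iff_true]
          exact hm.le.trans (hmem y).1
      · exact (hx ((DPoset.isTop_iff _).2 rfl)).elim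
      · rcases DPoset.eq_bot_or_top_or_shift hk y with rfl | rfl | ⟨y, rfl⟩
        · simp only [DPoset.extend_bot, DPoset.extend_shift hk]
          exact iff_of_false ((hm.lt.trans_le (hmem x).1).not_ge)
            fun h' => DPoset.bot_ne_shift _ _ (le_antisymm (DPoset.bot_le _ _) h')
        · exact (hy ((DPoset.isTop_iff _).2 rfl)).elim
        · simp only [DPoset.extend_shift hk]
          rw [hf, DPoset.shift_le_iff hk]
    have hrF : range F = insert m (Icc u n) := by
      rw [← hr]
      ext v
      constructor
      · rintro ⟨⟨x, hx⟩, rfl⟩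
        simp only [F]
        rcases DPoset.eq_bot_or_top_or_shift hk x with rfl | rfl | ⟨x, rfl⟩
        · simp [DPoset.extend_bot]
        · exact (hx ((DPoset.isTop_iff _).2 rfl)).elim
        · simp [DPoset.extend_shift hk]
      · rintro (rfl | ⟨x, rfl⟩)
        · refine ⟨⟨DPoset.bot (by omega), ?_⟩, DPoset.extend_bot (by omega) _ _ _⟩
          rw [DPoset.isTop_iff (by omega)]
          exact DPoset.bot_ne_top _
        · refine ⟨⟨x.shift, ?_⟩, DPoset.extend_shift hk _ _ _ _⟩
          rw [DPoset.isTop_iff (by omega)]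
          exact (DPoset.top_ne_shift hk _).symm
    let g : {x : DPoset (k + 1) // ¬ IsTop x} ↪o P := OrderEmbedding.ofMapLEIff F hF
    exact ⟨(OrderIso.setCongr _ _ hrF).symm.trans g.orderIso.symm⟩

/-- The smallest case, where there is no inner `d`-interval to start from: a V formed by an element
and two of its covers is convex by itself. -/
theorem isDkMinusConvex_three {m u v : P} (hu : m ⋖ u) (hv : m ⋖ v) (huv : u ≠ v) :
    IsDkMinusConvex 3 {m, u, v} := by
  have h1 : ¬ u ≤ v := fun h => hv.2 hu.lt (lt_of_le_of_ne h huv)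
  have h2 : ¬ v ≤ u := fun h => hu.2 hv.lt (lt_of_le_of_ne h huv.symm)
  refine ⟨le_rfl, ⟨?_⟩, ?_⟩
  · intro x hx y hy t ht
    have hmt : m ≤ t := le_trans (by rcases hx with rfl | rfl | rfl; exacts [le_rfl, hu.le, hv.le]) ht.1
    rcases hy with rfl | rfl | rfl
    · exact Or.inl (le_antisymm ht.2 hmt)
    · rcases hu.eq_or_eq hmt ht.2 with h | h <;> simp [h]
    · rcases hv.eq_or_eq hmt ht.2 with h | h <;> simp [h]
  · let F : {x : DPoset 3 // ¬ IsTop x} → P := fun x => match x.1 with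
      | .tail _ => m
      | .side b => if b then v else u
      | .neck _ => m
    have nt : ∀ i, IsTop (DPoset.neck (k := 3) i) := fun i => by
      rw [DPoset.isTop_iff le_rfl]
      simp only [DPoset.top, DPoset.neck.injEq, Fin.ext_iff]
      omega
    have hF : ∀ x y, F x ≤ F y ↔ x ≤ y := by
      rintro ⟨⟨x, hx0⟩ | (_ | _) | x, hx⟩ ⟨⟨y, hy0⟩ | (_ | _) | y, hy⟩ <;>
        first
        | exact (hx (nt _)).elim
        | exact (hy (nt _)).elim
        | simp [F, DPoset.le_iff, DPoset.level, hu.le, hv.le, hu.lt.not_ge, hv.lt.not_ge, h1, h2] <;>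
          omega
    have hrF : range F = {m, u, v} := by
      ext t
      constructor
      · rintro ⟨⟨x | (_ | _) | x, hx⟩, rfl⟩ <;> simp [F]
      · have nb : ∀ x, x ≠ DPoset.top (k := 3) le_rfl → ¬ IsTop x := fun x hx h =>
          hx ((DPoset.isTop_iff le_rfl).1 h)
        rintro (rfl | rfl | rfl)
        · exact ⟨⟨DPoset.bot le_rfl, nb _ (DPoset.bot_ne_top _)⟩, rfl⟩
        · exact ⟨⟨.side false, nb _ (by simp [DPoset.top])⟩, rfl⟩
        · exact ⟨⟨.side true, nb _ (by simp [DPoset.top])⟩, rfl⟩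
    let g : {x : DPoset 3 // ¬ IsTop x} ↪o P := OrderEmbedding.ofMapLEIff F hF
    exact ⟨(OrderIso.setCongr _ _ hrF).symm.trans g.orderIso.symm⟩

end DComplete

/-! ### Working forms of the three conditions of `d`-completeness. -/

namespace DComplete

open Set

variable {P : Type*} [PartialOrder P]

theorem DInt.symm {k : ℕ} {p q w z : P} (h : DInt k p q w z) : DInt k p q z w := by
  induction h with
  | base hpw hpz hwq hzq hwz hI =>
    exact .base hpz hpw hzq hwq hwz.symm (by rw [hI, insert_comm (_ : P) (_ : P) {_}])
  | step _ hp hq hI ih => exact .step ih hp hq hI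

/-- Every element other than a side is comparable to the whole interval, so the sides form the only
incomparable pair. -/
theorem DInt.eq_sides_of_incomp {k : ℕ} {p q w z x y : P} (h : DInt k p q w z)
    (hx : x ∈ Icc p q) (hy : y ∈ Icc p q) (hxy : ¬ x ≤ y) (hyx : ¬ y ≤ x) :
    (x = w ∧ y = z) ∨ (x = z ∧ y = w) := by
  induction h with
  | @base p q w z hpw hpz hwq hzq hwz hI =>
    have h1 : x ≠ p := fun h => hxy (h ▸ hy.1)
    have h2 : x ≠ q := fun h => hyx (h ▸ hy.2)
    have h3 : y ≠ p := fun h => hyx (h ▸ hx.1)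
    have h4 : y ≠ q := fun h => hxy (h ▸ hx.2)
    rw [hI] at hx hy
    simp only [mem_insert_iff, mem_singleton_iff, h1, h2, h3, h4, false_or, or_false] at hx hy
    rcases hx with rfl | rfl <;> rcases hy with rfl | rfl
    · exact (hxy le_rfl).elim
    · simp
    · simp
    · exact (hxy le_rfl).elim
  | @step k p q w z p' q' h hp hq hI ih =>
    have h1 : x ≠ p' := fun h => hxy (h ▸ hy.1)
    have h2 : x ≠ q' := fun h => hyx (h ▸ hy.2)
    have h3 : y ≠ p' := fun h => hyx (h ▸ hx.1)
    have h4 : y ≠ q' := fun h => hxy (h ▸ hx.2)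
    rw [hI] at hx hy
    exact ih ((hx.resolve_left h1).resolve_left h2) ((hy.resolve_left h3).resolve_left h4)

theorem DInt.ncard_Icc [Finite P] {k : ℕ} {p q w z : P} (h : DInt k p q w z) :
    (Icc p q).ncard = 2 * k - 2 := by
  induction h with
  | @base p q w z hpw hpz hwq hzq hwz hI =>
    rw [hI, ncard_insert_of_notMem, ncard_insert_of_notMem, ncard_pair hzq.ne]
    · simp [hwz, hwq.ne]
    · simp [hpw.ne, hpz.ne, (hpw.lt.trans hwq.lt).ne]
  | @step k p q w z p' q' h hp hq hI ih =>
    have := h.three_le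
    rw [hI, ncard_insert_of_notMem, ncard_insert_of_notMem, ih]
    · omega
    · exact fun h' => hq.lt.not_ge h'.2
    · rintro (h' | h')
      · exact (hp.lt.trans (h.lt.trans hq.lt)).ne h'
      · exact hp.lt.not_ge h'.1

/-- The height of a side element determines `k`; this locates the element that completes a
`d^-`-convex set. -/
theorem DInt.ncard_Icc_side [Finite P] {k : ℕ} {p q w z : P} (h : DInt k p q w z) :
    (Icc p w).ncard = k - 1 := by
  induction h with
  | @base p q w z hpw hpz hwq hzq hwz hI =>
    have : Icc p w = {p, w} := by
      ext v
      constructor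
      · exact fun hv => hpw.eq_or_eq hv.1 hv.2
      · rintro (rfl | rfl)
        exacts [⟨le_rfl, hpw.le⟩, ⟨hpw.le, le_rfl⟩]
    rw [this, ncard_pair hpw.ne]
  | @step k p q w z p' q' h hp hq hI ih =>
    have h3 := h.three_le
    have hs := h.lt_sides
    have : Icc p' w = insert p' (Icc p w) := by
      ext v
      constructor
      · intro hv
        have hv' : v ∈ Icc p' q' := ⟨hv.1, hv.2.trans (hs.2.2.1.trans hq.lt).le⟩
        rw [hI] at hv'
        rcases hv' with rfl | rfl | hv'
        · exact Or.inl rfl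
        · exact ((hs.2.2.1.trans hq.lt).not_ge hv.2).elim
        · exact Or.inr ⟨hv'.1, hv.2⟩
      · rintro (rfl | hv)
        · exact ⟨le_rfl, (hp.lt.trans hs.1).le⟩
        · exact ⟨hp.le.trans hv.1, hv.2⟩
    rw [this, ncard_insert_of_notMem, ih]
    · omega
    · exact fun h' => hp.lt.not_ge h'.1

theorem DInt.eq_base {p q w z : P} (h : DInt 3 p q w z) :
    p ⋖ w ∧ p ⋖ z ∧ w ⋖ q ∧ z ⋖ q ∧ Icc p q = {p, w, z, q} := by
  generalize hk : 3 = k at h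
  cases h with
  | base hpw hpz hwq hzq hwz hI => exact ⟨hpw, hpz, hwq, hzq, hI⟩
  | step h => have := h.three_le; omega

theorem IsDkInterval.exists_dInt {k : ℕ} {I : Set P} (h : IsDkInterval k I) :
    ∃ p q w z, I = Icc p q ∧ DInt k p q w z := by
  obtain ⟨hk, p, q, rfl, ⟨e⟩⟩ := h
  exact ⟨p, q, _, _, rfl, dInt_of_orderIso hk e⟩

variable [Finite P]

/-- The completion condition does not say where the new element goes. It must be the maximum, since
none of `m`, `u`, `v` lies above both of the incomparable elements `u` and `v`. -/
theorem IsDComplete.exists_dInt_three (hP : IsDComplete P) {m u v : P} (hu : m ⋖ u) (hv : m ⋖ v)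
    (huv : u ≠ v) : ∃ z, DInt 3 m z u v := by
  have h1 : ¬ u ≤ v := fun h => hv.2 hu.lt (lt_of_le_of_ne h huv)
  have h2 : ¬ v ≤ u := fun h => hu.2 hv.lt (lt_of_le_of_ne h huv.symm)
  obtain ⟨z, hz⟩ := hP.exists_completion 3 _ (isDkMinusConvex_three hu hv huv)
  obtain ⟨p, q, w, t, hI, hd⟩ := hz.exists_dInt
  have hc3 : ({m, u, v} : Set P).ncard = 3 := by
    rw [ncard_insert_of_notMem, ncard_pair huv]
    simp [hu.ne, hv.ne]
  have hz3 : z ∉ ({m, u, v} : Set P) := by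
    intro h
    have h4 := hd.ncard_Icc
    rw [← hI, insert_eq_of_mem h, hc3] at h4
    omega
  have hmem : ∀ x, x ∈ Icc p q ↔ x = z ∨ x = m ∨ x = u ∨ x = v := by
    intro x
    rw [← hI]
    simp
  have hmi := (hmem m).2 (by simp)
  have hui := (hmem u).2 (by simp)
  have hvi := (hmem v).2 (by simp)
  have hzi := (hmem z).2 (by simp)
  have hq : q = z := by
    rcases (hmem q).1 ⟨hmi.1.trans hmi.2, le_rfl⟩ with h | rfl | rfl | rfl
    · exact h
    · exact (hu.lt.not_ge hui.2).elim
    · exact (h2 hvi.2).elim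
    · exact (h1 hui.2).elim
  have hp : p = m := by
    rcases (hmem p).1 ⟨le_rfl, hmi.1.trans hmi.2⟩ with rfl | h | rfl | rfl
    · exact (hz3 (by simp [le_antisymm hmi.1 (hq ▸ hmi.2)])).elim
    · exact h
    · exact (hu.lt.not_ge hmi.1).elim
    · exact (hv.lt.not_ge hmi.1).elim
  subst hp hq
  refine ⟨q, ?_⟩
  rcases hd.eq_sides_of_incomp hui hvi h1 h2 with ⟨rfl, rfl⟩ | ⟨rfl, rfl⟩
  exacts [hd, hd.symm]

/-- Again the completing element has to be shown to be the maximum. As a new minimum it would put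
the sides at the wrong height, and any other position is excluded by `hv`. -/
theorem IsDComplete.exists_dInt_succ (hP : IsDComplete P) {k : ℕ} {m u n w t : P}
    (h : DInt k u n w t) (hm : m ⋖ u) (hv : ∀ v, m ≤ v → v ≤ n → v = m ∨ u ≤ v) :
    ∃ z, n ⋖ z ∧ Icc m z = insert m (insert z (Icc u n)) := by
  have hk := h.three_le
  have hs := h.lt_sides
  obtain ⟨z, hz⟩ := hP.exists_completion _ _ (h.isDkMinusConvex hm hv)
  obtain ⟨p, q, w', t', hI, hd⟩ := hz.exists_dInt
  have hmu : m ∉ Icc u n := fun h' => hm.lt.not_ge h'.1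
  have hzI : z ∉ insert m (Icc u n) := by
    intro h'
    have h4 := hd.ncard_Icc
    rw [← hI, insert_eq_of_mem h', ncard_insert_of_notMem hmu, h.ncard_Icc] at h4
    omega
  have hmem : ∀ x, x ∈ Icc p q ↔ x = z ∨ x = m ∨ x ∈ Icc u n := by
    intro x
    rw [← hI]
    simp
  have hun := h.lt.le
  have hmi := (hmem m).2 (by simp)
  have hni := (hmem n).2 (by simp [hun])
  have hzi := (hmem z).2 (by simp)
  have hpq := hmi.1.trans hmi.2
  have hp : p = m := by
    rcases (hmem p).1 ⟨le_rfl, hpq⟩ with rfl | h' | h'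
    · exfalso
      -- In a `d_{k+1}`-interval a side has `k` elements at most itself, but with the completing
      -- element below `m` there would be `k + 1`.
      have hcard : ∀ x, x ∈ Icc u n → (Icc u x).ncard = k - 1 → (Icc p x).ncard = k → False := by
        intro x hx h5 h6
        have : Icc p x = insert p (insert m (Icc u x)) := by
          ext y
          constructor
          · intro hy
            rcases (hmem y).1 ⟨hy.1, hy.2.trans ((hmem x).2 (by simp [hx.1, hx.2])).2⟩ with
              rfl | rfl | h'
            · simp
            · simp
            · exact Or.inr (Or.inr ⟨h'.1, hy.2⟩)
          · rintro (rfl | rfl | hy)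
            · exact ⟨le_rfl, hmi.1.trans (hm.le.trans hx.1)⟩
            · exact ⟨hmi.1, hm.le.trans hx.1⟩
            · exact ⟨hmi.1.trans (hm.le.trans hy.1), hy.2⟩
        rw [this, ncard_insert_of_notMem, ncard_insert_of_notMem, h5] at h6
        · omega
        · exact fun h' => hm.lt.not_ge h'.1
        · rintro (rfl | h')
          · exact hzI (by simp)
          · exact hzI (Or.inr ⟨h'.1, h'.2.trans hx.2⟩)
      have hw : w ∈ Icc u n := ⟨hs.1.le, hs.2.2.1.le⟩
      have ht : t ∈ Icc u n := ⟨hs.2.1.le, hs.2.2.2.1.le⟩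
      rcases hd.eq_sides_of_incomp ((hmem w).2 (Or.inr (Or.inr hw)))
        ((hmem t).2 (Or.inr (Or.inr ht))) hs.2.2.2.2.1 hs.2.2.2.2.2 with ⟨rfl, rfl⟩ | ⟨rfl, rfl⟩
      · exact hcard _ hw h.ncard_Icc_side hd.ncard_Icc_side
      · exact hcard _ hw h.ncard_Icc_side hd.symm.ncard_Icc_side
    · exact h'
    · exact (hm.lt.not_ge (h'.1.trans hmi.1)).elim
  have hq : q = z := by
    rcases (hmem q).1 ⟨hpq, le_rfl⟩ with h' | rfl | h'
    · exact h'
    · exact ((hm.lt.trans h.lt).not_ge hni.2).elim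
    · exfalso
      rcases hv z (hp ▸ hzi.1) (hzi.2.trans h'.2) with h5 | h5
      · exact hzI (Or.inl h5)
      · exact hzI (Or.inr ⟨h5, hzi.2.trans h'.2⟩)
  subst hp hq
  refine ⟨q, ⟨lt_of_le_of_ne hni.2 ?_, ?_⟩, ?_⟩
  · rintro rfl
    exact hzI (Or.inr ⟨hun, le_rfl⟩)
  · intro x hx hx'
    rcases (hmem x).1 ⟨hmi.1.trans (hni.1.trans hx.le), hx'.le⟩ with rfl | rfl | h'
    · exact hx'.ne rfl
    · exact hx.not_ge hni.1
    · exact hx.not_ge h'.2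
  · rw [← hI, insert_comm]

theorem IsDComplete.mem_Icc_of_covBy (hP : IsDComplete P) {k : ℕ} {p q w z x : P}
    (h : DInt k p q w z) (hx : x ⋖ q) : x ∈ Icc p q :=
  hP.mem_of_covBy p q h.isDInterval x hx

/-- The maximum of a `d`-interval with more than four elements covers only one element. -/
theorem IsDComplete.covBy_unique (hP : IsDComplete P) {k : ℕ} {p q w z p' q' x : P}
    (h : DInt k p q w z) (hp : p' ⋖ p) (hq : q ⋖ q')
    (hI : Icc p' q' = insert p' (insert q' (Icc p q))) (hx : x ⋖ q') : x = q := by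
  have := hP.mem_Icc_of_covBy (.step h hp hq hI) hx
  rw [hI] at this
  rcases this with rfl | rfl | h'
  · exact (hx.2 (hp.lt.trans h.lt) hq.lt).elim
  · exact (hx.ne rfl).elim
  · exact (eq_of_le_of_not_lt h'.2 fun h'' => hx.2 h'' hq.lt)

theorem IsDComplete.covBy_unique_three (hP : IsDComplete P) {p q w z x : P}
    (h : DInt 3 p q w z) (hx : x ⋖ q) : x = w ∨ x = z := by
  have h' := h.eq_base
  have := hP.mem_Icc_of_covBy h hx
  rw [h'.2.2.2.2] at this
  rcases this with rfl | h1 | h1 | rfl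
  · exact (hx.2 h'.1.lt h'.2.2.1.lt).elim
  · exact Or.inl h1
  · exact Or.inr h1
  · exact (hx.ne rfl).elim

theorem IsDComplete.eq_of_isDkMinusConvex (hP : IsDComplete P) {k l : ℕ} {a b : P} {S : Set P}
    (ha : IsDkMinusConvex k (insert a S)) (hb : IsDkMinusConvex l (insert b S))
    (haS : ∀ x ∈ S, a < x) (hbS : ∀ x ∈ S, b < x) : a = b := by
  have h1 : ∀ c : P, (∀ x ∈ S, c < x) → IsLeast (insert c S) c := fun c hc =>
    ⟨mem_insert _ _, by rintro x (rfl | hx); exacts [le_rfl, (hc x hx).le]⟩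
  have h2 : ∀ c : P, (∀ x ∈ S, c < x) → insert c S \ {c} = S := fun c hc =>
    insert_sdiff_self_of_notMem fun h => (hc c h).ne rfl
  have h3 := hP.eq_of_diff_min k l _ _ ha hb a b (h1 a haS) (h1 b hbS)
    (by rw [h2 a haS, h2 b hbS])
  have h4 : a ∈ insert b S := h3 ▸ mem_insert a S
  rcases h4 with h4 | h4
  · exact h4
  · exact ((haS a h4).ne rfl).elim

end DComplete

/-! ### Heap colourings, and `d`-intervals that start at a new minimal element. -/

namespace DComplete

open Set

variable {P : Type*} [PartialOrder P]

/-- `q < r` are consecutive elements of the same colour. -/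
def Consec {C : Type*} (κ : P → C) (q r : P) : Prop :=
  q < r ∧ κ q = κ r ∧ ∀ v, q < v → v < r → κ v ≠ κ q

/-- A colouring `κ` of the upper set `E`, with an adjacency relation `A` between colours forming a
forest, such that elements of equal or adjacent colours are comparable, there are exactly two elements
of adjacent colour between consecutive elements of the same colour and at most one above the last
element of a colour, and `d`-intervals are the intervals between consecutive elements of a colour. -/
structure HeapColoring (E : Set P) (κ : P → P) (A : P → P → Prop) : Prop where
  mem_color : ∀ q ∈ E, κ q ∈ E
  mem_adj : ∀ i j, A i j → i ∈ E ∧ j ∈ E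
  symm : ∀ i j, A i j → A j i
  irrefl : ∀ i, ¬ A i i
  covBy : ∀ q ∈ E, ∀ r, q ⋖ r → A (κ q) (κ r)
  comp : ∀ q ∈ E, ∀ r ∈ E, κ q = κ r ∨ A (κ q) (κ r) → q ≤ r ∨ r ≤ q
  two : ∀ q ∈ E, ∀ r, Consec κ q r → {v | q < v ∧ v < r ∧ A (κ q) (κ v)}.ncard = 2
  top : ∀ q ∈ E, (∀ v, q < v → κ v ≠ κ q) → {v | q < v ∧ A (κ q) (κ v)}.ncard ≤ 1
  forest : ∀ i, ∃ f : P → P, (∀ j k, A j k → j ≠ i → k ≠ i → f j = f k) ∧ ∀ b, A i b → f b = b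
  consec_of_dInt : ∀ q ∈ E, ∀ k r w z, DInt k q r w z → Consec κ q r
  dInt_of_consec : ∀ q ∈ E, ∀ r, Consec κ q r → ∃ k w z, DInt k q r w z

namespace HeapColoring

variable {E : Set P} {κ : P → P} {A : P → P → Prop}

theorem consec_above_unique (H : HeapColoring E κ A) (hE : IsUpperSet E) {q r r' : P} (hq : q ∈ E)
    (h : Consec κ q r) (h' : Consec κ q r') : r = r' := by
  by_contra hne
  rcases H.comp r (hE h.1.le hq) r' (hE h'.1.le hq) (Or.inl (h.2.1.symm.trans h'.2.1)) with hl | hl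
  · exact h'.2.2 r h.1 (lt_of_le_of_ne hl hne) h.2.1.symm
  · exact h.2.2 r' h'.1 (lt_of_le_of_ne hl (Ne.symm hne)) h'.2.1.symm

theorem consec_below_unique (H : HeapColoring E κ A) {q q' r : P} (hq : q ∈ E) (hq' : q' ∈ E)
    (h : Consec κ q r) (h' : Consec κ q' r) : q = q' := by
  by_contra hne
  rcases H.comp q hq q' hq' (Or.inl (h.2.1.trans h'.2.1.symm)) with hl | hl
  · exact h.2.2 q' (lt_of_le_of_ne hl hne) h'.1 (h'.2.1.trans h.2.1.symm)
  · exact h'.2.2 q (lt_of_le_of_ne hl (Ne.symm hne)) h.1 (h.2.1.trans h'.2.1.symm)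

end HeapColoring

variable [Finite P]

theorem exists_consec_below {C : Type*} {κ : P → C} {y z : P} (h : y < z) (hκ : κ y = κ z) :
    ∃ y', y ≤ y' ∧ Consec κ y' z := by
  obtain ⟨y', ⟨h1, h2, h3⟩, h4⟩ := (wellFounded_gt (α := P)).has_min
    {v | y ≤ v ∧ v < z ∧ κ v = κ z} ⟨y, le_rfl, h, hκ⟩
  exact ⟨y', h1, h2, h3, fun v hv hv' he => h4 v ⟨h1.trans hv.le, hv', he.trans h3⟩ hv⟩

theorem exists_consec_above {C : Type*} {κ : P → C} {y z : P} (h : y < z) (hκ : κ y = κ z) :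
    ∃ z', z' ≤ z ∧ Consec κ y z' := by
  obtain ⟨z', ⟨h1, h2, h3⟩, h4⟩ := (wellFounded_lt (α := P)).has_min
    {v | v ≤ z ∧ y < v ∧ κ v = κ y} ⟨z, le_rfl, h, hκ.symm⟩
  exact ⟨z', h1, h2, h3.symm, fun v hv hv' he => h4 v ⟨hv'.le.trans h1, hv, he⟩ hv'⟩

/-- A `d`-interval `[u, n]` and a `d`-interval `[n, T]` such that everything below `T` is comparable
to `n` cannot coexist in a `d`-complete poset. -/
theorem IsDComplete.not_stacked (hP : IsDComplete P) {k : ℕ} {u n w t : P} (h : DInt k u n w t) :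
    ∀ (l : ℕ) (T α β : P), DInt l n T α β → ¬ ∀ v < T, n ≤ v ∨ v ≤ n := by
  have hv {a b T : P} (hab : a ⋖ b) (hT : b < T) (h : ∀ v < T, b ≤ v ∨ v ≤ b) :
      ∀ v, a ≤ v → v ≤ T → v = a ∨ b ≤ v := by
    intro v h1 h2
    rcases h2.eq_or_lt with rfl | h2
    · exact Or.inr hT.le
    · rcases h v h2 with h3 | h3
      · exact Or.inr h3
      · rcases hab.eq_or_eq h1 h3 with h4 | h4
        · exact Or.inl h4
        · exact Or.inr h4.ge
  induction h with
  | @base p q w z hpw hpz hwq hzq hwz hI =>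
    intro l T α β hd hc
    -- Each side of the diamond together with `[n, T]` is `d^-`-convex, and these two sets differ
    -- only in their minima.
    refine hwz (hP.eq_of_isDkMinusConvex (hd.isDkMinusConvex hwq (hv hwq hd.lt hc))
      (hd.isDkMinusConvex hzq (hv hzq hd.lt hc)) ?_ ?_)
    · exact fun x hx => hwq.lt.trans_le hx.1
    · exact fun x hx => hzq.lt.trans_le hx.1
  | @step k p q w z p' q' h hp hq hI ih =>
    intro l T α β hd hc
    -- Move one step down: the maximum of the inner interval becomes the minimum of a larger
    -- `d`-interval with a new maximum `T'`. As `T'` covers only the old `T`, the comparability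
    -- condition persists.
    obtain ⟨T', hT, hI'⟩ := hP.exists_dInt_succ hd hq (hv hq hd.lt hc)
    refine ih _ T' α β (.step hd hq hT hI') fun v hvT => ?_
    obtain ⟨c, hvc, hc'⟩ := exists_le_covBy_of_lt hvT
    obtain rfl := hP.covBy_unique hd hq hT hI' hc'
    rcases hvc.eq_or_lt with rfl | hvc
    · exact Or.inl (hq.le.trans hd.lt.le)
    rcases hc v hvc with h1 | h1
    · exact Or.inl (hq.le.trans h1)
    rcases h1.eq_or_lt with rfl | h1
    · exact Or.inl hq.le
    obtain ⟨c, hvc, hc'⟩ := exists_le_covBy_of_lt h1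
    obtain rfl := hP.covBy_unique h hp hq hI hc'
    exact Or.inr hvc

namespace HeapColoring

variable {E : Set P} {κ : P → P} {A : P → P → Prop}

/-- A saturated chain is a walk in the colour graph. If it avoids `i`, it stays in one component of
the forest without `i`, and such a component contains only one neighbour of `i`. -/
theorem color_eq_of_forest (H : HeapColoring E κ A) (hE : IsUpperSet E) {i y v : P} (hy : y ∈ E)
    (hyv : y ≤ v) (hi : ∀ r, y ≤ r → r ≤ v → κ r ≠ i) (h1 : A i (κ y)) (h2 : A i (κ v)) :
    κ y = κ v := by
  obtain ⟨f, hf, hf'⟩ := H.forest i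
  rw [← hf' _ h1, ← hf' _ h2]
  clear h1
  revert hy hyv hi
  induction y using (wellFounded_gt (α := P)).induction with
  | _ y ih =>
    intro hy hyv hi
    rcases hyv.eq_or_lt with rfl | hlt
    · rfl
    obtain ⟨y', hy', hyv'⟩ := exists_covBy_le_of_lt hlt
    rw [hf _ _ (H.covBy y hy y' hy') (hi y le_rfl hyv) (hi y' hy'.le hyv')]
    exact ih y' hy'.lt (hE hy'.le hy) hyv' fun r h3 h4 => hi r (hy'.le.trans h3) h4

/-- The three diamonds over pairs of covers would give a closed walk of six steps in the colour
forest. The forest condition makes two of their tops have equal colour; these are then comparable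
and cover a common element, so they coincide. -/
theorem not_three_covers (hP : IsDComplete P) (H : HeapColoring E κ A) {m u₁ u₂ u₃ : P}
    (hE : IsUpperSet E) (hm : ∀ v, m < v → v ∈ E) (h1 : m ⋖ u₁) (h2 : m ⋖ u₂) (h3 : m ⋖ u₃)
    (h12 : u₁ ≠ u₂) (h13 : u₁ ≠ u₃) (h23 : u₂ ≠ u₃) : False := by
  have hnle : ∀ {a b : P}, m ⋖ a → m ⋖ b → a ≠ b → ¬ a ≤ b := fun ha hb hab hle =>
    hb.2 ha.lt (lt_of_le_of_ne hle hab)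
  obtain ⟨z₁₂, d12⟩ := hP.exists_dInt_three h1 h2 h12
  obtain ⟨z₁₃, d13⟩ := hP.exists_dInt_three h1 h3 h13
  obtain ⟨z₂₃, d23⟩ := hP.exists_dInt_three h2 h3 h23
  have b12 := d12.eq_base
  have b13 := d13.eq_base
  have b23 := d23.eq_base
  have key : ∀ {a b c z : P}, DInt 3 m z a b → m ⋖ c → a ≠ c → b ≠ c → ¬ c ≤ z := by
    intro a b c z hd hc hac hbc hcz
    have hb := hd.eq_base
    have : c ∈ Icc m z := ⟨hc.le, hcz⟩
    rw [hb.2.2.2.2] at this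
    rcases this with rfl | rfl | rfl | rfl
    · exact hc.ne rfl
    · exact hac rfl
    · exact hbc rfl
    · exact hnle hb.1 hc hac hb.2.2.1.le
  have e1 := hm u₁ h1.lt
  have e2 := hm u₂ h2.lt
  have e3 := hm u₃ h3.lt
  have ezz : z₁₂ ∈ E := hE b12.2.2.1.le e1
  have ez3 : z₁₃ ∈ E := hE b13.2.2.1.le e1
  have ez23 : z₂₃ ∈ E := hE b23.2.2.1.le e2
  have cne : ∀ {a b : P}, a ∈ E → b ∈ E → ¬ a ≤ b → ¬ b ≤ a → κ a ≠ κ b := fun ha hb h h' he =>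
    (H.comp _ ha _ hb (Or.inl he)).elim h h'
  have cne' : ∀ {a b : P}, a ∈ E → a ⋖ b → κ b ≠ κ a := fun {a b} ha h he =>
    H.irrefl (κ a) (by simpa [he] using H.covBy _ ha _ h)
  have n2 : κ u₂ ≠ κ u₁ := cne e2 e1 (hnle h2 h1 h12.symm) (hnle h1 h2 h12)
  have n3 : κ u₃ ≠ κ u₁ := cne e3 e1 (hnle h3 h1 h13.symm) (hnle h1 h3 h13)
  have nz : κ z₂₃ ≠ κ u₁ := cne ez23 e1
    (fun h => hnle h2 h1 h12.symm (b23.2.2.1.le.trans h)) (key d23 h1 h12.symm h13.symm)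
  have nz2 : κ z₁₂ ≠ κ u₁ := cne' e1 b12.2.2.1
  have nz3 : κ z₁₃ ≠ κ u₁ := cne' e1 b13.2.2.1
  obtain ⟨f, hf, hf'⟩ := H.forest (κ u₁)
  -- The walk through the colours of `z₁₂, u₂, z₂₃, u₃, z₁₃` avoids the colour of `u₁`, and both of
  -- its ends are neighbours of that colour.
  have hz : κ z₁₂ = κ z₁₃ := by
    rw [← hf' _ (H.covBy _ e1 _ b12.2.2.1), ← hf' _ (H.covBy _ e1 _ b13.2.2.1),
      ← hf _ _ (H.covBy _ e2 _ b12.2.2.2.1) n2 nz2, hf _ _ (H.covBy _ e2 _ b23.2.2.1) n2 nz,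
      ← hf _ _ (H.covBy _ e3 _ b23.2.2.2.1) n3 nz, hf _ _ (H.covBy _ e3 _ b13.2.2.2.1) n3 nz3]
  have hne : z₁₂ ≠ z₁₃ := by
    rintro rfl
    exact key d12 h3 h13 h23 b13.2.2.2.1.le
  rcases H.comp _ ezz _ ez3 (Or.inl hz) with h | h
  · exact b13.2.2.1.2 b12.2.2.1.lt (lt_of_le_of_ne h hne)
  · exact b12.2.2.1.2 b13.2.2.1.lt (lt_of_le_of_ne h hne.symm)

/-- A new minimal element is covered only by elements that are the lowest of their colour. -/
theorem cover_lowest (hP : IsDComplete P) (H : HeapColoring E κ A) (hE : IsUpperSet E) {m u y : P}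
    (hmE : m ∉ E) (hm : ∀ v, m < v → v ∈ E) (hu : m ⋖ u) (hy : y ∈ E) (hyu : κ y = κ u) :
    u ≤ y := by
  rcases H.comp _ hy _ (hm u hu.lt) (Or.inl hyu) with h | h
  · rcases h.eq_or_lt with rfl | h
    · exact le_rfl
    obtain ⟨y', hy', hc⟩ := exists_consec_below h hyu
    obtain ⟨k, w, z, hd⟩ := H.dInt_of_consec y' (hE hy' hy) u hc
    -- `u` is the maximum of the `d`-interval `[y', u]` and covers `m`, so `m ≥ y'` by the second
    -- condition; but `y'` lies in the upper set `E`.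
    exact (hmE (hE (hP.mem_Icc_of_covBy hd hu).1 (hE hy' hy))).elim
  · exact h

/-- For a diamond, a further cover is excluded by `not_three_covers`. In a longer interval, complete
`c` and the inner minimum `u` to a diamond; its top covers `u` and hence lies below the next element
of the colour of `u`, which is the inner maximum. -/
theorem cover_le (hP : IsDComplete P) (H : HeapColoring E κ A) (hE : IsUpperSet E) {k : ℕ}
    {m z w t c : P} (hm : ∀ v, m < v → v ∈ E) (hd : DInt k m z w t) (hc : m ⋖ c) : c ≤ z := by
  cases hd with
  | base hpw hpz hwq hzq hwz hI =>
    by_contra hcz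
    refine H.not_three_covers hP hE hm hpw hpz hc hwz ?_ ?_
    · rintro rfl; exact hcz hwq.le
    · rintro rfl; exact hcz hzq.le
  | @step k u n _ _ _ _ h hp hq hI =>
    by_cases hcu : c = u
    · exact hcu ▸ (h.lt.trans hq.lt).le
    obtain ⟨z₃, h3⟩ := hP.exists_dInt_three hp hc (Ne.symm hcu)
    have b3 := h3.eq_base
    have huE := hm u hp.lt
    obtain ⟨s, hs, hsn⟩ := exists_covBy_le_of_lt h.lt
    have hz3 : z₃ ≤ n := by
      by_cases hsz : s = z₃
      · exact hsz ▸ hsn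
      obtain ⟨z₄, h4⟩ := hP.exists_dInt_three hs b3.2.2.1 hsz
      obtain rfl := H.consec_above_unique hE huE (H.consec_of_dInt _ huE _ _ _ _ h4)
        (H.consec_of_dInt _ huE _ _ _ _ h)
      exact h4.lt_sides.2.2.2.1.le
    exact b3.2.2.2.1.le.trans (hz3.trans hq.le)

theorem cover_eq {k : ℕ} {u n w t m z c : P} (h : DInt k u n w t) (hp : m ⋖ u) (hq : n ⋖ z)
    (hI : Icc m z = insert m (insert z (Icc u n))) (hc : m ⋖ c) (hcz : c ≤ z) : c = u := by
  have : c ∈ Icc m z := ⟨hc.le, hcz⟩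
  rw [hI] at this
  rcases this with rfl | rfl | h'
  · exact (hc.ne rfl).elim
  · exact (hc.2 hp.lt (h.lt.trans hq.lt)).elim
  · exact (hc.eq_or_eq hp.le h'.1).elim (fun h => (hp.ne h.symm).elim) Eq.symm

theorem eq_or_le_of_step {u n m z : P} (hq : n ⋖ z)
    (hI : Icc m z = insert m (insert z (Icc u n))) (v : P) (h1 : m ≤ v) (h2 : v ≤ n) :
    v = m ∨ u ≤ v := by
  have : v ∈ Icc m z := ⟨h1, h2.trans hq.le⟩
  rw [hI] at this
  rcases this with rfl | rfl | h'
  · exact Or.inl rfl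
  · exact (hq.lt.not_ge h2).elim
  · exact Or.inr h'.1

/-- The maximum of a `d`-interval starting at a new minimal element is the lowest of its colour. -/
theorem max_lowest (hP : IsDComplete P) (H : HeapColoring E κ A) (hE : IsUpperSet E) {k : ℕ}
    {m z w t y : P} (hmE : m ∉ E) (hm : ∀ v, m < v → v ∈ E) (hd : DInt k m z w t) (hy : y ∈ E)
    (hyz : κ y = κ z) : z ≤ y := by
  rcases H.comp _ hy _ (hm z hd.lt) (Or.inl hyz) with h | h
  swap
  · exact h
  rcases h.eq_or_lt with rfl | h
  · exact le_rfl
  exfalso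
  obtain ⟨x, hyx, hc⟩ := exists_consec_below h hyz
  have hx := hE hyx hy
  obtain ⟨l, w', t', hd'⟩ := H.dInt_of_consec x hx z hc
  -- The `d`-intervals `[m, z]` and `[x, z]` have the same maximum, and the lower covers of `z`
  -- decide whether it is a diamond. So they agree except at the minimum, and the third condition
  -- forces `m = x`, which lies in `E`.
  cases hd with
  | @base _ _ _ _ hpw hpz hwq hzq hwz hI =>
    cases hd' with
    | @base _ _ _ _ hpw' hpz' hwq' hzq' hwz' hI' =>
      have hb := DInt.base hpw hpz hwq hzq hwz hI
      have e1 := hP.covBy_unique_three hb hwq'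
      have e2 := hP.covBy_unique_three hb hzq'
      have key : ({w', t'} : Set P) = {w, t} := by
        rcases e1 with rfl | rfl <;> rcases e2 with rfl | rfl
        · exact (hwz' rfl).elim
        · rfl
        · exact pair_comm _ _
        · exact (hwz' rfl).elim
      have := hP.eq_of_isDkMinusConvex (isDkMinusConvex_three hpw hpz hwz)
        (key ▸ isDkMinusConvex_three hpw' hpz' hwz')
        (by rintro _ (rfl | rfl); exacts [hpw.lt, hpz.lt])
        (by rw [← key]; rintro _ (rfl | rfl); exacts [hpw'.lt, hpz'.lt])
      exact hmE (this ▸ hx)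
    | @step _ _ _ _ _ _ _ h' hp' hq' hI' =>
      exact hwz ((hP.covBy_unique h' hp' hq' hI' hwq).trans
        (hP.covBy_unique h' hp' hq' hI' hzq).symm)
  | @step _ u n _ _ _ _ hd1 hp hq hI =>
    have huE := hm u hp.lt
    cases hd' with
    | @base _ _ _ _ hpw' hpz' hwq' hzq' hwz' hI' =>
      exact hwz' ((hP.covBy_unique hd1 hp hq hI hwq').trans
        (hP.covBy_unique hd1 hp hq hI hzq').symm)
    | @step _ u' n' _ _ _ _ h' hp' hq' hI' =>
      obtain rfl := hP.covBy_unique hd1 hp hq hI hq'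
      have hu' := hE hp'.le hx
      obtain rfl := H.consec_below_unique huE hu' (H.consec_of_dInt _ huE _ _ _ _ hd1)
        (H.consec_of_dInt _ hu' _ _ _ _ h')
      have := hP.eq_of_isDkMinusConvex
        (hd1.isDkMinusConvex hp (eq_or_le_of_step hq hI))
        (hd1.isDkMinusConvex hp' (eq_or_le_of_step hq' hI'))
        (fun x hx => hp.lt.trans_le hx.1) (fun x hx => hp'.lt.trans_le hx.1)
      exact hmE (this ▸ hx)

/-- All covers of `m` lie below both maxima, so the two intervals agree below their maxima. Two
different maxima over a common diamond would give two V-shaped sets that differ only in their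
minimum. In the longer case they would complete to a diamond above the inner interval, which
`IsDComplete.not_stacked` forbids. -/
theorem max_unique (hP : IsDComplete P) (H : HeapColoring E κ A) (hE : IsUpperSet E) {k l : ℕ}
    {m z w t z' w' t' : P} (hm : ∀ v, m < v → v ∈ E) (hd : DInt k m z w t)
    (hd' : DInt l m z' w' t') : z' = z := by
  have hle' : ∀ c, m ⋖ c → c ≤ z := fun c hc => H.cover_le hP hE hm hd hc
  have hle'' : ∀ c, m ⋖ c → c ≤ z' := fun c hc => H.cover_le hP hE hm hd' hc
  by_contra hne
  cases hd with
  | @base _ _ _ _ hpw hpz hwq hzq hwz hI =>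
    cases hd' with
    | @base _ _ _ _ hpw' hpz' hwq' hzq' hwz' hI' =>
      have mem : ∀ c, m ⋖ c → c = w' ∨ c = t' := by
        intro c hc
        have : c ∈ Icc m z' := ⟨hc.le, hle'' c hc⟩
        rw [hI'] at this
        rcases this with rfl | h | h | rfl
        · exact (hc.ne rfl).elim
        · exact Or.inl h
        · exact Or.inr h
        · exact (hc.2 hpw'.lt hwq'.lt).elim
      have cov : ∀ c, m ⋖ c → c ⋖ z' := fun c hc => by
        rcases mem c hc with rfl | rfl
        exacts [hwq', hzq']
      have c1 := cov w hpw
      have c2 := cov t hpz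
      refine hwz (hP.eq_of_isDkMinusConvex (isDkMinusConvex_three c1 hwq hne)
        (isDkMinusConvex_three c2 hzq hne) ?_ ?_)
      · rintro _ (rfl | rfl); exacts [c1.lt, hwq.lt]
      · rintro _ (rfl | rfl); exacts [c2.lt, hzq.lt]
    | @step _ _ _ _ _ _ _ h' hp' hq' hI' =>
      exact hwz ((cover_eq h' hp' hq' hI' hpw (hle'' _ hpw)).trans
        (cover_eq h' hp' hq' hI' hpz (hle'' _ hpz)).symm)
  | @step _ u n _ _ _ _ hd1 hp hq hI =>
    cases hd' with
    | @base _ _ _ _ hpw' hpz' hwq' hzq' hwz' hI' =>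
      exact hwz' ((cover_eq hd1 hp hq hI hpw' (hle' _ hpw')).trans
        (cover_eq hd1 hp hq hI hpz' (hle' _ hpz')).symm)
    | @step _ u' n' _ _ _ _ h' hp' hq' hI' =>
      obtain rfl := cover_eq hd1 hp hq hI hp' (hle' _ hp')
      have huE := hm _ hp.lt
      obtain rfl := H.consec_above_unique hE huE (H.consec_of_dInt _ huE _ _ _ _ hd1)
        (H.consec_of_dInt _ huE _ _ _ _ h')
      obtain ⟨T, hT⟩ := hP.exists_dInt_three hq hq' (Ne.symm hne)
      refine hP.not_stacked hd1 _ T _ _ hT fun v hv => ?_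
      obtain ⟨c, hvc, hcT⟩ := exists_le_covBy_of_lt hv
      rcases hP.covBy_unique_three hT hcT with rfl | rfl
      · rcases hvc.eq_or_lt with rfl | hvc
        · exact Or.inl hq.le
        obtain ⟨d, hvd, hdc⟩ := exists_le_covBy_of_lt hvc
        exact Or.inr (hP.covBy_unique hd1 hp hq hI hdc ▸ hvd)
      · rcases hvc.eq_or_lt with rfl | hvc
        · exact Or.inl hq'.le
        obtain ⟨d, hvd, hdc⟩ := exists_le_covBy_of_lt hvc
        exact Or.inr (hP.covBy_unique hd1 hp hq' hI' hdc ▸ hvd)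

/-- The two elements are the sides of a diamond, or the inner minimum and maximum of a longer
interval. This yields the count of two in `HeapColoring.two` when `m` is added with the colour of
`z`. -/
theorem exists_lower_neighbors (hP : IsDComplete P) (H : HeapColoring E κ A) (hE : IsUpperSet E)
    {k : ℕ} {m z w t : P} (hmE : m ∉ E) (hm : ∀ v, m < v → v ∈ E) (hd : DInt k m z w t) :
    ∃ a b, a ≠ b ∧ m < a ∧ m < b ∧ a < z ∧ b < z ∧ A (κ z) (κ a) ∧ A (κ z) (κ b) ∧
      (∀ c, m ⋖ c → c = a ∨ c = b) ∧ ∀ y ∈ E, y < z → A (κ z) (κ y) → y = a ∨ y = b := by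
  have hle : ∀ c, m ⋖ c → c ≤ z := fun c hc => H.cover_le hP hE hm hd hc
  have hlow : ∀ y ∈ E, κ y = κ z → z ≤ y := fun y hy h => H.max_lowest hP hE hmE hm hd hy h
  have hcol : ∀ y ∈ E, ∀ c, y ≤ c → c ⋖ z → A (κ z) (κ y) → κ y = κ c := by
    intro y hy c hyc hcz hA
    refine H.color_eq_of_forest hE hy hyc (fun r h1 h2 h3 => ?_) hA
      (H.symm _ _ (H.covBy _ (hE hyc hy) _ hcz))
    exact (h2.trans_lt hcz.lt).not_ge (hlow r (hE h1 hy) h3)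
  cases hd with
  | @base _ _ _ _ hpw hpz hwq hzq hwz hI =>
    refine ⟨w, t, hwz, hpw.lt, hpz.lt, hwq.lt, hzq.lt, H.symm _ _ (H.covBy _ (hm _ hpw.lt) _ hwq),
      H.symm _ _ (H.covBy _ (hm _ hpz.lt) _ hzq), ?_, ?_⟩
    · intro c hc
      have : c ∈ Icc m z := ⟨hc.le, hle c hc⟩
      rw [hI] at this
      rcases this with rfl | h | h | rfl
      · exact (hc.ne rfl).elim
      · exact Or.inl h
      · exact Or.inr h
      · exact (hc.2 hpw.lt hwq.lt).elim
    · intro y hy hyz hA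
      obtain ⟨c, hyc, hcz⟩ := exists_le_covBy_of_lt hyz
      have hκ := hcol y hy c hyc hcz hA
      rcases hP.covBy_unique_three (.base hpw hpz hwq hzq hwz hI) hcz with rfl | rfl
      · exact Or.inl (le_antisymm hyc (H.cover_lowest hP hE hmE hm hpw hy hκ))
      · exact Or.inr (le_antisymm hyc (H.cover_lowest hP hE hmE hm hpz hy hκ))
  | @step _ u n _ _ _ _ hd1 hp hq hI =>
    have huE := hm u hp.lt
    have hun := H.consec_of_dInt _ huE _ _ _ _ hd1
    have hA := H.symm _ _ (H.covBy _ (hE hun.1.le huE) _ hq)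
    refine ⟨u, n, hun.1.ne, hp.lt, hp.lt.trans hun.1, hun.1.trans hq.lt, hq.lt, hun.2.1 ▸ hA, hA,
      fun c hc => Or.inl (cover_eq hd1 hp hq hI hc (hle c hc)), ?_⟩
    intro y hy hyz hA'
    obtain ⟨c, hyc, hcz⟩ := exists_le_covBy_of_lt hyz
    have hκ := hcol y hy c hyc hcz hA'
    obtain rfl := hP.covBy_unique hd1 hp hq hI hcz
    have huy := H.cover_lowest hP hE hmE hm hp hy (hκ.trans hun.2.1.symm)
    by_contra! hne
    exact hun.2.2 y (lt_of_le_of_ne huy hne.1.symm) (lt_of_le_of_ne hyc hne.2)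
      (hκ.trans hun.2.1.symm)

end HeapColoring

end DComplete

/-! ### Existence of the heap colouring. -/

namespace DComplete

open Set

variable {P : Type*} [PartialOrder P] [Finite P]

namespace HeapColoring

variable {E : Set P} {κ : P → P} {A : P → P → Prop}

open Classical in
-- The new element takes the colour of the maximum `z` of its `d`-interval. No colour and no edge is
-- added, so the forest stays the same; `z` is the next element of its colour by `max_lowest`.
theorem insert_of_dInt (hP : IsDComplete P) (H : HeapColoring E κ A) (hE : IsUpperSet E) {k : ℕ}
    {m z w t : P} (hmE : m ∉ E) (hm : ∀ v, m < v → v ∈ E) (hd : DInt k m z w t) :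
    HeapColoring (insert m E) (Function.update κ m (κ z)) A := by
  obtain ⟨a, b, hab, hma, hmb, haz, hbz, hAa, hAb, hcov, hnbr⟩ :=
    H.exists_lower_neighbors hP hE hmE hm hd
  have hzE := hm z hd.lt
  have hlow : ∀ y ∈ E, κ y = κ z → z ≤ y := fun y hy h => H.max_lowest hP hE hmE hm hd hy h
  have hκ : ∀ q ∈ E, Function.update κ m (κ z) q = κ q := fun q hq =>
    Function.update_of_ne (ne_of_mem_of_not_mem hq hmE) _ _
  have hκm : Function.update κ m (κ z) m = κ z := Function.update_self ..
  set κ' := Function.update κ m (κ z) with hκ'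
  have hcon : ∀ q ∈ E, ∀ r, Consec κ' q r ↔ Consec κ q r := by
    intro q hq r
    have : ∀ v, q < v → κ' v = κ v := fun v hv => hκ v (hE hv.le hq)
    constructor
    · rintro ⟨h1, h2, h3⟩
      refine ⟨h1, by rw [← hκ q hq, h2, this r h1], fun v hv hv' => ?_⟩
      rw [← this v hv, ← hκ q hq]
      exact h3 v hv hv'
    · rintro ⟨h1, h2, h3⟩
      refine ⟨h1, by rw [hκ q hq, h2, this r h1], fun v hv hv' => ?_⟩
      rw [this v hv, hκ q hq]
      exact h3 v hv hv'
  have hconm : Consec κ' m z := by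
    refine ⟨hd.lt, by rw [hκm, hκ z hzE], fun v hv hv' h => ?_⟩
    rw [hκm, hκ v (hm v hv)] at h
    exact hv'.not_ge (hlow v (hm v hv) h)
  have hconm' : ∀ r, Consec κ' m r → r = z := by
    rintro r ⟨h1, h2, h3⟩
    rw [hκm, hκ r (hm r h1)] at h2
    by_contra hne
    exact h3 z hd.lt (lt_of_le_of_ne (hlow r (hm r h1) h2.symm) (Ne.symm hne))
      (by rw [hκm, hκ z hzE])
  have hset : ∀ q ∈ E, ∀ v, q < v → κ' v = κ v := fun q hq v hv => hκ v (hE hv.le hq)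
  have hcompm : ∀ r ∈ E, κ z = κ r ∨ A (κ z) (κ r) → m ≤ r := by
    rintro r hr (h | h)
    · exact hd.lt.le.trans (hlow r hr h.symm)
    · rcases H.comp z hzE r hr (Or.inr h) with h' | h'
      · exact hd.lt.le.trans h'
      · rcases hnbr r hr (lt_of_le_of_ne h' fun e => H.irrefl (κ z) (by rwa [e] at h)) h with
          rfl | rfl
        exacts [hma.le, hmb.le]
  exact {
    mem_color := by
      rintro q (rfl | hq)
      · rw [hκm]; exact Or.inr (H.mem_color z hzE)
      · rw [hκ q hq]; exact Or.inr (H.mem_color q hq)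
    mem_adj := fun i j h => ⟨Or.inr (H.mem_adj i j h).1, Or.inr (H.mem_adj i j h).2⟩
    symm := H.symm
    irrefl := H.irrefl
    covBy := by
      rintro q (rfl | hq) r hr
      · rw [hκm, hκ r (hm r hr.lt)]
        rcases hcov r hr with rfl | rfl
        exacts [hAa, hAb]
      · rw [hκ q hq, hset q hq r hr.lt]
        exact H.covBy q hq r hr
    comp := by
      rintro q (rfl | hq) r (rfl | hr) h
      · exact Or.inl le_rfl
      · rw [hκm, hκ r hr] at h
        exact Or.inl (hcompm r hr h)
      · rw [hκm, hκ q hq] at h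
        exact Or.inr (hcompm q hq (h.imp Eq.symm (H.symm _ _)))
      · rw [hκ q hq, hκ r hr] at h
        exact H.comp q hq r hr h
    two := by
      rintro q (rfl | hq) r hc
      · obtain rfl := hconm' r hc
        rw [hκm, ← ncard_pair hab]
        congr 1
        ext v
        constructor
        · rintro ⟨h1, h2, h3⟩
          rw [hκ v (hm v h1)] at h3
          exact hnbr v (hm v h1) h2 h3
        · rintro (rfl | rfl)
          · exact ⟨hma, haz, by rwa [hκ _ (hm _ hma)]⟩
          · exact ⟨hmb, hbz, by rwa [hκ _ (hm _ hmb)]⟩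
      · rw [← H.two q hq r ((hcon q hq r).1 hc), hκ q hq]
        congr 1
        ext v
        simp only [mem_ofPred_eq]
        refine and_congr_right fun h => ?_
        rw [hset q hq v h]
    top := by
      rintro q (rfl | hq) hc
      · exact (hc z hd.lt hconm.2.1.symm).elim
      · rw [hκ q hq] at hc ⊢
        refine le_trans (le_of_eq ?_) (H.top q hq fun v hv => by
          rw [← hset q hq v hv]; exact hc v hv)
        congr 1
        ext v
        simp only [mem_ofPred_eq]
        refine and_congr_right fun h => ?_
        rw [hset q hq v h]
    forest := H.forest
    consec_of_dInt := by
      rintro q (rfl | hq) l r w' t' hd'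
      · exact H.max_unique hP hE hm hd hd' ▸ hconm
      · exact (hcon q hq r).2 (H.consec_of_dInt q hq l r w' t' hd')
    dInt_of_consec := by
      rintro q (rfl | hq) r hc
      · exact hconm' r hc ▸ ⟨k, w, t, hd⟩
      · exact H.dInt_of_consec q hq r ((hcon q hq r).1 hc) }

open Classical in
-- Two covers of `m` would complete to a diamond, so there is at most one cover `u`. If the colour
-- of `u` recurred above `u`, the resulting `d`-interval would extend down to `m`; so `u` is alone
-- in its colour. A new colour attached only to that of `u` is a leaf (or isolated), which keeps the
-- forest and makes the comparabilities trivial.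
theorem exists_insert_of_not_dInt (hP : IsDComplete P) (H : HeapColoring E κ A)
    (hE : IsUpperSet E) {m : P} (hmE : m ∉ E) (hm : ∀ v, m < v → v ∈ E)
    (hd : ∀ k z w t, ¬ DInt k m z w t) :
    ∃ κ' A', HeapColoring (insert m E) κ' A' := by
  have huniq : ∀ c c', m ⋖ c → m ⋖ c' → c = c' := by
    intro c c' hc hc'
    by_contra hne
    obtain ⟨z, hz⟩ := hP.exists_dInt_three hc hc' hne
    exact hd _ _ _ _ hz
  have hsole : ∀ u, m ⋖ u → ∀ y ∈ E, κ y = κ u → y = u := by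
    intro u hu y hy hyu
    have huy := H.cover_lowest hP hE hmE hm hu hy hyu
    rcases huy.eq_or_lt with h | h
    · exact h.symm
    exfalso
    obtain ⟨n, -, hc⟩ := exists_consec_above h hyu.symm
    obtain ⟨k, w, t, hk⟩ := H.dInt_of_consec u (hm u hu.lt) n hc
    obtain ⟨z, hnz, hI⟩ := hP.exists_dInt_succ hk hu fun v h1 h2 => by
      rcases h1.eq_or_lt with rfl | h1
      · exact Or.inl rfl
      · obtain ⟨c, hc, hcv⟩ := exists_covBy_le_of_lt h1
        exact Or.inr (huniq c u hc hu ▸ hcv)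
    exact hd _ _ _ _ (.step hk hu hnz hI)
  have hκ : ∀ q ∈ E, Function.update κ m m q = κ q := fun q hq =>
    Function.update_of_ne (ne_of_mem_of_not_mem hq hmE) _ _
  have hκm : Function.update κ m m m = m := Function.update_self ..
  set κ' := Function.update κ m m with hκ'
  let A' : P → P → Prop := fun i j =>
    A i j ∨ (i = m ∧ ∃ u, m ⋖ u ∧ j = κ u) ∨ (j = m ∧ ∃ u, m ⋖ u ∧ i = κ u)
  have hκE : ∀ q ∈ E, κ q ≠ m := fun q hq h => hmE (h ▸ H.mem_color q hq)
  have hA : ∀ i j, i ≠ m → j ≠ m → (A' i j ↔ A i j) := by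
    intro i j hi hj
    simp [A', hi, hj]
  have hAm : ∀ j, A' m j ↔ ∃ u, m ⋖ u ∧ j = κ u := by
    intro j
    constructor
    · rintro (h | ⟨-, h⟩ | ⟨-, u, hu, h⟩)
      · exact (hmE (H.mem_adj _ _ h).1).elim
      · exact h
      · exact (hκE u (hm u hu.lt) h.symm).elim
    · exact fun h => Or.inr (Or.inl ⟨rfl, h⟩)
  have hsymm : ∀ i j, A' i j → A' j i := by
    rintro i j (h | h | h)
    · exact Or.inl (H.symm _ _ h)
    · exact Or.inr (Or.inr h)
    · exact Or.inr (Or.inl h)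
  have hAE : ∀ q ∈ E, ∀ r ∈ E, (A' (κ' q) (κ' r) ↔ A (κ q) (κ r)) := fun q hq r hr => by
    rw [hκ q hq, hκ r hr, hA _ _ (hκE q hq) (hκE r hr)]
  have hset : ∀ q ∈ E, ∀ v, q < v → κ' v = κ v := fun q hq v hv => hκ v (hE hv.le hq)
  have hcon : ∀ q ∈ E, ∀ r, Consec κ' q r ↔ Consec κ q r := by
    intro q hq r
    constructor
    · rintro ⟨h1, h2, h3⟩
      refine ⟨h1, by rw [← hκ q hq, h2, hset q hq r h1], fun v hv hv' => ?_⟩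
      rw [← hset q hq v hv, ← hκ q hq]
      exact h3 v hv hv'
    · rintro ⟨h1, h2, h3⟩
      refine ⟨h1, by rw [hκ q hq, h2, hset q hq r h1], fun v hv hv' => ?_⟩
      rw [hset q hq v hv, hκ q hq]
      exact h3 v hv hv'
  have hconm : ∀ r, ¬ Consec κ' m r := by
    rintro r ⟨h1, h2, -⟩
    rw [hκm, hκ r (hm r h1)] at h2
    exact hκE r (hm r h1) h2.symm
  have hcompm : ∀ r ∈ E, κ' m = κ' r ∨ A' (κ' m) (κ' r) → m ≤ r := by
    rintro r hr (h | h)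
    · rw [hκm, hκ r hr] at h
      exact (hκE r hr h.symm).elim
    · rw [hκm, hκ r hr, hAm] at h
      obtain ⟨u, hu, h⟩ := h
      exact hsole u hu r hr h ▸ hu.le
  refine ⟨κ', A', {
    mem_color := by
      rintro q (rfl | hq)
      · rw [hκm]; exact Or.inl rfl
      · rw [hκ q hq]; exact Or.inr (H.mem_color q hq)
    mem_adj := by
      rintro i j (h | ⟨rfl, u, hu, rfl⟩ | ⟨rfl, u, hu, rfl⟩)
      · exact ⟨Or.inr (H.mem_adj i j h).1, Or.inr (H.mem_adj i j h).2⟩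
      · exact ⟨Or.inl rfl, Or.inr (H.mem_color u (hm u hu.lt))⟩
      · exact ⟨Or.inr (H.mem_color u (hm u hu.lt)), Or.inl rfl⟩
    symm := hsymm
    irrefl := by
      rintro i (h | ⟨rfl, u, hu, h⟩ | ⟨rfl, u, hu, h⟩)
      · exact H.irrefl i h
      · exact hκE u (hm u hu.lt) h.symm
      · exact hκE u (hm u hu.lt) h.symm
    covBy := by
      rintro q (rfl | hq) r hr
      · rw [hκm, hκ r (hm r hr.lt), hAm]
        exact ⟨r, hr, rfl⟩
      · rw [hAE q hq r (hE hr.le hq)]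
        exact H.covBy q hq r hr
    comp := by
      rintro q (rfl | hq) r (rfl | hr) h
      · exact Or.inl le_rfl
      · exact Or.inl (hcompm r hr h)
      · exact Or.inr (hcompm q hq (h.imp Eq.symm (hsymm _ _)))
      · rw [hAE q hq r hr, hκ q hq, hκ r hr] at h
        exact H.comp q hq r hr h
    two := by
      rintro q (rfl | hq) r hc
      · exact (hconm r hc).elim
      · rw [← H.two q hq r ((hcon q hq r).1 hc)]
        congr 1
        ext v
        simp only [mem_ofPred_eq]
        refine and_congr_right fun h => ?_
        rw [hAE q hq v (hE h.le hq)]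
    top := by
      rintro q (rfl | hq) hc
      · refine (ncard_le_one (toFinite _)).2 ?_
        rintro v ⟨h1, h2⟩ v' ⟨h1', h2'⟩
        rw [hκm, hκ _ (hm _ h1), hAm] at h2
        rw [hκm, hκ _ (hm _ h1'), hAm] at h2'
        obtain ⟨u, hu, h2⟩ := h2
        obtain ⟨u', hu', h2'⟩ := h2'
        rw [hsole u hu v (hm v h1) h2, hsole u' hu' v' (hm v' h1') h2', huniq u u' hu hu']
      · refine le_trans (le_of_eq ?_) (H.top q hq fun v hv => by
          rw [← hset q hq v hv, ← hκ q hq]; exact hc v hv)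
        congr 1
        ext v
        simp only [mem_ofPred_eq]
        refine and_congr_right fun h => ?_
        rw [hAE q hq v (hE h.le hq)]
    forest := by
      intro i
      by_cases him : i = m
      · subst him
        by_cases hu : ∃ u, i ⋖ u
        · obtain ⟨u, hu⟩ := hu
          refine ⟨fun _ => κ u, fun _ _ _ _ _ => rfl, fun b hb => ?_⟩
          obtain ⟨u', hu', rfl⟩ := (hAm b).1 hb
          rw [huniq u u' hu hu']
        · exact ⟨fun _ => i, fun _ _ _ _ _ => rfl, fun b hb => by
            obtain ⟨u', hu', -⟩ := (hAm b).1 hb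
            exact (hu ⟨u', hu'⟩).elim⟩
      · obtain ⟨f, hf, hf'⟩ := H.forest i
        by_cases hu : ∃ u, m ⋖ u
        · obtain ⟨u, hu⟩ := hu
          have huE := hm u hu.lt
          -- After deleting `i`, the leaf `m` belongs to the component of `κ u`, unless `κ u = i`;
          -- then `m` is a component of its own and a neighbour of `i`, so it must be labelled by
          -- itself.
          let g := Function.update f m (if κ u = i then m else f (κ u))
          have hgm : g m = if κ u = i then m else f (κ u) := Function.update_self ..
          have hg : ∀ j, j ≠ m → g j = f j := fun j hj => Function.update_of_ne hj _ _
          have hmk : ∀ k, A' m k → k ≠ i → g m = g k := by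
            intro k hk hki
            obtain ⟨u', hu', rfl⟩ := (hAm k).1 hk
            obtain rfl := huniq u u' hu hu'
            rw [hgm, if_neg hki, hg _ (hκE u huE)]
          refine ⟨g, fun j k hjk hj hk => ?_, fun b hb => ?_⟩
          · by_cases hjm : j = m
            · subst hjm; exact hmk k hjk hk
            by_cases hkm : k = m
            · subst hkm; exact (hmk j (hsymm _ _ hjk) hj).symm
            rw [hg j hjm, hg k hkm]
            exact hf j k ((hA j k hjm hkm).1 hjk) hj hk
          · by_cases hbm : b = m
            · subst hbm
              obtain ⟨u', hu', rfl⟩ := (hAm i).1 (hsymm _ _ hb)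
              obtain rfl := huniq u u' hu hu'
              rw [hgm, if_pos rfl]
            · rw [hg b hbm]
              exact hf' b ((hA i b him hbm).1 hb)
        · have hAA : ∀ j k, A' j k → A j k := by
            rintro j k (h | ⟨-, u, h, -⟩ | ⟨-, u, h, -⟩)
            exacts [h, (hu ⟨u, h⟩).elim, (hu ⟨u, h⟩).elim]
          exact ⟨f, fun j k h => hf j k (hAA j k h), fun b h => hf' b (hAA i b h)⟩
    consec_of_dInt := by
      rintro q (rfl | hq) l r w' t' hd'
      · exact (hd _ _ _ _ hd').elim
      · exact (hcon q hq r).2 (H.consec_of_dInt q hq l r w' t' hd')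
    dInt_of_consec := by
      rintro q (rfl | hq) r hc
      · exact (hconm r hc).elim
      · exact H.dInt_of_consec q hq r ((hcon q hq r).1 hc) }⟩

end HeapColoring

theorem IsDComplete.exists_heapColoring (hP : IsDComplete P) :
    ∃ (κ : P → P) (A : P → P → Prop), HeapColoring univ κ A := by
  suffices h : ∀ S : Set P, IsLowerSet S → ∃ κ A, HeapColoring Sᶜ κ A by
    simpa using h ∅ isLowerSet_empty
  intro S
  induction hn : Sᶜ.ncard generalizing S with
  | zero =>
    intro _
    rw [ncard_eq_zero (toFinite _)] at hn
    rw [hn]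
    exact ⟨id, fun _ _ => False, by
      constructor <;> try simp
      exact fun i => Or.inr ⟨i⟩⟩
  | succ n ih =>
    intro hS
    obtain ⟨m, hm, hmin⟩ := (wellFounded_lt (α := P)).has_min Sᶜ
      ((ncard_pos (toFinite _)).1 (by omega))
    have hE : IsUpperSet (Sᶜ \ {m}) := by
      rintro a b hab ⟨ha, ham⟩
      refine ⟨hS.compl hab ha, ?_⟩
      rintro rfl
      exact hmin a ha (lt_of_le_of_ne hab ham)
    obtain ⟨κ, A, H⟩ := ih (Sᶜ \ {m})ᶜ
      (by rw [compl_compl, ncard_sdiff_singleton_of_mem hm, hn]; rfl) hE.compl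
    rw [compl_compl] at H
    have hmE : m ∉ Sᶜ \ {m} := by simp
    have hm' : ∀ v, m < v → v ∈ Sᶜ \ {m} := fun v hv => ⟨hS.compl hv.le hm, hv.ne'⟩
    have hins : insert m (Sᶜ \ {m}) = Sᶜ := by rw [insert_sdiff_singleton, insert_eq_of_mem hm]
    rw [← hins]
    by_cases hd : ∃ k z w t, DInt k m z w t
    · obtain ⟨k, z, w, t, hd⟩ := hd
      exact ⟨_, _, H.insert_of_dInt hP hE hmE hm' hd⟩
    · push Not at hd
      exact H.exists_insert_of_not_dInt hP hE hmE hm' hd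

end DComplete

/-! ### The Cartan pairing of a colour with sets of elements. -/

namespace DComplete

open Finset

open scoped Classical

/-- The entries of the generalized Cartan matrix of the graph `A`. -/
noncomputable def cartan {C : Type*} (A : C → C → Prop) (i j : C) : ℚ :=
  if i = j then 2 else if A i j then -1 else 0

theorem cartan_self {C : Type*} (A : C → C → Prop) (i : C) : cartan A i i = 2 := if_pos rfl

theorem sum_cartan_of_ne {C P : Type*} {A : C → C → Prop} {κ : P → C} {i : C} {s : Finset P}
    (h : ∀ v ∈ s, κ v ≠ i) :
    ∑ v ∈ s, cartan A i (κ v) = -((s.filter fun v => A i (κ v)).card : ℚ) := by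
  rw [card_filter, Nat.cast_sum, ← sum_neg_distrib]
  refine sum_congr rfl fun v hv => ?_
  rw [cartan, if_neg (h v hv).symm]
  split_ifs <;> simp

variable {P : Type*} [PartialOrder P] [Fintype P]

namespace HeapColoring

variable {κ : P → P} {A : P → P → Prop}

theorem cartan_comm (H : HeapColoring Set.univ κ A) (i j : P) : cartan A i j = cartan A j i := by
  simp only [cartan, eq_comm (a := i), show A i j ↔ A j i from ⟨H.symm i j, H.symm j i⟩]

theorem comparable_of_cartan_ne_zero (H : HeapColoring Set.univ κ A) {q v : P}
    (h : cartan A (κ q) (κ v) ≠ 0) : q ≤ v ∨ v ≤ q := by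
  refine H.comp q trivial v trivial ?_
  by_contra! hc
  exact h (by rw [cartan, if_neg hc.1, if_neg hc.2])

/-- Elements incomparable to `q` have colours neither equal nor adjacent to that of `q`, so they
contribute nothing. -/
theorem sum_cartan_split (H : HeapColoring Set.univ κ A) (s : Finset P) (q : P) :
    ∑ v ∈ s, cartan A (κ q) (κ v) = ∑ v ∈ s with v < q, cartan A (κ q) (κ v) +
      ∑ v ∈ s with q ≤ v, cartan A (κ q) (κ v) := by
  rw [← sum_filter_add_sum_filter_not s (· < q)]
  congr 1
  symm
  refine sum_subset (fun v hv => ?_) fun v hv hv' => ?_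
  · simp only [mem_filter] at hv ⊢
    exact ⟨hv.1, hv.2.not_gt⟩
  · simp only [mem_filter, not_and] at hv hv'
    by_contra hne
    rcases H.comparable_of_cartan_ne_zero hne with h | h
    · exact hv' hv.1 h
    · exact hv' hv.1 (eq_of_le_of_not_lt h hv.2).ge

theorem sum_cartan_split' (H : HeapColoring Set.univ κ A) (s : Finset P) (q : P) :
    ∑ v ∈ s, cartan A (κ q) (κ v) = ∑ v ∈ s with v ≤ q, cartan A (κ q) (κ v) +
      ∑ v ∈ s with q < v, cartan A (κ q) (κ v) := by
  rw [← sum_filter_add_sum_filter_not s (· ≤ q)]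
  congr 1
  symm
  refine sum_subset (fun v hv => ?_) fun v hv hv' => ?_
  · simp only [mem_filter] at hv ⊢
    exact ⟨hv.1, hv.2.not_ge⟩
  · simp only [mem_filter, not_and] at hv hv'
    by_contra hne
    rcases H.comparable_of_cartan_ne_zero hne with h | h
    · exact hv' hv.1 (lt_of_le_not_ge h hv.2)
    · exact hv.2 h

/-- The lower end contributes `2`, and the two adjacent elements in between contribute `-1` each.
Chains of such pieces telescope to zero, which is the main cancellation below. -/
theorem sum_cartan_consec (H : HeapColoring Set.univ κ A) {y t : P} (h : Consec κ y t) :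
    ∑ v with y ≤ v ∧ v < t, cartan A (κ y) (κ v) = 0 := by
  have h1 : univ.filter (fun v => y ≤ v ∧ v < t) =
      insert y (univ.filter fun v => y < v ∧ v < t) := by
    ext v
    simp only [mem_filter, mem_univ, true_and, mem_insert]
    constructor
    · rintro ⟨h1, h2⟩
      exact h1.eq_or_lt.imp Eq.symm fun h1 => ⟨h1, h2⟩
    · rintro (rfl | ⟨h1, h2⟩)
      exacts [⟨le_rfl, h.1⟩, ⟨h1.le, h2⟩]
  have h2 := H.two y trivial t h
  rw [Set.ncard_eq_toFinset_card'] at h2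
  rw [h1, sum_insert (by simp), cartan_self, sum_cartan_of_ne]
  · rw [show (univ.filter fun v => y < v ∧ v < t).filter (fun v => A (κ y) (κ v)) =
      Set.toFinset {v | y < v ∧ v < t ∧ A (κ y) (κ v)} by ext; simp [and_assoc], h2]
    norm_num
  · intro v hv
    simp only [mem_filter, mem_univ, true_and] at hv
    exact h.2.2 v hv.1 hv.2

theorem sum_cartan_Ico (H : HeapColoring Set.univ κ A) {l t : P} (hlt : l ≤ t) (hκ : κ l = κ t) :
    ∑ v with l ≤ v ∧ v < t, cartan A (κ l) (κ v) = 0 := by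
  induction t using (wellFounded_lt (α := P)).induction with
  | _ t ih =>
    rcases hlt.eq_or_lt with rfl | hlt'
    · refine sum_eq_zero fun v hv => ?_
      simp only [mem_filter, mem_univ, true_and] at hv
      exact (hv.2.not_ge hv.1).elim
    obtain ⟨y, hly, hc⟩ := exists_consec_below hlt' hκ
    have hy : κ l = κ y := hκ.trans hc.2.1.symm
    rw [hy, H.sum_cartan_split _ y, filter_filter, filter_filter]
    have e1 : univ.filter (fun v => (l ≤ v ∧ v < t) ∧ v < y) = univ.filter fun v => l ≤ v ∧ v < y := by
      ext v
      simp only [mem_filter, mem_univ, true_and]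
      exact ⟨fun h => ⟨h.1.1, h.2⟩, fun h => ⟨⟨h.1, h.2.trans hc.1⟩, h.2⟩⟩
    have e2 : univ.filter (fun v => (l ≤ v ∧ v < t) ∧ y ≤ v) = univ.filter fun v => y ≤ v ∧ v < t := by
      ext v
      simp only [mem_filter, mem_univ, true_and]
      exact ⟨fun h => ⟨h.2, h.1.2⟩, fun h => ⟨⟨hly.trans h.1, h.2⟩, h.1⟩⟩
    rw [e1, e2, H.sum_cartan_consec hc, ← hy, ih y hc.1 hly hy, add_zero]

theorem sum_cartan_Ioc (H : HeapColoring Set.univ κ A) {l t : P} (hlt : l ≤ t) (hκ : κ l = κ t) :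
    ∑ v with l < v ∧ v ≤ t, cartan A (κ l) (κ v) = 0 := by
  have h1 : ∑ v with l ≤ v ∧ v ≤ t, cartan A (κ l) (κ v) =
      ∑ v with l < v ∧ v ≤ t, cartan A (κ l) (κ v) + 2 := by
    rw [show univ.filter (fun v => l ≤ v ∧ v ≤ t) =
      insert l (univ.filter fun v => l < v ∧ v ≤ t) by
        ext v
        simp only [mem_filter, mem_univ, true_and, mem_insert]
        constructor
        · rintro ⟨h1, h2⟩
          exact h1.eq_or_lt.imp Eq.symm fun h1 => ⟨h1, h2⟩
        · rintro (rfl | ⟨h1, h2⟩)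
          exacts [⟨le_rfl, hlt⟩, ⟨h1.le, h2⟩], sum_insert (by simp), cartan_self, add_comm]
  have h2 : ∑ v with l ≤ v ∧ v ≤ t, cartan A (κ l) (κ v) =
      ∑ v with l ≤ v ∧ v < t, cartan A (κ l) (κ v) + 2 := by
    rw [show univ.filter (fun v => l ≤ v ∧ v ≤ t) =
      insert t (univ.filter fun v => l ≤ v ∧ v < t) by
        ext v
        simp only [mem_filter, mem_univ, true_and, mem_insert]
        constructor
        · rintro ⟨h1, h2⟩
          exact h2.eq_or_lt.imp_right fun h2 => ⟨h1, h2⟩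
        · rintro (rfl | ⟨h1, h2⟩)
          exacts [⟨hlt, le_rfl⟩, ⟨h1, h2.le⟩], sum_insert (by simp), hκ, cartan_self, add_comm]
  rw [H.sum_cartan_Ico hlt hκ] at h2
  linarith

theorem exists_top_color {C : Type*} {κ : P → C} (p : P → Prop) (q : P) (hq : p q) :
    ∃ t, q ≤ t ∧ κ t = κ q ∧ p t ∧ ∀ v, t < v → p v → κ v ≠ κ t := by
  obtain ⟨t, ⟨h1, h2, h3⟩, h4⟩ := (wellFounded_gt (α := P)).has_min
    {v | q ≤ v ∧ κ v = κ q ∧ p v} ⟨q, le_rfl, rfl, hq⟩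
  exact ⟨t, h1, h2, h3, fun v hv hpv he => h4 v ⟨h1.trans hv.le, he.trans h2, hpv⟩ hv⟩

theorem exists_bot_color {C : Type*} {κ : P → C} (p : P → Prop) (q : P) (hq : p q) :
    ∃ t, t ≤ q ∧ κ t = κ q ∧ p t ∧ ∀ v, v < t → p v → κ v ≠ κ t := by
  obtain ⟨t, ⟨h1, h2, h3⟩, h4⟩ := (wellFounded_lt (α := P)).has_min
    {v | v ≤ q ∧ κ v = κ q ∧ p v} ⟨q, le_rfl, rfl, hq⟩
  exact ⟨t, h1, h2, h3, fun v hv hpv he => h4 v ⟨hv.le.trans h1, he.trans h2, hpv⟩ hv⟩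

/-- `1` plus the pairing of the colour of `q` with everything above `q`: the coefficient of the
colour of `q` in the dominant weight whose orbit contains all upper sets. -/
noncomputable def weight (κ : P → P) (A : P → P → Prop) (q : P) : ℚ :=
  1 + ∑ v with q < v, cartan A (κ q) (κ v)

/-- The part between `l` and `t` pairs to zero, so the weight depends on the colour only. -/
theorem weight_eq (H : HeapColoring Set.univ κ A) {l t : P} (hlt : l ≤ t) (hκ : κ l = κ t) :
    weight κ A l = weight κ A t := by
  rw [weight, weight, hκ, H.sum_cartan_split' _ t, filter_filter, filter_filter]
  have e1 := H.sum_cartan_Ioc hlt hκ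
  rw [hκ] at e1
  rw [e1, zero_add]
  congr 2
  ext v
  simp only [mem_filter, mem_univ, true_and]
  exact ⟨fun h => h.2, fun h => ⟨hlt.trans_lt h, h⟩⟩

theorem weight_eq' (H : HeapColoring Set.univ κ A) {l t : P} (hκ : κ l = κ t) :
    weight κ A l = weight κ A t := by
  rcases H.comp l trivial t trivial (Or.inl hκ) with h | h
  · exact H.weight_eq h hκ
  · exact (H.weight_eq h hκ.symm).symm

/-- Evaluated at the top element of the colour, the weight is `1` minus the number of adjacent
elements above, which is at most one. -/
theorem weight_nonneg (H : HeapColoring Set.univ κ A) (q : P) : 0 ≤ weight κ A q := by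
  obtain ⟨t, hqt, hκ, -, ht⟩ := exists_top_color (κ := κ) (fun _ => True) q trivial
  rw [H.weight_eq hqt hκ.symm, weight, sum_cartan_of_ne]
  · have h := H.top t trivial fun v hv => ht v hv trivial
    rw [Set.ncard_eq_toFinset_card'] at h
    rw [show (univ.filter fun v => t < v).filter (fun v => A (κ t) (κ v)) =
      Set.toFinset {v | t < v ∧ A (κ t) (κ v)} by ext; simp]
    have : ((Set.toFinset {v | t < v ∧ A (κ t) (κ v)}).card : ℚ) ≤ 1 := by exact_mod_cast h
    linarith
  · intro v hv
    simp only [mem_filter, mem_univ, true_and] at hv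
    exact ht v hv trivial

theorem sum_cartan_Icc_eq (H : HeapColoring Set.univ κ A) {x p : P} (hxp : x ≤ p)
    (hx : ∀ v, x < v → v ≤ p → κ v ≠ κ x) :
    ∑ v with x ≤ v ∧ v ≤ p, cartan A (κ x) (κ v) =
      2 - ((univ.filter fun v => x ≤ v ∧ v ≤ p ∧ A (κ x) (κ v)).card : ℚ) := by
  rw [show univ.filter (fun v => x ≤ v ∧ v ≤ p) =
    insert x (univ.filter fun v => x < v ∧ v ≤ p) by
      ext v
      simp only [mem_filter, mem_univ, true_and, mem_insert]
      constructor
      · rintro ⟨h1, h2⟩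
        exact h1.eq_or_lt.imp Eq.symm fun h1 => ⟨h1, h2⟩
      · rintro (rfl | ⟨h1, h2⟩)
        exacts [⟨le_rfl, hxp⟩, ⟨h1.le, h2⟩], sum_insert (by simp), cartan_self,
    sum_cartan_of_ne, ← sub_eq_add_neg]
  · congr 3
    ext v
    simp only [mem_filter, mem_univ, true_and]
    constructor
    · rintro ⟨⟨h1, h2⟩, h3⟩
      exact ⟨h1.le, h2, h3⟩
    · rintro ⟨h1, h2, h3⟩
      refine ⟨⟨lt_of_le_of_ne h1 ?_, h2⟩, h3⟩
      rintro rfl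
      exact H.irrefl _ h3
  · intro v hv
    simp only [mem_filter, mem_univ, true_and] at hv
    exact hx v hv.1 hv.2

theorem sum_cartan_Icc_le_one (H : HeapColoring Set.univ κ A) {x p : P} (hxp : x < p)
    (hx : ∀ v, x < v → v ≤ p → κ v ≠ κ x) :
    ∑ v with x ≤ v ∧ v ≤ p, cartan A (κ x) (κ v) ≤ 1 := by
  rw [H.sum_cartan_Icc_eq hxp.le hx]
  obtain ⟨c, hc, hcp⟩ := exists_covBy_le_of_lt hxp
  have : 1 ≤ (univ.filter fun v => x ≤ v ∧ v ≤ p ∧ A (κ x) (κ v)).card :=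
    card_pos.2 ⟨c, by simpa using ⟨hc.le, hcp, H.covBy x trivial c hc⟩⟩
  have : (1 : ℚ) ≤ ((univ.filter fun v => x ≤ v ∧ v ≤ p ∧ A (κ x) (κ v)).card : ℚ) := by
    exact_mod_cast this
  linarith

/-- An interval cannot pair nonpositively with all colours. -/
theorem not_antidominant (H : HeapColoring Set.univ κ A) {x p : P} (hxp : x ≤ p)
    (hS : ∀ y, ∑ v with x ≤ v ∧ v ≤ p, cartan A (κ y) (κ v) ≤ 0) : False := by
  set D := univ.filter fun v => x ≤ v ∧ v ≤ p with hD
  have memD : ∀ v, v ∈ D ↔ x ≤ v ∧ v ≤ p := by simp [hD]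
  set Q := univ.filter fun v => ¬ v ≤ p with hQ
  -- Let `β` be the sum of the colours of `D`. The left side pairs `β` with the dominant weight
  -- minus the colours of `Q`, and the right side is half the norm of `β`, as `h2` shows.
  -- Antidominance makes the norm nonpositive and the left side positive.
  have h1 : ∑ q ∈ D, weight κ A q - ∑ y ∈ Q, ∑ v ∈ D, cartan A (κ y) (κ v) =
      ∑ q ∈ D, (1 + ∑ y ∈ D with q < y, cartan A (κ q) (κ y)) := by
    rw [sum_comm, ← sum_sub_distrib]
    refine sum_congr rfl fun q hq => ?_
    rw [memD] at hq
    have e1 : ∑ y ∈ Q, cartan A (κ y) (κ q) = ∑ y with q < y ∧ ¬ y ≤ p, cartan A (κ q) (κ y) := by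
      rw [sum_congr rfl fun y _ => H.cartan_comm (κ y) (κ q), H.sum_cartan_split' Q q,
        sum_eq_zero, zero_add]
      · refine sum_congr ?_ fun _ _ => rfl
        ext y
        simp [hQ, and_comm]
      · intro v hv
        simp only [hQ, mem_filter, mem_univ, true_and] at hv
        exact (hv.1 (hv.2.trans hq.2)).elim
    have e2 : D.filter (fun y => q < y) = univ.filter fun y => q < y ∧ y ≤ p := by
      ext y
      simp only [mem_filter, memD, mem_univ, true_and]
      exact ⟨fun h => ⟨h.2, h.1.2⟩, fun h => ⟨⟨hq.1.trans h.1.le, h.2⟩, h.1⟩⟩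
    rw [e1, e2, weight, ← sum_filter_add_sum_filter_not (univ.filter fun v => q < v) (· ≤ p),
      filter_filter, filter_filter]
    ring
  have h2 : 2 * ∑ q ∈ D, (1 + ∑ y ∈ D with q < y, cartan A (κ q) (κ y)) =
      ∑ q ∈ D, ∑ y ∈ D, cartan A (κ q) (κ y) := by
    have e1 : ∀ q ∈ D, ∑ y ∈ D, cartan A (κ q) (κ y) =
        ∑ y ∈ D with y < q, cartan A (κ q) (κ y) +
          (2 + ∑ y ∈ D with q < y, cartan A (κ q) (κ y)) := by
      intro q hq
      rw [H.sum_cartan_split D q]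
      congr 1
      rw [show D.filter (fun y => q ≤ y) = insert q (D.filter fun y => q < y) by
        ext v
        simp only [mem_filter, mem_insert]
        constructor
        · rintro ⟨h1, h2⟩
          exact h2.eq_or_lt.imp Eq.symm fun h2 => ⟨h1, h2⟩
        · rintro (rfl | ⟨h1, h2⟩)
          exacts [⟨hq, le_rfl⟩, ⟨h1, h2.le⟩], sum_insert (by simp), cartan_self]
    have e2 : ∑ q ∈ D, ∑ y ∈ D with y < q, cartan A (κ q) (κ y) =
        ∑ q ∈ D, ∑ y ∈ D with q < y, cartan A (κ q) (κ y) := by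
      simp only [sum_filter]
      rw [sum_comm]
      refine sum_congr rfl fun q _ => sum_congr rfl fun y _ => ?_
      rw [H.cartan_comm]
    rw [sum_congr rfl e1]
    simp only [sum_add_distrib, e2, sum_const, nsmul_eq_mul]
    ring
  have h3 : ∑ q ∈ D, ∑ y ∈ D, cartan A (κ q) (κ y) ≤ 0 := sum_nonpos fun q _ => hS q
  have h4 : 0 < ∑ q ∈ D, weight κ A q - ∑ y ∈ Q, ∑ v ∈ D, cartan A (κ y) (κ v) := by
    have n1 : 0 ≤ ∑ q ∈ D, weight κ A q := sum_nonneg fun q _ => H.weight_nonneg q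
    have n2 : ∑ y ∈ Q, ∑ v ∈ D, cartan A (κ y) (κ v) ≤ 0 := sum_nonpos fun q _ => hS q
    -- Strict positivity comes from the highest element `t` whose colour occurs in `D`. If nothing
    -- adjacent lies above `t`, its weight is `1`. Otherwise an adjacent `y` above `t` lies in `Q`,
    -- and its colour, absent from `D`, pairs strictly negatively with `D`.
    obtain ⟨t, ⟨v, hv, htv⟩, ht⟩ := (wellFounded_gt (α := P)).has_min
      {t | ∃ v ∈ D, κ t = κ v} ⟨x, x, (memD x).2 ⟨le_rfl, hxp⟩, rfl⟩
    have ht' : ∀ y, t < y → ∀ v ∈ D, κ v ≠ κ y := fun y hy v hv he => ht y ⟨v, hv, he.symm⟩ hy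
    have hsum : ∑ v with t < v, cartan A (κ t) (κ v) =
        -(((univ.filter fun v => t < v).filter fun y => A (κ t) (κ y)).card : ℚ) := by
      refine sum_cartan_of_ne fun y hy he => ?_
      simp only [mem_filter, mem_univ, true_and] at hy
      exact ht' y hy v hv (htv.symm.trans he.symm)
    rcases (((univ.filter fun v => t < v).filter fun y => A (κ t) (κ y))).eq_empty_or_nonempty
      with he | ⟨y, hy⟩
    · have : weight κ A v = 1 := by
        rw [← H.weight_eq' htv, weight, hsum, he]
        simp
      have : weight κ A v ≤ ∑ q ∈ D, weight κ A q :=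
        single_le_sum (f := fun q => weight κ A q) (fun q _ => H.weight_nonneg q) hv
      linarith
    · simp only [mem_filter, mem_univ, true_and] at hy
      have hyQ : y ∈ Q := by
        simp only [hQ, mem_filter, mem_univ, true_and]
        intro hyp
        refine ht' y hy.1 y ((memD y).2 ⟨?_, hyp⟩) rfl
        rcases H.comp t trivial v trivial (Or.inl htv) with h | h
        · rcases h.eq_or_lt with rfl | h
          · exact ((memD _).1 hv).1.trans hy.1.le
          · exact (ht' v h v hv rfl).elim
        · exact ((memD _).1 hv).1.trans (h.trans hy.1.le)
      have hneg : ∑ v ∈ D, cartan A (κ y) (κ v) < 0 := by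
        rw [sum_cartan_of_ne (ht' y hy.1), neg_lt_zero]
        exact_mod_cast card_pos.2 ⟨v, by
          simp only [mem_filter]
          exact ⟨hv, htv ▸ H.symm _ _ hy.2⟩⟩
      have : ∑ y ∈ Q, ∑ v ∈ D, cartan A (κ y) (κ v) < 0 :=
        sum_neg' (fun q _ => hS q) ⟨y, hyQ, hneg⟩
      linarith
  linarith

/-- If the colours of the ends of an interval occur only once in it, then the minimum has
exactly one neighbour in the interval. -/
theorem sum_cartan_Icc_eq_one (H : HeapColoring Set.univ κ A) {x p : P} (hxp : x < p)
    (hx : ∀ v, x < v → v ≤ p → κ v ≠ κ x) (hp : ∀ v, x ≤ v → v < p → κ v ≠ κ p) :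
    ∑ v with x ≤ v ∧ v ≤ p, cartan A (κ x) (κ v) = 1 := by
  refine le_antisymm (H.sum_cartan_Icc_le_one hxp hx) ?_
  induction hn : (univ.filter fun v => x ≤ v ∧ v ≤ p).card using Nat.strong_induction_on
    generalizing x p with
  | _ n ih =>
    subst hn
    by_contra hlt
    have hcard : 2 ≤ (univ.filter fun v => x ≤ v ∧ v ≤ p ∧ A (κ x) (κ v)).card := by
      rw [H.sum_cartan_Icc_eq hxp.le hx] at hlt
      by_contra hle
      have : ((univ.filter fun v => x ≤ v ∧ v ≤ p ∧ A (κ x) (κ v)).card : ℚ) ≤ 1 := by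
        exact_mod_cast (by omega : _ ≤ 1)
      exact hlt (by linarith)
    -- A minimal counterexample pairs nonpositively with every colour: clear for colours absent from
    -- the interval, and for the colour of `x` because `x` has at least two neighbours.
    refine H.not_antidominant hxp.le fun y => ?_
    set D := univ.filter fun v => x ≤ v ∧ v ≤ p with hD
    have memD : ∀ v, v ∈ D ↔ x ≤ v ∧ v ≤ p := by simp [hD]
    by_cases hy : ∃ v ∈ D, κ v = κ y
    swap
    · push Not at hy
      rw [sum_cartan_of_ne hy, neg_nonpos]
      exact Nat.cast_nonneg _
    obtain ⟨v, hv, hvy⟩ := hy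
    rw [← hvy]
    rw [memD] at hv
    by_cases hvx : κ v = κ x
    · rw [hvx, H.sum_cartan_Icc_eq hxp.le hx, sub_nonpos]
      exact_mod_cast hcard
    by_cases hvp : κ v = κ p
    · rw [hvp]
      have e1 : ∑ v ∈ D, cartan A (κ p) (κ v) =
          2 - ((univ.filter fun v => x ≤ v ∧ v ≤ p ∧ A (κ p) (κ v)).card : ℚ) := by
        rw [show D = insert p (univ.filter fun v => x ≤ v ∧ v < p) by
            ext v
            simp only [mem_filter, mem_univ, true_and, mem_insert, hD]
            constructor
            · rintro ⟨h1, h2⟩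
              exact h2.eq_or_lt.imp_right fun h2 => ⟨h1, h2⟩
            · rintro (rfl | ⟨h1, h2⟩)
              exacts [⟨hxp.le, le_rfl⟩, ⟨h1, h2.le⟩], sum_insert (by simp), cartan_self,
          sum_cartan_of_ne, ← sub_eq_add_neg]
        · congr 3
          ext v
          simp only [mem_filter, mem_univ, true_and]
          constructor
          · rintro ⟨⟨h1, h2⟩, h3⟩
            exact ⟨h1, h2.le, h3⟩
          · rintro ⟨h1, h2, h3⟩
            refine ⟨⟨h1, lt_of_le_of_ne h2 ?_⟩, h3⟩
            rintro rfl
            exact H.irrefl _ h3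
        · intro v hv
          simp only [mem_filter, mem_univ, true_and] at hv
          exact hp v hv.1 hv.2
      rw [e1, sub_nonpos]
      by_contra hle
      have hc1 : (univ.filter fun v => x ≤ v ∧ v ≤ p ∧ A (κ p) (κ v)).card ≤ 1 := by
        by_contra h
        exact hle (by exact_mod_cast (by omega : 2 ≤ _))
      have huniq : ∀ a b, x ≤ a → a ≤ p → A (κ p) (κ a) → x ≤ b → b ≤ p → A (κ p) (κ b) →
          a = b := fun a b h1 h2 h3 h4 h5 h6 =>
        card_le_one.1 hc1 a (by simpa using ⟨h1, h2, h3⟩) b (by simpa using ⟨h4, h5, h6⟩)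
      have hcov : ∀ c, c ⋖ p → A (κ p) (κ c) := fun c hc => H.symm _ _ (H.covBy c trivial p hc)
      have hpx : κ p ≠ κ x := hx p hxp le_rfl
      obtain ⟨c, hxc, hcp⟩ := exists_le_covBy_of_lt hxp
      have hbelow : ∀ v, x ≤ v → v < p → v ≤ c := by
        intro v h1 h2
        obtain ⟨c', hvc, hcp'⟩ := exists_le_covBy_of_lt h2
        obtain rfl := huniq c c' hxc hcp.le (hcov c hcp) (h1.trans hvc) hcp'.le (hcov c' hcp')
        exact hvc
      -- If `p` has a single neighbour, that is its only lower cover `c` in the interval. Removing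
      -- `p` leaves `[x, c]`, still with ends of unique colour, and does not change the pairing with
      -- the colour of `x`.
      rcases hxc.eq_or_lt with rfl | hxc'
      · have : (univ.filter fun v => x ≤ v ∧ v ≤ p ∧ A (κ x) (κ v)).card ≤ 1 := by
          rw [card_le_one]
          have : ∀ a ∈ (univ.filter fun v => x ≤ v ∧ v ≤ p ∧ A (κ x) (κ v)), a = p := by
            intro a ha
            simp only [mem_filter, mem_univ, true_and] at ha
            by_contra hne
            obtain rfl := le_antisymm ha.1 (hbelow a ha.1 (lt_of_le_of_ne ha.2.1 hne))
            exact H.irrefl _ ha.2.2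
          intro a ha b hb
          rw [this a ha, this b hb]
        omega
      · have hlt' : (univ.filter fun v => x ≤ v ∧ v ≤ c).card < D.card := by
          refine card_lt_card ⟨fun v hv => ?_, fun h => ?_⟩
          · simp only [mem_filter, mem_univ, true_and] at hv
            exact (memD v).2 ⟨hv.1, hv.2.trans hcp.le⟩
          · have := h ((memD p).2 ⟨hxp.le, le_rfl⟩)
            simp only [mem_filter, mem_univ, true_and] at this
            exact hcp.lt.not_ge this.2
        have hI := ih _ hlt' hxc' (fun v h1 h2 => hx v h1 (h2.trans hcp.le)) (fun v h1 h2 he => by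
          refine h2.ne (huniq v c h1 (h2.le.trans hcp.le) ?_ hxc hcp.le (hcov c hcp))
          rw [he]
          exact hcov c hcp) rfl
        refine hlt (hI.trans (le_of_eq ?_))
        rw [show D = insert p (univ.filter fun v => x ≤ v ∧ v ≤ c) by
            ext v
            simp only [mem_filter, mem_univ, true_and, mem_insert, hD]
            constructor
            · rintro ⟨h1, h2⟩
              exact h2.eq_or_lt.imp_right fun h2 => ⟨h1, hbelow v h1 h2⟩
            · rintro (rfl | ⟨h1, h2⟩)
              exacts [⟨hxp.le, le_rfl⟩, ⟨h1, h2.trans hcp.le⟩],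
          sum_insert (by simp [hcp.lt.not_ge])]
        rw [cartan, if_neg hpx.symm, if_neg, zero_add]
        intro hA
        exact hxc'.ne (huniq x c le_rfl hxp.le (H.symm _ _ hA) hxc hcp.le (hcov c hcp))
    -- For an interior colour with lowest occurrence `l` and highest `t`, the pieces `[x, l)`, `[l,
    -- t)` and `[t, p]` contribute at most `-1`, exactly `0` and at most `1`.
    · obtain ⟨t, hvt, htv, htp, ht⟩ := exists_top_color (κ := κ) (fun w => w ≤ p) v hv.2
      obtain ⟨l, hlv, hltv, hxl, hl⟩ := exists_bot_color (κ := κ) (fun w => x ≤ w) v hv.1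
      have hxt : x < t := lt_of_le_of_ne (hv.1.trans hvt) (by rintro rfl; exact hvx htv.symm)
      have htp' : t < p := lt_of_le_of_ne htp (by rintro rfl; exact hvp htv.symm)
      have hxl' : x < l := lt_of_le_of_ne hxl (by rintro rfl; exact hvx hltv.symm)
      have hlt' : (univ.filter fun v => t ≤ v ∧ v ≤ p).card < D.card := by
        refine card_lt_card ⟨fun v hv => ?_, fun h => ?_⟩
        · simp only [mem_filter, mem_univ, true_and] at hv
          exact (memD v).2 ⟨hxt.le.trans hv.1, hv.2⟩
        · have := h ((memD x).2 ⟨le_rfl, hxp.le⟩)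
          simp only [mem_filter, mem_univ, true_and] at this
          exact hxt.not_ge this.1
      have s3 := H.sum_cartan_Icc_le_one htp' ht
      have s2 := H.sum_cartan_Ico (hlv.trans hvt) (hltv.trans htv.symm)
      have s1 : ∑ v with x ≤ v ∧ v < l, cartan A (κ l) (κ v) ≤ -1 := by
        rw [sum_cartan_of_ne, neg_le_neg_iff]
        · obtain ⟨c, hxc, hcl⟩ := exists_le_covBy_of_lt hxl'
          exact_mod_cast card_pos.2 ⟨c, by
            simpa using ⟨⟨hxc, hcl.lt⟩, H.symm _ _ (H.covBy c trivial l hcl)⟩⟩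
        · intro w hw
          simp only [mem_filter, mem_univ, true_and] at hw
          exact hl w hw.2 hw.1
      have e1 : D.filter (fun w => t ≤ w) = univ.filter fun w => t ≤ w ∧ w ≤ p := by
        ext w
        simp only [mem_filter, memD, mem_univ, true_and]
        exact ⟨fun h => ⟨h.2, h.1.2⟩, fun h => ⟨⟨hxt.le.trans h.1, h.2⟩, h.1⟩⟩
      have e2 : (D.filter (fun w => w < t)).filter (fun w => l ≤ w) =
          univ.filter fun w => l ≤ w ∧ w < t := by
        ext w
        simp only [mem_filter, memD, mem_univ, true_and]
        exact ⟨fun h => ⟨h.2, h.1.2⟩,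
          fun h => ⟨⟨⟨hxl'.le.trans h.1, h.2.le.trans htp⟩, h.2⟩, h.1⟩⟩
      have e3 : (D.filter (fun w => w < t)).filter (fun w => w < l) =
          univ.filter fun w => x ≤ w ∧ w < l := by
        ext w
        simp only [mem_filter, memD, mem_univ, true_and]
        have hlt := hlv.trans hvt
        exact ⟨fun h => ⟨h.1.1.1, h.2⟩,
          fun h => ⟨⟨⟨h.1, h.2.le.trans (hlt.trans htp)⟩, h.2.trans_le hlt⟩, h.2⟩⟩
      rw [← htv, H.sum_cartan_split D t, e1, htv, ← hltv,
        H.sum_cartan_split (D.filter fun w => w < t) l, e2, e3, s2]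
      rw [htv, ← hltv] at s3
      linarith

end HeapColoring

end DComplete

/-! ### Roots attached to elements, and the hook recursion. -/

namespace DComplete

open Finset

open scoped Classical

/-- The reflection in the simple root `i`, acting on evaluations of the simple roots. -/
noncomputable def reflect {C : Type*} (A : C → C → Prop) (i : C) (a : C → ℚ) (j : C) : ℚ :=
  a j - cartan A i j * a i

variable {P : Type*} [PartialOrder P] [Fintype P]

/-- The value at `a` of the root attached to the element `p` of the upper set `F`, obtained from the
simple root of the colour of `p` by the reflections attached to the elements of `F` below `p`. -/
noncomputable def root (κ : P → P) (A : P → P → Prop) (F : Finset P) (p : P) (a : P → ℚ) : ℚ :=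
  if h : ∃ m ∈ F, m < p ∧ ∀ v ∈ F, ¬ v < m then
    root κ A (F.erase h.choose) p (reflect A (κ h.choose) a)
  else a (κ p)
termination_by F.card
decreasing_by exact card_erase_lt_of_mem h.choose_spec.1

theorem exists_minimal_lt {F : Finset P} {p v : P} (hv : v ∈ F) (hvp : v < p) :
    ∃ m ∈ F, m < p ∧ ∀ v ∈ F, ¬ v < m := by
  obtain ⟨m, ⟨h1, h2⟩, h3⟩ := (wellFounded_lt (α := P)).has_min {v | v ∈ F ∧ v < p} ⟨v, hv, hvp⟩
  exact ⟨m, h1, h2, fun v hv hvm => h3 v ⟨hv, hvm.trans h2⟩ hvm⟩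

theorem isUpperSet_erase {F : Finset P} (hF : IsUpperSet (F : Set P)) {m : P}
    (hm : ∀ v ∈ F, ¬ v < m) : IsUpperSet ((F.erase m : Finset P) : Set P) := by
  intro a b hab ha
  simp only [coe_erase, Set.mem_sdiff, mem_coe, Set.mem_singleton_iff] at ha ⊢
  refine ⟨hF hab ha.1, ?_⟩
  rintro rfl
  exact hm a ha.1 (lt_of_le_of_ne hab ha.2)

namespace HeapColoring

variable {κ : P → P} {A : P → P → Prop}

theorem reflect_comm (H : HeapColoring Set.univ κ A) {m m' : P} (h : ¬ m ≤ m') (h' : ¬ m' ≤ m)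
    (a : P → ℚ) : reflect A (κ m) (reflect A (κ m') a) = reflect A (κ m') (reflect A (κ m) a) := by
  have h0 : cartan A (κ m) (κ m') = 0 := by
    by_contra hne
    exact (H.comparable_of_cartan_ne_zero hne).elim h h'
  have h0' : cartan A (κ m') (κ m) = 0 := by rw [H.cartan_comm, h0]
  ext j
  simp only [reflect, h0, h0']
  ring

theorem root_of_minimal {F : Finset P} {p : P} (hp : ∀ v ∈ F, ¬ v < p) (a : P → ℚ) :
    root κ A F p a = a (κ p) := by
  rw [root, dif_neg]
  rintro ⟨m, hm, hmp, -⟩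
  exact hp m hm hmp

/-- The definition of `root` chooses minimal elements below `p` arbitrarily. Since incomparable
elements have commuting reflections, any minimal element other than `p` may be removed first, even
one not below `p`. -/
theorem root_erase (H : HeapColoring Set.univ κ A) {F : Finset P} {p m : P} (hp : p ∈ F)
    (hm : m ∈ F) (hmin : ∀ v ∈ F, ¬ v < m) (hmp : m ≠ p) (a : P → ℚ) :
    root κ A F p a = root κ A (F.erase m) p (reflect A (κ m) a) := by
  induction hn : F.card using Nat.strong_induction_on generalizing F m a with
  | _ n ih =>
    subst hn
    by_cases h : ∃ m ∈ F, m < p ∧ ∀ v ∈ F, ¬ v < m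
    · rw [root, dif_pos h]
      obtain ⟨h1, h2, h3⟩ := h.choose_spec
      set m₀ := h.choose
      by_cases h0 : m₀ = m
      · rw [h0]
      have hcard := card_erase_lt_of_mem h1
      have hcard' := card_erase_lt_of_mem hm
      rw [ih _ hcard (mem_erase.2 ⟨h2.ne', hp⟩) (mem_erase.2 ⟨Ne.symm h0, hm⟩)
        (fun v hv => hmin v (mem_of_mem_erase hv)) hmp _ rfl,
        ih _ hcard' (mem_erase.2 ⟨hmp.symm, hp⟩) (mem_erase.2 ⟨h0, h1⟩)
        (fun v hv => h3 v (mem_of_mem_erase hv)) h2.ne _ rfl, erase_right_comm, H.reflect_comm]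
      · exact fun hle => h3 m hm (lt_of_le_of_ne hle (Ne.symm h0))
      · exact fun hle => hmin m₀ h1 (lt_of_le_of_ne hle h0)
    · have hpmin : ∀ v ∈ F, ¬ v < p := fun v hv hvp => h (exists_minimal_lt hv hvp)
      rw [root_of_minimal hpmin, root_of_minimal fun v hv => hpmin v (mem_of_mem_erase hv), reflect]
      have h0 : cartan A (κ m) (κ p) = 0 := by
        by_contra hne
        rcases H.comparable_of_cartan_ne_zero hne with hle | hle
        · exact hpmin m hm (lt_of_le_of_ne hle hmp)
        · exact hmin p hp (lt_of_le_of_ne hle hmp.symm)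
      rw [h0]
      ring

/-- Split at the highest element `t ≤ p` of the colour of `m`: `[m, t)` cancels, and `[t, p]`
contributes `1` by `sum_cartan_Icc_eq_one`. -/
theorem sum_cartan_below (H : HeapColoring Set.univ κ A) {F : Finset P}
    (hF : IsUpperSet (F : Set P)) {p m : P} (hm : m ∈ F) (hmin : ∀ v ∈ F, ¬ v < m) (hmp : m < p)
    (hκ : ∀ q ∈ F, q < p → κ q ≠ κ p) :
    ∑ q ∈ F with q ≤ p, cartan A (κ m) (κ q) = 1 := by
  obtain ⟨t, hmt, htm, htp, ht⟩ := exists_top_color (κ := κ) (fun w => w ≤ p) m hmp.le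
  have htp' : t < p := lt_of_le_of_ne htp (by rintro rfl; exact hκ m hm hmp htm.symm)
  rw [H.sum_cartan_split _ m, sum_eq_zero, zero_add, ← htm, H.sum_cartan_split _ t]
  · have e1 : ((F.filter (· ≤ p)).filter (fun v => m ≤ v)).filter (fun v => v < t) =
        univ.filter fun v => m ≤ v ∧ v < t := by
      ext v
      simp only [mem_filter, mem_univ, true_and]
      exact ⟨fun h => ⟨h.1.2, h.2⟩, fun h => ⟨⟨⟨hF h.1 hm, h.2.le.trans htp⟩, h.1⟩, h.2⟩⟩
    have e2 : ((F.filter (· ≤ p)).filter (fun v => m ≤ v)).filter (fun v => t ≤ v) =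
        univ.filter fun v => t ≤ v ∧ v ≤ p := by
      ext v
      simp only [mem_filter, mem_univ, true_and]
      exact ⟨fun h => ⟨h.2, h.1.1.2⟩,
        fun h => ⟨⟨⟨hF (hmt.trans h.1) hm, h.2⟩, hmt.trans h.1⟩, h.1⟩⟩
    rw [e1, e2, H.sum_cartan_Icc_eq_one htp' ht (fun v h1 h2 => hκ v (hF (hmt.trans h1) hm) h2), htm,
      H.sum_cartan_Ico hmt htm.symm, zero_add]
  · intro v hv
    simp only [mem_filter] at hv
    exact (hmin v hv.1.1 hv.2).elim

theorem sum_filter_le_erase {F : Finset P} {p m : P} (hm : m ∈ F) (hmp : m ≤ p) (f : P → ℚ) :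
    ∑ q ∈ F with q ≤ p, f q = f m + ∑ q ∈ F.erase m with q ≤ p, f q := by
  rw [filter_erase, add_sum_erase]
  exact mem_filter.2 ⟨hm, hmp⟩

/-- Removing a minimal `m < p` from the sum leaves pairing `1 - 2 = -1` with the colour of `m`, so
the reflection adds exactly one copy of that colour back. -/
theorem root_eq_sum (H : HeapColoring Set.univ κ A) {F : Finset P} (hF : IsUpperSet (F : Set P))
    {p : P} (hp : p ∈ F) (hκ : ∀ q ∈ F, q < p → κ q ≠ κ p) (a : P → ℚ) :
    root κ A F p a = ∑ q ∈ F with q ≤ p, a (κ q) := by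
  induction hn : F.card using Nat.strong_induction_on generalizing F a with
  | _ n ih =>
    subst hn
    by_cases h : ∃ m ∈ F, m < p ∧ ∀ v ∈ F, ¬ v < m
    · obtain ⟨m, hm, hmp, hmin⟩ := h
      have hs := H.sum_cartan_below hF hm hmin hmp hκ
      rw [sum_filter_le_erase hm hmp.le, cartan_self] at hs
      rw [H.root_erase hp hm hmin hmp.ne, ih _ (card_erase_lt_of_mem hm) (isUpperSet_erase hF hmin)
        (mem_erase.2 ⟨hmp.ne', hp⟩) (fun q hq => hκ q (mem_of_mem_erase hq)) _ rfl,
        sum_filter_le_erase hm hmp.le]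
      simp only [reflect]
      rw [sum_sub_distrib, ← sum_mul, show ∑ q ∈ F.erase m with q ≤ p, cartan A (κ m) (κ q) = -1 by
        linarith]
      ring
    · have hpmin : ∀ v ∈ F, ¬ v < p := fun v hv hvp => h (exists_minimal_lt hv hvp)
      rw [root_of_minimal hpmin, show F.filter (· ≤ p) = {p} by
        ext v
        simp only [mem_filter, mem_singleton]
        constructor
        · rintro ⟨h1, h2⟩
          exact eq_of_le_of_not_lt h2 (hpmin v h1)
        · rintro rfl
          exact ⟨hp, le_rfl⟩, sum_singleton]

/-- Each neck element repeats the colour of a tail element, so `[p, q]` contains every tail colour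
twice, as do `[p, w]` and `[p, z]` together. -/
theorem sum_Icc_eq_sides (H : HeapColoring Set.univ κ A) {k : ℕ} {p q w z : P} (h : DInt k p q w z)
    (a : P → ℚ) : ∑ v with p ≤ v ∧ v ≤ q, a (κ v) =
      ∑ v with p ≤ v ∧ v ≤ w, a (κ v) + ∑ v with p ≤ v ∧ v ≤ z, a (κ v) := by
  induction h with
  | @base p q w z hpw hpz hwq hzq hwz hI =>
    have hc := H.consec_of_dInt p trivial _ _ _ _ (.base hpw hpz hwq hzq hwz hI)
    have hmem : ∀ v, (p ≤ v ∧ v ≤ q) ↔ v = p ∨ v = w ∨ v = z ∨ v = q := fun v => by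
      rw [← Set.mem_Icc, hI]; simp
    have e : ∀ {w}, p ⋖ w → (univ.filter fun v => p ≤ v ∧ v ≤ w) = {p, w} := by
      intro w hw
      ext v
      simp only [mem_filter, mem_univ, true_and, mem_insert, mem_singleton]
      constructor
      · exact fun hv => hw.eq_or_eq hv.1 hv.2
      · rintro (rfl | rfl)
        exacts [⟨le_rfl, hw.le⟩, ⟨hw.le, le_rfl⟩]
    rw [e hpw, e hpz, show (univ.filter fun v => p ≤ v ∧ v ≤ q) = {p, w, z, q} by
      ext v; simp [hmem], sum_pair hpw.ne, sum_pair hpz.ne, sum_insert, sum_insert,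
      sum_pair hzq.ne, hc.2.1]
    · ring
    · simp [hwz, hwq.ne]
    · simp [hpw.ne, hpz.ne, (hpw.lt.trans hwq.lt).ne]
  | @step k p q w z p' q' h hp hq hI ih =>
    have hc := H.consec_of_dInt p' trivial _ _ _ _ (.step h hp hq hI)
    have hs := h.lt_sides
    have hmem : ∀ v, (p' ≤ v ∧ v ≤ q') ↔ v = p' ∨ v = q' ∨ (p ≤ v ∧ v ≤ q) := fun v => by
      rw [← Set.mem_Icc, hI]; simp
    have e : ∀ {w}, p < w → w < q → ∑ v with p' ≤ v ∧ v ≤ w, a (κ v) =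
        a (κ p') + ∑ v with p ≤ v ∧ v ≤ w, a (κ v) := by
      intro w hpw hwq
      rw [show (univ.filter fun v => p' ≤ v ∧ v ≤ w) =
        insert p' (univ.filter fun v => p ≤ v ∧ v ≤ w) by
          ext v
          simp only [mem_filter, mem_univ, true_and, mem_insert]
          constructor
          · rintro ⟨h1, h2⟩
            rcases (hmem v).1 ⟨h1, h2.trans (hwq.trans hq.lt).le⟩ with h3 | rfl | h3
            · exact Or.inl h3
            · exact ((hwq.trans hq.lt).not_ge h2).elim
            · exact Or.inr ⟨h3.1, h2⟩
          · rintro (rfl | ⟨h1, h2⟩)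
            exacts [⟨le_rfl, (hp.lt.trans hpw).le⟩, ⟨hp.le.trans h1, h2⟩],
        sum_insert]
      simp [hp.lt.not_ge]
    rw [e hs.1 hs.2.2.1, e hs.2.1 hs.2.2.2.1, show (univ.filter fun v => p' ≤ v ∧ v ≤ q') =
      insert p' (insert q' (univ.filter fun v => p ≤ v ∧ v ≤ q)) by ext v; simp [hmem],
      sum_insert, sum_insert, ih, ← hc.2.1]
    · ring
    · simp [hq.lt.not_ge]
    · simp [hp.lt.not_ge, hc.1.ne]

theorem color_ne_side (H : HeapColoring Set.univ κ A) {k : ℕ} {p q w z : P} (h : DInt k p q w z) :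
    ∀ v, p ≤ v → v < w → κ v ≠ κ w := by
  induction h with
  | @base p q w z hpw hpz hwq hzq hwz hI =>
    intro v h1 h2
    rcases hpw.eq_or_eq h1 h2.le with rfl | rfl
    · intro he
      exact H.irrefl (κ w) (by simpa [he] using H.covBy v trivial w hpw)
    · exact (h2.ne rfl).elim
  | @step k p q w z p' q' h hp hq hI ih =>
    have hc := H.consec_of_dInt p' trivial _ _ _ _ (.step h hp hq hI)
    have hs := h.lt_sides
    intro v h1 h2
    have hv : v ∈ Set.Icc p' q' := ⟨h1, (h2.trans (hs.2.2.1.trans hq.lt)).le⟩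
    rw [hI] at hv
    rcases hv with rfl | rfl | hv
    · exact (hc.2.2 w h2 (hs.2.2.1.trans hq.lt)).symm
    · exact (h2.not_gt (hs.2.2.1.trans hq.lt)).elim
    · exact ih v hv.1 h2

/-- The recursion for hook vectors at neck elements holds for roots. -/
theorem root_neck (H : HeapColoring Set.univ κ A) {k : ℕ} {m p w z : P} (h : DInt k m p w z)
    {F : Finset P} (hF : IsUpperSet (F : Set P)) (hm : m ∈ F) (a : P → ℚ) :
    root κ A F p a = root κ A F w a + root κ A F z a - root κ A F m a := by
  have hs := h.lt_sides
  have hc := H.consec_of_dInt m trivial _ _ _ _ h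
  induction hn : F.card using Nat.strong_induction_on generalizing F a with
  | _ n ih =>
    subst hn
    have mem : ∀ {v}, m ≤ v → v ∈ F := fun hv => hF hv hm
    by_cases hx : ∃ x ∈ F, x ≠ m ∧ ∀ v ∈ F, ¬ v < x
    · obtain ⟨x, hx, hxm, hmin⟩ := hx
      have hne : ∀ {v}, m < v → x ≠ v := by
        rintro v hv rfl
        exact hmin m hm hv
      rw [H.root_erase (mem hc.1.le) hx hmin (hne hc.1), H.root_erase (mem hs.1.le) hx hmin (hne hs.1),
        H.root_erase (mem hs.2.1.le) hx hmin (hne hs.2.1), H.root_erase hm hx hmin hxm]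
      exact ih _ (card_erase_lt_of_mem hx) (isUpperSet_erase hF hmin)
        (mem_erase.2 ⟨hxm.symm, hm⟩) _ rfl
    -- All other minimal elements are gone, so `m` is the minimum of `F`. The roots at `w` and `z`
    -- are now interval sums from `m`, and the root at `p` is the sum over `(m, p]`, which the
    -- reflection of `m` fixes because it pairs to zero with the colour of `m`.
    · have hle : ∀ v ∈ F, m ≤ v := by
        intro v hv
        obtain ⟨y, ⟨h1, h2⟩, h3⟩ := (wellFounded_lt (α := P)).has_min {y | y ∈ F ∧ y ≤ v}
          ⟨v, hv, le_rfl⟩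
        have hy : y = m := by
          by_contra hne
          exact hx ⟨y, h1, hne, fun u hu huy => h3 u ⟨hu, huy.le.trans h2⟩ huy⟩
        exact hy ▸ h2
      have hmin : ∀ v ∈ F, ¬ v < m := fun v hv => (hle v hv).not_gt
      have e : ∀ x, F.filter (· ≤ x) = univ.filter fun v => m ≤ v ∧ v ≤ x := by
        intro x
        ext v
        simp only [mem_filter, mem_univ, true_and]
        exact ⟨fun h => ⟨hle v h.1, h.2⟩, fun h => ⟨mem h.1, h.2⟩⟩
      have e' : (F.erase m).filter (· ≤ p) = univ.filter fun v => m < v ∧ v ≤ p := by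
        ext v
        simp only [mem_filter, mem_univ, true_and, mem_erase]
        exact ⟨fun h => ⟨lt_of_le_of_ne (hle v h.1.2) h.1.1.symm, h.2⟩,
          fun h => ⟨⟨h.1.ne', mem h.1.le⟩, h.2⟩⟩
      have hsum := sum_filter_le_erase hm hc.1.le fun q => a (κ q)
      rw [e p, e', H.sum_Icc_eq_sides h] at hsum
      rw [root_of_minimal hmin, H.root_eq_sum hF (mem hs.1.le) fun q hq => H.color_ne_side h q (hle q hq),
        H.root_eq_sum hF (mem hs.2.1.le) fun q hq => H.color_ne_side h.symm q (hle q hq), e w, e z, hsum,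
        H.root_erase (mem hc.1.le) hm hmin hc.1.ne,
        H.root_eq_sum (isUpperSet_erase hF hmin) (mem_erase.2 ⟨hc.1.ne', mem hc.1.le⟩), e']
      · simp only [reflect]
        rw [sum_sub_distrib, ← sum_mul, H.sum_cartan_Ioc hc.1.le hc.2.1]
        ring
      · intro q hq hqp
        rw [← hc.2.1]
        rw [mem_erase] at hq
        exact hc.2.2 q (lt_of_le_of_ne (hle q hq.2) hq.1.symm) hqp

end HeapColoring

end DComplete

/-! ### Addable and removable elements, and localizations. -/

namespace DComplete

open Finset

open scoped Classical

variable {P : Type*} [PartialOrder P] [Fintype P]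

/-- The elements that can be added to the upper set `Q`. -/
noncomputable def addable (Q : Finset P) : Finset P :=
  univ.filter fun x => x ∉ Q ∧ IsUpperSet ((insert x Q : Finset P) : Set P)

/-- The elements that can be removed from the upper set `Q`. -/
noncomputable def removable (Q : Finset P) : Finset P :=
  Q.filter fun x => IsUpperSet (Q : Set P) ∧ IsUpperSet ((Q.erase x : Finset P) : Set P)

theorem mem_addable {Q : Finset P} {x : P} :
    x ∈ addable Q ↔ x ∉ Q ∧ IsUpperSet ((insert x Q : Finset P) : Set P) := by simp [addable]

theorem mem_removable {Q : Finset P} {x : P} :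
    x ∈ removable Q ↔ x ∈ Q ∧ IsUpperSet (Q : Set P) ∧ IsUpperSet ((Q.erase x : Finset P) : Set P) := by
  simp [removable]

theorem mem_addable_iff {Q : Finset P} (hQ : IsUpperSet (Q : Set P)) {x : P} :
    x ∈ addable Q ↔ x ∉ Q ∧ ∀ v, x < v → v ∈ Q := by
  rw [mem_addable]
  refine and_congr_right fun hx => ⟨fun h v hv => ?_, fun h a b hab ha => ?_⟩
  · have : v ∈ ((insert x Q : Finset P) : Set P) := h hv.le (by simp)
    simp only [coe_insert, Set.mem_insert_iff, mem_coe] at this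
    exact this.resolve_left hv.ne'
  · simp only [coe_insert, Set.mem_insert_iff, mem_coe] at ha ⊢
    rcases ha with rfl | ha
    · exact hab.eq_or_lt.imp Eq.symm (h b)
    · exact Or.inr (hQ hab ha)

theorem mem_removable_iff {Q : Finset P} (hQ : IsUpperSet (Q : Set P)) {x : P} :
    x ∈ removable Q ↔ x ∈ Q ∧ ∀ v ∈ Q, ¬ v < x := by
  rw [mem_removable]
  refine and_congr_right fun hx => ⟨fun h v hv hvx => ?_, fun h => ⟨hQ, isUpperSet_erase hQ h⟩⟩
  have : x ∈ ((Q.erase x : Finset P) : Set P) := h.2 hvx.le (mem_coe.2 (mem_erase.2 ⟨hvx.ne, hv⟩))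
  simp at this

theorem addable_erase {Q : Finset P} {y : P} (hy : y ∈ removable Q) : y ∈ addable (Q.erase y) := by
  rw [mem_removable] at hy
  rw [mem_addable, insert_erase hy.1]
  exact ⟨notMem_erase _ _, hy.2.1⟩

/-- Adding and then removing different elements is the same as first removing and then adding. -/
theorem add_remove_comm {Q : Finset P} (hQ : IsUpperSet (Q : Set P)) {x y : P} (hxy : x ≠ y) :
    x ∈ addable Q ∧ y ∈ removable (insert x Q) ↔ y ∈ removable Q ∧ x ∈ addable (Q.erase y) := by
  have e : (insert x Q).erase y = insert x (Q.erase y) := erase_insert_of_ne hxy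
  constructor
  · rintro ⟨h1, h2⟩
    have h2' := h2
    rw [mem_removable, mem_insert] at h2
    rw [mem_removable_iff (mem_addable.1 h1).2] at h2'
    refine ⟨(mem_removable_iff hQ).2 ⟨h2.1.resolve_left hxy.symm, fun v hv =>
      h2'.2 v (mem_insert_of_mem hv)⟩, mem_addable.2 ⟨?_, e ▸ h2.2.2⟩⟩
    exact fun h => (mem_addable.1 h1).1 (mem_of_mem_erase h)
  · rintro ⟨h1, h2⟩
    have h3 := (mem_removable.1 h1).2.2
    have h4 := (mem_addable_iff h3).1 h2
    have h5 : x ∈ addable Q := (mem_addable_iff hQ).2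
      ⟨fun h => h4.1 (mem_erase.2 ⟨hxy, h⟩), fun v hv => mem_of_mem_erase (h4.2 v hv)⟩
    refine ⟨h5, mem_removable.2 ⟨mem_insert_of_mem (mem_removable.1 h1).1, (mem_addable.1 h5).2, ?_⟩⟩
    rw [e]
    exact (mem_addable.1 h2).2

namespace HeapColoring

variable {κ : P → P} {A : P → P → Prop}

/-- The weight of an upper set `Q` contained in `F` pairs with the colour of an element addable to `F`
as the number of addable minus the number of removable elements of that colour. -/
theorem card_addable_sub_card_removable (H : HeapColoring Set.univ κ A) {F Q : Finset P} {m : P}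
    (hF : IsUpperSet (F : Set P)) (hm : m ∈ addable F) (hQ : IsUpperSet (Q : Set P)) (hQF : Q ⊆ F) :
    (((addable Q).filter fun x => κ x = κ m).card : ℚ) -
        ((removable Q).filter fun x => κ x = κ m).card =
      1 + ∑ v ∈ F, cartan A (κ m) (κ v) - ∑ v ∈ Q, cartan A (κ m) (κ v) := by
  rw [mem_addable_iff hF] at hm
  -- `y` is the highest element of the colour outside `Q`, hence the only candidate to be added. The
  -- part `(m, y]` cancels, so the pairing is `1 - |N|`, with `N` the adjacent elements above `y`
  -- that are missing from `Q`.
  obtain ⟨y, hmy, hym, hyQ, hy⟩ := exists_top_color (κ := κ) (fun w => w ∉ Q) m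
    fun h => hm.1 (hQF h)
  have hup : ∀ v, y ≤ v → κ v = κ m → v ∉ Q → v = y := fun v hv hvm hvQ => by
    by_contra hne
    exact hy v (lt_of_le_of_ne hv (Ne.symm hne)) hvQ (hvm.trans hym.symm)
  set N := (univ.filter fun v => y < v ∧ v ∉ Q).filter fun v => A (κ y) (κ v) with hN
  have memN : ∀ v, v ∈ N ↔ (y < v ∧ v ∉ Q) ∧ A (κ y) (κ v) := by simp [hN]
  have hsum : ∑ v ∈ F, cartan A (κ m) (κ v) - ∑ v ∈ Q, cartan A (κ m) (κ v) = -(N.card : ℚ) := by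
    rw [← sum_sdiff hQF, add_sub_cancel_right, H.sum_cartan_split' _ m, sum_eq_zero, zero_add,
      ← hym, H.sum_cartan_split' _ y]
    · have e1 : (((F \ Q).filter (m < ·)).filter (· ≤ y)) = univ.filter fun v => m < v ∧ v ≤ y := by
        ext v
        simp only [mem_filter, mem_sdiff, mem_univ, true_and]
        exact ⟨fun h => ⟨h.1.2, h.2⟩,
          fun h => ⟨⟨⟨hm.2 v h.1, fun hv => hyQ (hQ h.2 hv)⟩, h.1⟩, h.2⟩⟩
      have e2 : (((F \ Q).filter (m < ·)).filter (y < ·)) = univ.filter fun v => y < v ∧ v ∉ Q := by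
        ext v
        simp only [mem_filter, mem_sdiff, mem_univ, true_and]
        exact ⟨fun h => ⟨h.2, h.1.1.2⟩, fun h => ⟨⟨⟨hm.2 v (hmy.trans_lt h.1), h.2⟩,
          hmy.trans_lt h.1⟩, h.1⟩⟩
      rw [e1, e2, hym, H.sum_cartan_Ioc hmy hym.symm, zero_add, ← hym, sum_cartan_of_ne]
      intro v hv
      simp only [mem_filter, mem_univ, true_and] at hv
      exact hy v hv.1 hv.2
    · intro v hv
      simp only [mem_filter, mem_sdiff] at hv
      rcases hv.2.eq_or_lt with rfl | h
      · exact (hm.1 hv.1.1).elim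
      · exact (hm.1 (hF h.le hv.1.1)).elim
  have hadd : (((addable Q).filter fun x => κ x = κ m).card : ℚ) = if N.card = 0 then 1 else 0 := by
    have hsub : ∀ x ∈ (addable Q).filter (fun x => κ x = κ m), x = y := by
      intro x hx
      simp only [mem_filter, mem_addable_iff hQ] at hx
      rcases H.comp x trivial y trivial (Or.inl (hx.2.trans hym.symm)) with h | h
      · rcases h.eq_or_lt with h | h
        · exact h
        · exact (hyQ (hx.1.2 y h)).elim
      · exact hup x h hx.2 hx.1.1
    split_ifs with h0
    · rw [card_eq_zero] at h0
      rw [show (addable Q).filter (fun x => κ x = κ m) = {y} from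
        eq_singleton_iff_unique_mem.2 ⟨?_, hsub⟩, card_singleton, Nat.cast_one]
      simp only [mem_filter, mem_addable_iff hQ]
      refine ⟨⟨hyQ, fun v hv => ?_⟩, hym⟩
      obtain ⟨c, hc, hcv⟩ := exists_covBy_le_of_lt hv
      refine hQ hcv ?_
      by_contra hcQ
      have : c ∈ N := (memN c).2 ⟨⟨hc.lt, hcQ⟩, H.covBy y trivial c hc⟩
      simp [h0] at this
    · rw [Nat.cast_eq_zero, card_eq_zero, eq_empty_iff_forall_notMem]
      intro x hx
      obtain rfl := hsub x hx
      simp only [mem_filter, mem_addable_iff hQ] at hx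
      obtain ⟨v, hv⟩ := card_pos.1 (Nat.pos_of_ne_zero h0)
      rw [memN] at hv
      exact hv.1.2 (hx.1.2 v hv.1.1)
  rw [add_sub_assoc, hsum, hadd]
  -- If the colour occurs above `y`, the next occurrence `r` is the only candidate for removal and
  -- `N` lies among the two neighbours between `y` and `r`. The sizes `0, 1, 2` of `N` mean: `y`
  -- addable, neither, `r` removable. Without such an `r`, `N` has at most one element.
  by_cases hr : ∃ r, y < r ∧ κ r = κ y
  · obtain ⟨r', hr', hκ'⟩ := hr
    obtain ⟨r, -, hc⟩ := exists_consec_above hr' hκ'.symm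
    have hrm : κ r = κ m := hc.2.1.symm.trans hym
    have hrQ : r ∈ Q := by
      by_contra h
      exact hc.1.ne' (hup r hc.1.le hrm h)
    set T := univ.filter fun v => y < v ∧ v < r ∧ A (κ y) (κ v) with hT
    have memT : ∀ v, v ∈ T ↔ y < v ∧ v < r ∧ A (κ y) (κ v) := by simp [hT]
    have hTcard : T.card = 2 := by
      rw [← H.two y trivial r hc, Set.ncard_eq_toFinset_card']
      congr 1
      ext v
      simp [hT]
    have hNT : N ⊆ T := by
      intro v hv
      rw [memN] at hv
      refine (memT v).2 ⟨hv.1.1, ?_, hv.2⟩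
      rcases H.comp r trivial v trivial (Or.inr (hc.2.1 ▸ hv.2)) with h | h
      · exact (hv.1.2 (hQ h hrQ)).elim
      · exact lt_of_le_of_ne h fun e => hv.1.2 (e ▸ hrQ)
    have hle := card_le_card hNT
    have hrem : (((removable Q).filter fun x => κ x = κ m).card : ℚ) =
        if N.card = 2 then 1 else 0 := by
      have hsub : ∀ x ∈ (removable Q).filter (fun x => κ x = κ m), x = r := by
        intro x hx
        simp only [mem_filter, mem_removable_iff hQ] at hx
        have hyx : y < x := by
          rcases H.comp x trivial y trivial (Or.inl (hx.2.trans hym.symm)) with h | h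
          · exact (hyQ (hQ h hx.1.1)).elim
          · exact lt_of_le_of_ne h fun e => hyQ (e ▸ hx.1.1)
        rcases H.comp x trivial r trivial (Or.inl (hx.2.trans hrm.symm)) with h | h
        · by_contra hne
          exact hc.2.2 x hyx (lt_of_le_of_ne h hne) (hx.2.trans hym.symm)
        · by_contra hne
          exact hx.1.2 r hrQ (lt_of_le_of_ne h (Ne.symm hne))
      split_ifs with h2
      · have hNT' : N = T := eq_of_subset_of_card_le hNT (by omega)
        rw [show (removable Q).filter (fun x => κ x = κ m) = {r} from
          eq_singleton_iff_unique_mem.2 ⟨?_, hsub⟩, card_singleton, Nat.cast_one]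
        simp only [mem_filter, mem_removable_iff hQ]
        refine ⟨⟨hrQ, fun v hv hvr => ?_⟩, hrm⟩
        obtain ⟨c, hvc, hcr⟩ := exists_le_covBy_of_lt hvr
        have hcQ := hQ hvc hv
        have hA : A (κ y) (κ c) := hc.2.1 ▸ H.symm _ _ (H.covBy c trivial r hcr)
        rcases H.comp y trivial c trivial (Or.inr hA) with h | h
        · have : c ∈ N := hNT' ▸ (memT c).2 ⟨lt_of_le_of_ne h fun e => hyQ (e ▸ hcQ), hcr.lt, hA⟩
          exact ((memN c).1 this).1.2 hcQ
        · exact hyQ (hQ h hcQ)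
      · rw [Nat.cast_eq_zero, card_eq_zero, eq_empty_iff_forall_notMem]
        intro x hx
        obtain rfl := hsub x hx
        simp only [mem_filter, mem_removable_iff hQ] at hx
        refine h2 (hTcard ▸ congrArg card (hNT.antisymm fun v hv => ?_))
        rw [memT] at hv
        exact (memN v).2 ⟨⟨hv.1, fun h => hx.1.2 v h hv.2.1⟩, hv.2.2⟩
    rw [hrem]
    have : N.card = 0 ∨ N.card = 1 ∨ N.card = 2 := by omega
    rcases this with h | h | h <;> rw [h] <;> norm_num
  · push Not at hr
    have hrem : (removable Q).filter (fun x => κ x = κ m) = ∅ := by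
      rw [eq_empty_iff_forall_notMem]
      intro x hx
      simp only [mem_filter, mem_removable_iff hQ] at hx
      rcases H.comp x trivial y trivial (Or.inl (hx.2.trans hym.symm)) with h | h
      · exact hyQ (hQ h hx.1.1)
      · exact hr x (lt_of_le_of_ne h fun e => hyQ (e ▸ hx.1.1)) (hx.2.trans hym.symm)
    have hle : N.card ≤ 1 := by
      have h := H.top y trivial hr
      rw [Set.ncard_eq_toFinset_card'] at h
      refine (card_le_card fun v hv => ?_).trans h
      rw [memN] at hv
      simpa using ⟨hv.1.1, hv.2⟩
    rw [hrem]
    have : N.card = 0 ∨ N.card = 1 := by omega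
    rcases this with h | h <;> rw [h] <;> norm_num

/-- The function `ψ` on upper sets and evaluations of the simple roots satisfies the Chevalley
formula of the upper set `F`. -/
structure IsLocalization (κ : P → P) (A : P → P → Prop) (F : Finset P)
    (ψ : (P → ℚ) → Finset P → ℚ) : Prop where
  support : ∀ a Q, ψ a Q ≠ 0 → IsUpperSet (Q : Set P) ∧ Q ⊆ F
  empty : ∀ a, ψ a ∅ = 1
  chevalley : ∀ a (Q : Finset P), IsUpperSet (Q : Set P) →
    (∑ p ∈ F, a (κ p) - ∑ p ∈ Q, a (κ p)) * ψ a Q = ∑ x ∈ addable Q, ψ a (insert x Q)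
  self : ∀ a, ψ a F = ∏ p ∈ F, root κ A F p a

/-- The recursion for localizations when the element `m` is added to the upper set. -/
noncomputable def localizationStep (κ : P → P) (A : P → P → Prop) (m : P)
    (ψ : (P → ℚ) → Finset P → ℚ) (a : P → ℚ) (Q : Finset P) : ℚ :=
  ψ (reflect A (κ m) a) Q +
    a (κ m) * ∑ y ∈ (removable Q).filter fun y => κ y = κ m, ψ (reflect A (κ m) a) (Q.erase y)

/-- Adding `x` and removing `y` commute when `x ≠ y`; the two counts differ only by the terms `x =
y`, which return `Q` itself. -/
theorem sum_addable_removable (Q : Finset P) (hQ : IsUpperSet (Q : Set P)) (i : P)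
    (f : Finset P → ℚ) :
    ∑ x ∈ addable Q, ∑ y ∈ (removable (insert x Q)).filter (fun y => κ y = i),
        f ((insert x Q).erase y) + ((removable Q).filter fun y => κ y = i).card * f Q =
      ∑ y ∈ (removable Q).filter (fun y => κ y = i), ∑ x ∈ addable (Q.erase y),
        f (insert x (Q.erase y)) + ((addable Q).filter fun y => κ y = i).card * f Q := by
  have e1 : ∀ x ∈ addable Q, ∑ y ∈ (removable (insert x Q)).filter (fun y => κ y = i),
      f ((insert x Q).erase y) =
      ∑ y ∈ univ.filter (fun y => κ y = i ∧ x ≠ y ∧ y ∈ removable (insert x Q)),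
        f (insert x (Q.erase y)) + if κ x = i then f Q else 0 := by
    intro x hx
    have hx' := mem_addable.1 hx
    rw [← sum_filter_add_sum_filter_not _ (fun y => x ≠ y)]
    congr 1
    · refine sum_congr ?_ fun y hy => ?_
      · ext y
        simp only [mem_filter, mem_univ, true_and]
        tauto
      · simp only [mem_filter, mem_univ, true_and] at hy
        rw [erase_insert_of_ne hy.2.1]
    · split_ifs with h
      · rw [show (((removable (insert x Q)).filter fun y => κ y = i).filter fun y => ¬ x ≠ y) = {x} by
          ext y
          simp only [mem_filter, mem_singleton, not_not]
          constructor
          · exact fun h => h.2.symm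
          · rintro rfl
            refine ⟨⟨mem_removable.2 ⟨mem_insert_self _ _, hx'.2, ?_⟩, h⟩, rfl⟩
            rwa [erase_insert hx'.1], sum_singleton, erase_insert hx'.1]
      · refine sum_eq_zero fun y hy => ?_
        simp only [mem_filter, not_not] at hy
        exact (h (hy.2 ▸ hy.1.2)).elim
  have e2 : ∀ y ∈ (removable Q).filter (fun y => κ y = i), ∑ x ∈ addable (Q.erase y),
      f (insert x (Q.erase y)) =
      ∑ x ∈ univ.filter (fun x => x ≠ y ∧ x ∈ addable (Q.erase y)), f (insert x (Q.erase y)) +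
        f Q := by
    intro y hy
    rw [mem_filter] at hy
    rw [← sum_filter_add_sum_filter_not _ (fun x => x ≠ y)]
    congr 1
    · refine sum_congr ?_ fun _ _ => rfl
      ext x
      simp only [mem_filter, mem_univ, true_and]
      tauto
    · rw [show ((addable (Q.erase y)).filter fun x => ¬ x ≠ y) = {y} by
        ext x
        simp only [mem_filter, mem_singleton, not_not]
        constructor
        · exact fun h => h.2
        · rintro rfl
          exact ⟨addable_erase hy.1, rfl⟩, sum_singleton, insert_erase (mem_removable.1 hy.1).1]
  rw [sum_congr rfl e1, sum_congr rfl e2, sum_add_distrib, sum_add_distrib, sum_const, nsmul_eq_mul,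
    ← sum_filter, sum_const, nsmul_eq_mul]
  have e3 : ∑ x ∈ addable Q, ∑ y ∈ univ.filter (fun y => κ y = i ∧ x ≠ y ∧ y ∈ removable (insert x Q)),
        f (insert x (Q.erase y)) =
      ∑ y ∈ (removable Q).filter (fun y => κ y = i),
        ∑ x ∈ univ.filter (fun x => x ≠ y ∧ x ∈ addable (Q.erase y)), f (insert x (Q.erase y)) := by
    refine sum_comm' fun x y => ?_
    simp only [mem_filter, mem_univ, true_and]
    constructor
    · rintro ⟨h1, h2, h3, h4⟩
      obtain ⟨h5, h6⟩ := (add_remove_comm hQ h3).1 ⟨h1, h4⟩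
      exact ⟨⟨h3, h6⟩, h5, h2⟩
    · rintro ⟨⟨h1, h2⟩, h3, h4⟩
      obtain ⟨h5, h6⟩ := (add_remove_comm hQ h1).2 ⟨h3, h2⟩
      exact ⟨h5, h4, h1, h6⟩
  rw [e3]
  ring

/-- The recursion is that of localizations under multiplication by a simple reflection on the left.
The Chevalley formula of `F` is used at the reflected point, for `Q` and for each `Q.erase y`. -/
theorem isLocalization_insert (H : HeapColoring Set.univ κ A) {F : Finset P}
    (hF : IsUpperSet (F : Set P)) {m : P} (hm : m ∈ addable F) {ψ : (P → ℚ) → Finset P → ℚ}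
    (hψ : IsLocalization κ A F ψ) :
    IsLocalization κ A (insert m F) (localizationStep κ A m ψ) := by
  have hm' := (mem_addable_iff hF).1 hm
  have hmF := hm'.1
  refine ⟨fun a Q hne => ?_, fun a => ?_, fun a Q hQ => ?_, fun a => ?_⟩
  · by_cases h1 : ψ (reflect A (κ m) a) Q = 0
    · rw [localizationStep, h1, zero_add] at hne
      obtain ⟨y, hy, hy'⟩ := exists_ne_zero_of_sum_ne_zero (right_ne_zero_of_mul hne)
      rw [mem_filter] at hy
      have hr := mem_removable.1 hy.1
      refine ⟨hr.2.1, fun x hx => ?_⟩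
      have hsub := (hψ.support _ _ hy').2
      by_cases hxy : x = y
      · subst hxy
        rcases H.comp m trivial x trivial (Or.inl hy.2.symm) with h | h
        · rcases h.eq_or_lt with rfl | h
          · exact mem_insert_self _ _
          · exact mem_insert_of_mem (hm'.2 x h)
        · rcases h.eq_or_lt with rfl | h
          · exact mem_insert_self _ _
          · exact (hmF (hsub (mem_erase.2 ⟨h.ne', hr.2.1 h.le hx⟩))).elim
      · exact mem_insert_of_mem (hsub (mem_erase.2 ⟨hxy, hx⟩))
    · exact ⟨(hψ.support _ _ h1).1, (hψ.support _ _ h1).2.trans (subset_insert _ _)⟩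
  · rw [localizationStep, hψ.empty, show removable (∅ : Finset P) = ∅ by simp [removable]]
    simp
  · set b := reflect A (κ m) a with hb
    have hT : ∀ S : Finset P, ∑ p ∈ S, b (κ p) =
        ∑ p ∈ S, a (κ p) - (∑ p ∈ S, cartan A (κ m) (κ p)) * a (κ m) := by
      intro S
      simp only [hb, reflect]
      rw [sum_sub_distrib, sum_mul]
    -- Reflecting changes the sum of colours by a multiple of `a (κ m)`, and the multiple is the
    -- addable minus removable count. Outside the support of `ψ` both sides vanish.
    have hμ : ∀ S : Finset P, IsUpperSet (S : Set P) →
        (∑ p ∈ insert m F, a (κ p) - ∑ p ∈ S, a (κ p)) * ψ b S =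
          ∑ x ∈ addable S, ψ b (insert x S) +
            ((((addable S).filter fun x => κ x = κ m).card : ℚ) -
              ((removable S).filter fun x => κ x = κ m).card) * a (κ m) * ψ b S := by
      intro S hS
      have hch := hψ.chevalley b S hS
      rw [hT, hT] at hch
      by_cases h0 : ψ b S = 0
      · rw [h0, mul_zero] at hch
        rw [h0, ← hch]
        ring
      · rw [H.card_addable_sub_card_removable hF hm hS (hψ.support _ _ h0).2, ← hch,
          sum_insert hmF]
        ring
    -- Once `y` is removed, it is the only addable element of its colour and none is removable. The
    -- correction `a (κ m)` is then exactly the difference between the sums over `Q` and `Q.erase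
    -- y`.
    have hrem : ∀ y ∈ (removable Q).filter (fun y => κ y = κ m),
        (∑ p ∈ insert m F, a (κ p) - ∑ p ∈ Q, a (κ p)) * ψ b (Q.erase y) =
          ∑ x ∈ addable (Q.erase y), ψ b (insert x (Q.erase y)) := by
      intro y hy
      rw [mem_filter] at hy
      have hr := mem_removable.1 hy.1
      have hr' := (mem_removable_iff hQ).1 hy.1
      have h1 := hμ _ hr.2.2
      have c1 : (addable (Q.erase y)).filter (fun x => κ x = κ m) = {y} := by
        refine eq_singleton_iff_unique_mem.2 ⟨mem_filter.2 ⟨addable_erase hy.1, hy.2⟩, fun x hx => ?_⟩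
        rw [mem_filter, mem_addable_iff hr.2.2] at hx
        rcases H.comp x trivial y trivial (Or.inl (hx.2.trans hy.2.symm)) with h | h
        · rcases h.eq_or_lt with h | h
          · exact h
          · exact (notMem_erase y Q (hx.1.2 y h)).elim
        · by_contra hne
          exact hx.1.1 (mem_erase.2 ⟨hne, hQ h hr.1⟩)
      have c2 : (removable (Q.erase y)).filter (fun x => κ x = κ m) = ∅ := by
        rw [eq_empty_iff_forall_notMem]
        intro x hx
        rw [mem_filter, mem_removable_iff hr.2.2, mem_erase] at hx
        rcases H.comp x trivial y trivial (Or.inl (hx.2.trans hy.2.symm)) with h | h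
        · exact hr'.2 x hx.1.1.2 (lt_of_le_of_ne h hx.1.1.1)
        · obtain ⟨c, hyc, hcx⟩ := exists_le_covBy_of_lt (lt_of_le_of_ne h (Ne.symm hx.1.1.1))
          refine hx.1.2 c (mem_erase.2 ⟨?_, hQ hyc hr.1⟩) hcx.lt
          rintro rfl
          exact H.irrefl (κ m) (by simpa [hx.2, hy.2] using H.covBy c trivial x hcx)
      rw [c1, c2, card_singleton, card_empty] at h1
      rw [← add_sum_erase Q _ hr.1, hy.2]
      push_cast at h1
      linear_combination h1
    have hcomb := sum_addable_removable (κ := κ) Q hQ (κ m) (ψ b)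
    simp only [localizationStep]
    rw [← hb, mul_add, hμ Q hQ, mul_left_comm, mul_sum, sum_congr rfl hrem, sum_add_distrib,
      ← mul_sum]
    linear_combination a (κ m) * (-hcomb)
  -- By support only `y = m` contributes: `a (κ m)` is the root of `m`, and the reflection turns the
  -- roots of `F` into those of `insert m F`.
  · have h1 : ψ (reflect A (κ m) a) (insert m F) = 0 := by
      by_contra h
      exact hmF ((hψ.support _ _ h).2 (mem_insert_self _ _))
    have hmin : ∀ v ∈ insert m F, ¬ v < m := by
      intro v hv hvm
      rcases mem_insert.1 hv with rfl | hv
      · exact hvm.ne rfl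
      · exact hmF (hF hvm.le hv)
    have hrm : m ∈ (removable (insert m F)).filter fun y => κ y = κ m :=
      mem_filter.2 ⟨(mem_removable_iff (mem_addable.1 hm).2).2 ⟨mem_insert_self _ _, hmin⟩, rfl⟩
    rw [localizationStep, h1, zero_add, sum_eq_single_of_mem m hrm, erase_insert hmF, hψ.self,
      prod_insert hmF, root_of_minimal hmin]
    · congr 1
      refine prod_congr rfl fun p hp => ?_
      rw [H.root_erase (mem_insert_of_mem hp) (mem_insert_self _ _) hmin
        (ne_of_mem_of_not_mem hp hmF).symm, erase_insert hmF]
    · intro y hy hym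
      by_contra h
      exact hmF ((hψ.support _ _ h).2 (mem_erase.2 ⟨hym.symm, mem_insert_self _ _⟩))

end HeapColoring

end DComplete

/-! ### Hook lengths as roots, and counting linear extensions. -/

namespace DComplete

open Finset

open scoped Classical

variable {P : Type*} [PartialOrder P] [Fintype P]

namespace HeapColoring

variable {κ : P → P} {A : P → P → Prop}

theorem exists_isLocalization (H : HeapColoring Set.univ κ A) {F : Finset P}
    (hF : IsUpperSet (F : Set P)) : ∃ ψ, IsLocalization κ A F ψ := by
  induction hn : F.card generalizing F with
  | zero =>
    obtain rfl := card_eq_zero.1 hn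
    refine ⟨fun _ Q => if Q = ∅ then 1 else 0, fun a Q h => ?_, fun a => if_pos rfl,
      fun a Q _ => ?_, fun a => by simp⟩
    · obtain rfl : Q = ∅ := by
        by_contra hne
        exact h (if_neg hne)
      exact ⟨hF, Subset.rfl⟩
    · rw [sum_eq_zero fun x _ => if_neg (insert_ne_empty x Q)]
      split_ifs with h
      · simp [h]
      · simp
  | succ n ih =>
    obtain ⟨m, hm, hmin⟩ := (wellFounded_lt (α := P)).has_min {v | v ∈ F}
      (card_pos.1 (by omega : 0 < F.card))
    have hE := isUpperSet_erase hF (m := m) hmin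
    obtain ⟨ψ, hψ⟩ := ih hE (by rw [card_erase_of_mem hm]; omega)
    have := H.isLocalization_insert hE (m := m)
      (mem_addable.2 ⟨notMem_erase _ _, by rwa [insert_erase hm]⟩) hψ
    rw [insert_erase hm] at this
    exact ⟨_, this⟩

/-- Induction along `<`. At neck elements both sides satisfy the same recursion. An element that is
not a neck element is the lowest of its colour, and both sides count the elements at most `p`; the
diagonals only sort this count. -/
theorem hookLength_eq_root (H : HeapColoring Set.univ κ A) (p : P) :
    (hookLength p : ℚ) = root κ A univ p fun _ => 1 := by
  have hU : IsUpperSet ((univ : Finset P) : Set P) := by simpa using isUpperSet_univ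
  induction p using (wellFounded_lt (α := P)).induction with
  | _ p ih =>
    by_cases hp : IsNeckElement p
    · obtain ⟨p', w, z, h, hv⟩ := exists_hookVector_of_isNeckElement hp
      have hlt := h.lt
      obtain ⟨k, hk⟩ := isDIntervalWithSides_iff.1 h
      have : hookLength p = hookLength w + hookLength z - hookLength p' := by
        simp only [hookLength, hv, Pi.sub_apply, Pi.add_apply, sum_sub_distrib, sum_add_distrib]
      rw [this, H.root_neck hk hU (mem_univ _), ← ih w hlt.1, ← ih z hlt.2.1, ← ih p' hlt.2.2]
      push_cast
      rfl
    · have hκ : ∀ q ∈ (univ : Finset P), q < p → κ q ≠ κ p := by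
        intro q _ hqp he
        obtain ⟨q', -, hc⟩ := exists_consec_below hqp he
        obtain ⟨k, w, z, hd⟩ := H.dInt_of_consec q' trivial p hc
        exact hp (isNeckElement_iff.2 ⟨q', w, z, isDIntervalWithSides_iff.2 ⟨k, hd⟩⟩)
      have : hookLength p = ((univ.filter fun q => q ≤ p).card : ℤ) := by
        simp only [hookLength, hookVector_of_not_isNeckElement hp]
        rw [card_eq_sum_card_fiberwise (f := diagonalOf) (t := univ) fun _ _ => mem_coe.2 (mem_univ _)]
        push_cast
        refine sum_congr rfl fun D _ => ?_
        rw [Set.ncard_eq_toFinset_card']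
        congr 2
        ext q
        simp
      rw [this, H.root_eq_sum hU (mem_univ _) hκ]
      simp

end HeapColoring

/-- The ways of listing the complement of `Q` so that no element is listed before a larger one. -/
def downwardLists (Q : Finset P) : Set (List P) :=
  {l | l.Pairwise (fun a b => ¬ a ≤ b) ∧ ∀ x, x ∈ l ↔ x ∉ Q}

theorem cons_mem_downwardLists {Q : Finset P} (hQ : IsUpperSet (Q : Set P)) {x : P} {l : List P} :
    x :: l ∈ downwardLists Q ↔ x ∈ addable Q ∧ l ∈ downwardLists (insert x Q) := by
  simp only [downwardLists, Set.mem_ofPred_eq, List.pairwise_cons, List.mem_cons, mem_insert, not_or]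
  rw [mem_addable_iff hQ]
  constructor
  · rintro ⟨⟨h1, h2⟩, h3⟩
    refine ⟨⟨(h3 x).1 (Or.inl rfl), fun v hv => ?_⟩, h2, fun y => ⟨fun hy => ⟨?_, ?_⟩, fun hy => ?_⟩⟩
    · by_contra hvQ
      rcases (h3 v).2 hvQ with rfl | h
      · exact hv.ne rfl
      · exact h1 v h hv.le
    · rintro rfl
      exact h1 y hy le_rfl
    · exact (h3 y).1 (Or.inr hy)
    · exact ((h3 y).2 hy.2).resolve_left hy.1
  · rintro ⟨⟨h1, h2⟩, h3, h4⟩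
    refine ⟨⟨fun y hy hxy => ?_, h3⟩, fun y => ?_⟩
    · have := (h4 y).1 hy
      exact this.2 (h2 y (lt_of_le_of_ne hxy (Ne.symm this.1)))
    · rw [h4]
      constructor
      · rintro (rfl | h)
        exacts [h1, h.2]
      · intro h
        by_cases hy : y = x
        · exact Or.inl hy
        · exact Or.inr ⟨hy, h⟩

/-- The first listed element is an addable one, so the number of lists satisfies a recursion
parallel to `hf`; the factors `|P| - |Q|` accumulate to the factorial. -/
theorem exists_finset_downwardLists {f : Finset P → ℚ}
    (hf : ∀ Q : Finset P, IsUpperSet (Q : Set P) →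
      ((Fintype.card P : ℚ) - Q.card) * f Q = ∑ x ∈ addable Q, f (insert x Q))
    (Q : Finset P) (hQ : IsUpperSet (Q : Set P)) :
    ∃ S : Finset (List P), (∀ l, l ∈ S ↔ l ∈ downwardLists Q) ∧
      (S.card : ℚ) * f univ = (Fintype.card P - Q.card).factorial * f Q := by
  induction hn : Fintype.card P - Q.card generalizing Q with
  | zero =>
    have hle := card_le_univ Q
    obtain rfl : Q = univ := (card_eq_iff_eq_univ Q).1 (by omega)
    refine ⟨{[]}, fun l => ?_, by simp⟩
    simp only [mem_singleton, downwardLists, Set.mem_ofPred_eq, mem_univ, not_true_eq_false, iff_false]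
    constructor
    · rintro rfl
      simp
    · exact fun h => List.eq_nil_iff_forall_not_mem.2 h.2
  | succ n ih =>
    have hle := card_le_univ Q
    have hcard : ∀ x ∈ addable Q, Fintype.card P - (insert x Q).card = n := fun x hx => by
      rw [card_insert_of_notMem (mem_addable.1 hx).1]
      omega
    choose! S hS using fun x (hx : x ∈ addable Q) =>
      ih (insert x Q) (mem_addable.1 hx).2 (hcard x hx)
    refine ⟨(addable Q).biUnion fun x => (S x).image (List.cons x), fun l => ?_, ?_⟩
    · simp only [mem_biUnion, mem_image]
      constructor
      · rintro ⟨x, hx, l, hl, rfl⟩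
        exact (cons_mem_downwardLists hQ).2 ⟨hx, ((hS x hx).1 l).1 hl⟩
      · intro hl
        rcases l with _ | ⟨x, l⟩
        · have : Q = univ := eq_univ_iff_forall.2 fun x => by
            by_contra hx
            exact List.not_mem_nil ((hl.2 x).2 hx)
          rw [this, card_univ] at hn
          omega
        · obtain ⟨hx, hl⟩ := (cons_mem_downwardLists hQ).1 hl
          exact ⟨x, hx, l, ((hS x hx).1 l).2 hl, rfl⟩
    · rw [card_biUnion, Nat.cast_sum, sum_mul]
      · have : ∀ x ∈ addable Q, (((S x).image (List.cons x)).card : ℚ) * f univ =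
            n.factorial * f (insert x Q) := fun x hx => by
          rw [card_image_of_injective _ List.cons_injective, (hS x hx).2]
        rw [sum_congr rfl this, ← mul_sum, ← hf Q hQ, Nat.factorial_succ]
        have hn' : (Fintype.card P : ℚ) - Q.card = n + 1 := by
          rw [← Nat.cast_sub hle, hn]
          push_cast
          rfl
        rw [hn']
        push_cast
        ring
      · intro x _ y _ hxy
        rw [Function.onFun, disjoint_left]
        simp only [mem_image]
        rintro _ ⟨l, _, rfl⟩ ⟨l', _, h⟩
        exact hxy (List.cons.inj h).1.symm

/-- Listing a poset from the top to the bottom along a linear extension. -/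
theorem card_linExt : Nat.card (LinExt P) = (downwardLists (∅ : Finset P)).ncard := by
  let Φ : LinExt P → downwardLists (∅ : Finset P) := fun f =>
    ⟨(List.ofFn f.1.symm).reverse, by
      refine ⟨?_, fun x => by simpa using f.1.symm.surjective x⟩
      rw [List.pairwise_reverse, List.pairwise_ofFn]
      intro i j hij hle
      have := f.2 hle
      simp only [Equiv.apply_symm_apply] at this
      exact this.not_gt hij⟩
  rw [← Nat.card_coe_set_eq]
  refine Nat.card_congr (Equiv.ofBijective Φ ⟨fun f g h => ?_, fun ⟨l, h1, h2⟩ => ?_⟩)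
  · have h' : (List.ofFn f.1.symm).reverse = (List.ofFn g.1.symm).reverse := congrArg Subtype.val h
    have h3 := List.ofFn_injective (List.reverse_injective h')
    refine Subtype.ext ?_
    rw [← f.1.symm_symm, ← g.1.symm_symm, Equiv.coe_fn_injective h3]
  · have h1' : l.reverse.Pairwise fun a b => ¬ b ≤ a := List.pairwise_reverse.2 h1
    have hnd : l.reverse.Nodup := h1'.imp fun h e => h e.ge
    have hmem : ∀ x, x ∈ l.reverse := fun x => by simp [h2]
    have hlen : l.reverse.length = Fintype.card P := by
      rw [← List.toFinset_card_of_nodup hnd, ← card_univ]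
      congr 1
      ext x
      simpa using hmem x
    let e := hnd.getEquivOfForallMemList _ hmem
    refine ⟨⟨(e.symm.trans (finCongr hlen)), fun x y hxy => ?_⟩, ?_⟩
    · by_contra hlt
      have hlt' : e.symm y < e.symm x := by simpa using hlt
      have := List.pairwise_iff_get.1 h1' _ _ hlt'
      have h3 : ∀ x, l.reverse.get (e.symm x) = x := fun x => e.apply_symm_apply x
      rw [h3, h3] at this
      exact this hxy
    · refine Subtype.ext ?_
      change (List.ofFn _).reverse = l
      rw [List.reverse_eq_iff]
      refine List.ext_get (by simp [← hlen]) fun n h1 h2 => ?_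
      simp [e]

end DComplete

theorem mainTheorem2 (P : Type*) [PartialOrder P] [Fintype P] (hP : DComplete.IsDComplete P) :
    (Nat.card (DComplete.LinExt P) : ℚ) =
      ((Fintype.card P).factorial : ℚ) / ∏ p : P, (DComplete.hookLength p : ℚ) := by
  obtain ⟨κ, A, H⟩ := hP.exists_heapColoring
  have hU : IsUpperSet ((Finset.univ : Finset P) : Set P) := by simpa using isUpperSet_univ
  obtain ⟨ψ, hψ⟩ := H.exists_isLocalization hU
  obtain ⟨S, hS, hcard⟩ := DComplete.exists_finset_downwardLists (f := ψ fun _ => 1)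
    (fun Q hQ => by simpa using hψ.chevalley (fun _ => 1) Q hQ) ∅ (by simpa using isUpperSet_empty)
  have h1 : Nat.card (DComplete.LinExt P) = S.card := by
    rw [DComplete.card_linExt, ← Set.ncard_coe_finset]
    congr 1
    ext l
    exact (hS l).symm
  have h2 : ψ (fun _ => 1) Finset.univ = ∏ p : P, (DComplete.hookLength p : ℚ) := by
    rw [hψ.self]
    exact Finset.prod_congr rfl fun p _ => (H.hookLength_eq_root p).symm
  rw [h2, hψ.empty, Finset.card_empty, Nat.sub_zero, mul_one] at hcard
  rw [h1, eq_div_iff, hcard]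
  -- No hook length vanishes, since the product times the number of linear extensions is a
  -- factorial.
  intro h0
  rw [h0, mul_zero] at hcard
  exact (Fintype.card P).factorial_ne_zero (by exact_mod_cast hcard.symm)
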